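/- **Setting.** Fix a capacity $C\in\mathbb N$, a horizon $T>0$, coefficients $K_1,K_2,K_3$ (positive in the model) and a temperature $\gamma$ ($\ge 0$ in the model); the theorem holds for all real values of these four numbers. Let $\mathcal X=\{0,\dots,C\}$. On a probability space let $N^\lambda$ (customer arrivals) and $N^\mu$ (services) be Poisson processes on $[0,T]$ with nonnegative integrable rate functions $\lambda(t)$ and $\mu(t)$, and let $U_1,U_2,\dots$ be i.i.d. uniform on $[0,1]$, with $N^\lambda$, $N^\mu$ and $(U_k)$ independent. A policy $\boldsymbol\pi$ assigns to $(t,x)\in[0,T]\times\mathcal X$ a Bernoulli distribution on $\{0,1\}$ (1 = admit) with success probability $\boldsymbol\pi(1\mid t,x)$, measurable in $t$, with $\boldsymbol\pi(1\mid t,C)=0$; $\mathcal H(\boldsymbol\pi(\cdot\mid t,x))=-\sum_{a\in\{0,1\}}\boldsymbol\pi(a\mid t,x)\log\boldsymbol\pi(a\mid t,x)$ (with $0\log 0=0$) is its entropy. The $k$-th arriving customer, arriving at time $\tau_k$, is admitted iff $U_k<\boldsymbol\pi(1\mid\tau_k,X_{\tau_k-})$; a jump of $N^\mu$ at time $s$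 is a departure iff $X_{s-}\ge 1$. The queue starts empty, $A_t$ and $D_t$ count the admissions and departures up to time $t$, and $X_t=A_t-D_t$. For $(t,x)\in[0,T]\times\mathcal X$ the value function of $\boldsymbol\pi$ is $$J(t,x;\boldsymbol\pi)=\mathbb E\Big[K_1\int_{(t,T]}dA_s-K_2\int_t^T X_{s-}\,ds-K_3X_T+\gamma\int_t^T\mathcal H(\boldsymbol\pi(\cdot\mid s,X_{s-}))\,ds\ \Big|\ X_t=x\Big],$$ where conditioning on $X_t=x$ means that the queue is started at time $t$ with $x$ customers. Let $v:[0,T]\times\mathcal X\to\mathbb R$ be continuously differentiable in $t\in[0,T]$ for each $x\in\mathcal X$, and consider the conditions (a) $v(T,x)=-K_3x$ for all $x\in\mathcal X$; (b) for every bounded process $\xi$ that is predictable with respect to the natural filtration of $X$ (so that $\xi_t$ is $\mathcal F^X_{t-}$-measurable for every $t$), $$\mathbb E\Big[\int_0^T\xi_t\big\{dv(t,X_t)+K_1\,dA_t-K_2X_{t-}\,dt+\gamma\mathcal H(\boldsymbol\pi(\cdot\mid t,X_{t-}))\,dt\big\}\Big]=0 .$$ **Theorem.** 1. Conditions (a)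 and (b) hold if and only if $v(t,x)=J(t,x;\boldsymbol\pi)$ for all those $(t,x)\in[0,T]\times\mathcal X$ for which $\mathbb P(X_s=x)>0$ for every $s\in(t,T]$ (for $t=T$ this is no restriction on $x$). 2. Consequently, if $\mathbb P(X_t=x)>0$ for all $t\in(0,T]$ and $x\in\mathcal X$, then $v$ is the value function of $\boldsymbol\pi$, i.e. $v(t,x)=J(t,x;\boldsymbol\pi)$ for all $(t,x)\in[0,T]\times\mathcal X$, if and only if (a) and (b) hold. -/

import Mathlib

open MeasureTheory ProbabilityTheory Set
open scoped NNReal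

/-- `N` is a (possibly non-homogeneous) Poisson process on `[0, T]` with rate function `rate`:
a counting process with `N 0 = 0`, monotone right-continuous paths and independent increments,
whose increment over `(s, t]` is Poisson distributed with mean `∫ u in s..t, rate u`.
Only the values of `N` on `[0, T]` are ever used. -/
structure IsPoissonProcess {Ω : Type*} [MeasurableSpace Ω] (P : Measure Ω) (T : ℝ)
    (rate : ℝ → ℝ) (N : ℝ → Ω → ℕ) : Prop where
  measurable : ∀ t, Measurable (N t)
  zero : ∀ ω, N 0 ω = 0
  mono : ∀ ω, Monotone fun t => N t ω
  right_cts : ∀ ω t, ContinuousWithinAt (fun s => N s ω) (Ioi t) t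
  law : ∀ s t, 0 ≤ s → s ≤ t → t ≤ T →
    P.map (fun ω => N t ω - N s ω) = poissonMeasure (∫ u in s..t, rate u).toNNReal
  indep : HasIndepIncrements (fun (t : Icc (0 : ℝ) T) ω => N t ω) P

/-- The data of the single-server queue with admission control: capacity, horizon, rate functions
of the arrivals and of the service process, reward and cost coefficients, temperature, and the
primitive random objects (arrival process, service process, and a sequence of independent uniform
variables which are used to sample the randomized actions, the `k`-th one for the `k`-th arriving
customer). -/
structure QueueModel (Ω : Type*) [MeasurableSpace Ω] (P : Measure Ω) where
  C : ℕ
  T : ℝ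
  T_pos : 0 < T
  arrRate : ℝ → ℝ
  srvRate : ℝ → ℝ
  arrRate_nonneg : ∀ t ∈ Icc 0 T, 0 ≤ arrRate t
  srvRate_nonneg : ∀ t ∈ Icc 0 T, 0 ≤ srvRate t
  arrRate_integrable : IntegrableOn arrRate (Icc 0 T)
  srvRate_integrable : IntegrableOn srvRate (Icc 0 T)
  K₁ : ℝ
  K₂ : ℝ
  K₃ : ℝ
  γ : ℝ
  arr : ℝ → Ω → ℕ
  srv : ℝ → Ω → ℕ
  unif : ℕ → Ω → ℝ
  arr_poisson : IsPoissonProcess P T arrRate arr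
  srv_poisson : IsPoissonProcess P T srvRate srv
  unif_measurable : ∀ k, Measurable (unif k)
  unif_law : ∀ k, P.map (unif k) = volume.restrict (Icc (0 : ℝ) 1)
  unif_indep : iIndepFun unif P
  arr_indep_srv : IndepFun (fun ω (t : Icc (0 : ℝ) T) => arr t ω)
    (fun ω (t : Icc (0 : ℝ) T) => srv t ω) P
  unif_indep_arr_srv : IndepFun (fun ω k => unif k ω)
    (fun ω => (fun t : Icc (0 : ℝ) T => arr t ω, fun t : Icc (0 : ℝ) T => srv t ω)) P

namespace QueueModel

variable {Ω : Type*} [MeasurableSpace Ω] {P : Measure Ω}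

/-- A randomized Markov admission policy: `prob t x` is the probability `π(1 ∣ t, x)` of admitting
a customer who arrives at time `t` and finds `x` customers in the system; in the full system only
the action `0` (reject) is available. -/
structure Policy (Q : QueueModel Ω P) where
  prob : ℝ → ℕ → ℝ
  prob_mem : ∀ t ∈ Icc 0 Q.T, ∀ x ≤ Q.C, prob t x ∈ Icc (0 : ℝ) 1
  prob_full : ∀ t ∈ Icc 0 Q.T, prob t Q.C = 0
  measurable_prob : ∀ x, Measurable fun t : Icc (0 : ℝ) Q.T => prob t x

/-- The entropy of the Bernoulli distribution `π(· ∣ t, x)` on the actions `{0, 1}`. -/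
noncomputable def Policy.entropy {Q : QueueModel Ω P} (π : Q.Policy) (t : ℝ) (x : ℕ) : ℝ :=
  Real.negMulLog (π.prob t x) + Real.negMulLog (1 - π.prob t x)

variable (Q : QueueModel Ω P)

/-- The number of events (customer arrivals and service completions) in `[0, t]`. -/
def events (t : ℝ) (ω : Ω) : ℕ := Q.arr t ω + Q.srv t ω

/-- The time of the `n`-th event after time `t₀` (and `t₀` for `n = 0`); equal to `T` if there are
fewer than `n` events in `(t₀, T]`. -/
noncomputable def eventTime (t₀ : ℝ) (n : ℕ) (ω : Ω) : ℝ :=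
  sInf {t | t₀ ≤ t ∧ t ≤ Q.T ∧ (Q.events t₀ ω + n ≤ Q.events t ω ∨ t = Q.T)}

variable {Q} in
open scoped Classical in
/-- The numbers `(A, D)` of admitted customers and of departures in `(t₀, T]` up to and including
the `n`-th event after `t₀`, for the system that holds `x₀` customers at time `t₀`. An event at time
`e` is an arrival if `arr` has increased since the previous event, and a service completion
otherwise. An arriving customer who finds `x` customers is admitted if the uniform variable that
belongs to this customer is less than `π(1 ∣ e, x)`; a service completion leads to a departure
unless the system is empty. -/
noncomputable def counts (π : Q.Policy) (t₀ : ℝ) (x₀ : ℕ) (ω : Ω) : ℕ → ℕ × ℕ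
  | 0 => (0, 0)
  | n + 1 =>
    let AD := counts π t₀ x₀ ω n
    let x := x₀ + AD.1 - AD.2
    let e := Q.eventTime t₀ (n + 1) ω
    if Q.arr (Q.eventTime t₀ n ω) ω < Q.arr e ω then
      if Q.unif (Q.arr e ω) ω < π.prob e x then (AD.1 + 1, AD.2) else AD
    else
      if 0 < x then (AD.1, AD.2 + 1) else AD

/-- The number of events in `(t₀, t]`, where `t` is first projected to `[t₀, T]`. -/
noncomputable def numEvents (t₀ t : ℝ) (ω : Ω) : ℕ :=
  Q.events (max t₀ (min t Q.T)) ω - Q.events t₀ ω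

variable {Q}

/-- The number of customers admitted in `(t₀, t]` under the policy `π`, for the system that holds
`x₀` customers at time `t₀`; constant in `t` before `t₀` and after `T`. -/
noncomputable def admitted (π : Q.Policy) (t₀ : ℝ) (x₀ : ℕ) (t : ℝ) (ω : Ω) : ℕ :=
  (counts π t₀ x₀ ω (Q.numEvents t₀ t ω)).1

/-- The number of departures in `(t₀, t]`, for the same system. -/
noncomputable def departed (π : Q.Policy) (t₀ : ℝ) (x₀ : ℕ) (t : ℝ) (ω : Ω) : ℕ :=
  (counts π t₀ x₀ ω (Q.numEvents t₀ t ω)).2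

/-- The queue length `X` at time `t` for the system that holds `x₀` customers at time `t₀`. The
state process of the model, which starts empty, is `queue π 0 0`. -/
noncomputable def queue (π : Q.Policy) (t₀ : ℝ) (x₀ : ℕ) (t : ℝ) (ω : Ω) : ℕ :=
  x₀ + admitted π t₀ x₀ t ω - departed π t₀ x₀ t ω

/-- The left limit `X_{t-}` of the queue length. -/
noncomputable def queueLeft (π : Q.Policy) (t₀ : ℝ) (x₀ : ℕ) (t : ℝ) (ω : Ω) : ℕ :=
  Function.leftLim (fun s => queue π t₀ x₀ s ω) t

/-- The entropy-regularized value function `J(t, x; π)`. The conditional expectation given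
`X_t = x` is the expectation for the queue which is started with `x` customers at time `t`
(and driven by the arrivals, services and uniform variables after `t`). -/
noncomputable def valueFunction (π : Q.Policy) (t : ℝ) (x : ℕ) : ℝ :=
  ∫ ω, (Q.K₁ * (admitted π t x Q.T ω : ℝ)
    - Q.K₂ * (∫ s in t..Q.T, (queueLeft π t x s ω : ℝ))
    - Q.K₃ * (queue π t x Q.T ω : ℝ)
    + Q.γ * (∫ s in t..Q.T, π.entropy s (queueLeft π t x s ω))) ∂P

/-- The state `x` is occupied with positive probability at every time in `(t, T]`. -/
def Accessible (π : Q.Policy) (t : ℝ) (x : ℕ) : Prop :=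
  ∀ s, t < s → s ≤ Q.T → 0 < P {ω | queue π 0 0 s ω = x}

/-! Measurability of the queue length, which is needed for its natural filtration. -/

lemma measurable_at_random_time {N : ℝ → Ω → ℕ} (hN : ∀ t, Measurable (N t))
    (hm : ∀ ω, Monotone fun t => N t ω)
    (hr : ∀ ω t, ContinuousWithinAt (fun s => N s ω) (Ioi t) t)
    {e : Ω → ℝ} (he : Measurable e) : Measurable fun ω => N (e ω) ω := by
  have key : ∀ k : ℕ, {ω | k ≤ N (e ω) ω} = ⋂ q : ℚ, {ω | e ω < q → k ≤ N q ω} := by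
    intro k
    ext ω
    simp only [mem_ofPred_eq, mem_iInter]
    refine ⟨fun h q hq => h.trans (hm ω hq.le), fun h => ?_⟩
    have h1 : ∀ᶠ s in nhdsWithin (e ω) (Ioi (e ω)), N s ω = N (e ω) ω :=
      (hr ω (e ω)).eventually_mem (mem_nhds_discrete.mpr rfl : {N (e ω) ω} ∈ nhds (N (e ω) ω))
    obtain ⟨b, hb, hsub⟩ := mem_nhdsGT_iff_exists_Ioo_subset.mp h1
    obtain ⟨q, hq1, hq2⟩ := exists_rat_btwn (mem_Ioi.mp hb)
    have h2 : N q ω = N (e ω) ω := hsub ⟨hq1, hq2⟩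
    exact h2 ▸ h q hq1
  refine measurable_of_Ici fun k => ?_
  change MeasurableSet {ω | k ≤ N (e ω) ω}
  rw [key k]
  refine MeasurableSet.iInter fun q => ?_
  have : {ω | e ω < q → k ≤ N q ω} = {ω | e ω < q}ᶜ ∪ {ω | k ≤ N q ω} := by
    ext ω; simp only [mem_ofPred_eq, mem_union, mem_compl_iff]; tauto
  rw [this]
  exact (measurableSet_lt he measurable_const).compl.union (hN q measurableSet_Ici)

lemma measurable_events (t : ℝ) : Measurable (Q.events t) :=
  (Q.arr_poisson.measurable t).add (Q.srv_poisson.measurable t)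

lemma eventTime_mem {t₀ : ℝ} (h₀ : t₀ ≤ Q.T) (n : ℕ) (ω : Ω) :
    Q.eventTime t₀ n ω ∈ Icc t₀ Q.T :=
  ⟨le_csInf ⟨Q.T, h₀, le_rfl, Or.inr rfl⟩ fun _ h => h.1,
    csInf_le ⟨t₀, fun _ h => h.1⟩ ⟨h₀, le_rfl, Or.inr rfl⟩⟩

lemma measurable_eventTime {t₀ : ℝ} (h₀ : t₀ ≤ Q.T) (n : ℕ) :
    Measurable (Q.eventTime t₀ n) := by
  have key : ∀ c : ℝ, {ω | Q.eventTime t₀ n ω < c} =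
      {_ω | Q.T < c} ∪ ⋃ q : ℚ, {ω | (t₀ ≤ q ∧ (q : ℝ) < c) ∧ (q : ℝ) ≤ Q.T ∧
        Q.events t₀ ω + n ≤ Q.events q ω} := by
    intro c
    ext ω
    have hbdd : BddBelow {t | t₀ ≤ t ∧ t ≤ Q.T ∧
        (Q.events t₀ ω + n ≤ Q.events t ω ∨ t = Q.T)} := ⟨t₀, fun _ h => h.1⟩
    have hne : {t | t₀ ≤ t ∧ t ≤ Q.T ∧
        (Q.events t₀ ω + n ≤ Q.events t ω ∨ t = Q.T)}.Nonempty :=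
      ⟨Q.T, h₀, le_rfl, Or.inr rfl⟩
    simp only [mem_ofPred_eq, mem_union, mem_iUnion]
    rw [eventTime, csInf_lt_iff hbdd hne]
    constructor
    · rintro ⟨t, ⟨h1, h2, h3⟩, h4⟩
      rcases h2.lt_or_eq with h5 | h5
      · rcases h3 with h3 | h3
        · obtain ⟨q, hq1, hq2⟩ := exists_rat_btwn (lt_min h4 h5)
          refine Or.inr ⟨q, ⟨h1.trans hq1.le, hq2.trans_le (min_le_left _ _)⟩,
            hq2.le.trans (min_le_right _ _), h3.trans ?_⟩
          exact add_le_add (Q.arr_poisson.mono ω hq1.le) (Q.srv_poisson.mono ω hq1.le)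
        · exact absurd h3 h5.ne
      · exact Or.inl (h5 ▸ h4)
    · rintro (h | ⟨q, ⟨h1, h2⟩, h3, h4⟩)
      · exact ⟨Q.T, ⟨h₀, le_rfl, Or.inr rfl⟩, h⟩
      · exact ⟨q, ⟨h1, h3, Or.inl h4⟩, h2⟩
  refine measurable_of_Iio fun c => ?_
  change MeasurableSet {ω | Q.eventTime t₀ n ω < c}
  rw [key c]
  refine (MeasurableSet.const _).union (MeasurableSet.iUnion fun q => ?_)
  exact (MeasurableSet.const _).inter ((MeasurableSet.const _).inter
    (measurableSet_le ((measurable_events t₀).add_const n) (measurable_events _)))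

lemma measurable_counts (π : Q.Policy) {t₀ : ℝ} (h₀ : t₀ ∈ Icc 0 Q.T) (x₀ n : ℕ) :
    Measurable fun ω => counts π t₀ x₀ ω n := by
  classical
  induction n with
  | zero => exact measurable_const
  | succ n ih =>
    have he : ∀ n, Measurable (Q.eventTime t₀ n) := measurable_eventTime h₀.2
    have harr : ∀ n, Measurable fun ω => Q.arr (Q.eventTime t₀ n ω) ω := fun n =>
      measurable_at_random_time Q.arr_poisson.measurable Q.arr_poisson.mono
        Q.arr_poisson.right_cts (he n)
    have hx : Measurable fun ω => x₀ + (counts π t₀ x₀ ω n).1 - (counts π t₀ x₀ ω n).2 :=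
      (measurable_of_countable fun z : ℕ × ℕ => x₀ + z.1 - z.2).comp ih
    have hU : Measurable fun ω => Q.unif (Q.arr (Q.eventTime t₀ (n + 1) ω) ω) ω :=
      (measurable_from_prod_countable_right (f := fun z : ℕ × Ω => Q.unif z.1 z.2)
        Q.unif_measurable).comp ((harr (n + 1)).prodMk measurable_id)
    have hp : Measurable fun ω => π.prob (Q.eventTime t₀ (n + 1) ω)
        (x₀ + (counts π t₀ x₀ ω n).1 - (counts π t₀ x₀ ω n).2) := by
      have hmem : ∀ ω, Q.eventTime t₀ (n + 1) ω ∈ Icc 0 Q.T := fun ω =>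
        ⟨h₀.1.trans (eventTime_mem h₀.2 _ ω).1, (eventTime_mem h₀.2 _ ω).2⟩
      exact (measurable_from_prod_countable_right
        (f := fun z : ℕ × Icc (0 : ℝ) Q.T => π.prob z.2 z.1) π.measurable_prob).comp
          (hx.prodMk ((he (n + 1)).subtype_mk (h := hmem)))
    simp only [counts]
    refine Measurable.ite (measurableSet_lt (harr n) (harr (n + 1))) ?_ ?_
    · exact Measurable.ite (measurableSet_lt hU hp)
        ((measurable_of_countable fun z : ℕ × ℕ => (z.1 + 1, z.2)).comp ih) ih
    · exact Measurable.ite (measurableSet_lt measurable_const hx)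
        ((measurable_of_countable fun z : ℕ × ℕ => (z.1, z.2 + 1)).comp ih) ih

lemma measurable_queue (π : Q.Policy) {t₀ : ℝ} (h₀ : t₀ ∈ Icc 0 Q.T) (x₀ : ℕ) (t : ℝ) :
    Measurable (queue π t₀ x₀ t) := by
  have hn : Measurable (Q.numEvents t₀ t) :=
    (measurable_events _).sub (measurable_events _)
  have hc : Measurable fun ω => counts π t₀ x₀ ω (Q.numEvents t₀ t ω) :=
    (measurable_from_prod_countable_right (f := fun z : ℕ × Ω => counts π t₀ x₀ z.2 z.1)
      (measurable_counts π h₀ x₀)).comp (hn.prodMk measurable_id)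
  exact (measurable_of_countable fun z : ℕ × ℕ => x₀ + z.1 - z.2).comp hc

/-- The natural filtration of the state process (which is constant after time `T`). -/
noncomputable def naturalFiltration (π : Q.Policy) :
    Filtration ℝ≥0 (inferInstance : MeasurableSpace Ω) :=
  Filtration.natural (fun t : ℝ≥0 => queue π 0 0 t) fun t =>
    (measurable_queue π ⟨le_rfl, Q.T_pos.le⟩ 0 t).stronglyMeasurable

open scoped Classical in
/-- The Lebesgue-Stieltjes integral `∫_{(0, T]} g df` against a function of bounded variation. -/
noncomputable def stieltjesIntegral (T : ℝ) (g f : ℝ → ℝ) : ℝ :=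
  if hf : BoundedVariationOn f univ then ∫ᵛ t in Ioc 0 T, g t ∂•hf.vectorMeasure else 0

/-- The pathwise integral
`∫₀ᵀ ξ_t {dv(t, X_t) + K₁ dA_t - K₂ X_{t-} dt + γ H(π(· ∣ t, X_{t-})) dt}`. The path
`t ↦ v(t, X_t)` is extended from `[0, T]` to the real line by constants. -/
noncomputable def tdIntegral (π : Q.Policy) (v : ℝ → ℕ → ℝ) (ξ : ℝ≥0 → Ω → ℝ) (ω : Ω) : ℝ :=
  stieltjesIntegral Q.T (fun t => ξ t.toNNReal ω)
      (fun t => v (max 0 (min t Q.T)) (queue π 0 0 t ω))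
    + Q.K₁ * stieltjesIntegral Q.T (fun t => ξ t.toNNReal ω)
      (fun t => (admitted π 0 0 t ω : ℝ))
    - Q.K₂ * (∫ t in (0 : ℝ)..Q.T, ξ t.toNNReal ω * (queueLeft π 0 0 t ω : ℝ))
    + Q.γ * (∫ t in (0 : ℝ)..Q.T, ξ t.toNNReal ω * π.entropy t (queueLeft π 0 0 t ω))

/-- The martingale orthogonality condition, for all bounded test processes that are predictable
with respect to the natural filtration of the state process. -/
def MartingaleOrthogonality (π : Q.Policy) (v : ℝ → ℕ → ℝ) : Prop :=
  ∀ ξ : ℝ≥0 → Ω → ℝ, IsStronglyPredictable (naturalFiltration π) ξ →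
    (∃ B : ℝ, ∀ t ω, |ξ t ω| ≤ B) → ∫ ω, tdIntegral π v ξ ω ∂P = 0

end QueueModel

/-!
Write `X` for the state process and `R (s, x)` for the reward that is collected after time `s` by the
queue started with `x` customers at time `s`, so that the value function `J (s, x)` is the expectation
of `R (s, x)`. If `v` has the right terminal values, then the flow property of the queue and the
fundamental theorem of calculus between the events show that for the test process
`ξ = 1_{(s, ∞) × A}` the pathwise integral equals `1_A (R (s, X_s) - v (s, X_s))`
(`QueueModel.tdIntegral_indicator`).

The indicators of these sets, with `A` in the natural filtration at time `s`, are essentially all that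
has to be tested: they and the negligible sets `{0} × A` form a π-system that generates the
predictable σ-algebra, and the expectation of the pathwise integral is a functional of the test
process that is represented by a finite signed measure, with one part that is absolutely continuous
in time and one part carried by the events (`QueueModel.integral_tdIntegral`). Hence
martingale orthogonality means that `R (s, X_s) - v (s, X_s)` integrates to zero over all such `A`
(`QueueModel.martingaleOrthogonality_iff`).

By the Markov property (`QueueModel.setIntegral_future`) the integral of `R (s, X_s) - v (s, X_s)`
over `A` is the sum over all `x ≤ C` of `P (A ∩ {X_s = x}) (J (s, x) - v (s, x))`
(`QueueModel.setIntegral_reward_sub`). The Markov property is read off from the independence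
assumptions: the queue up to time `s` is a function of the increments of the driving processes up to
`s` and of the uniform variables of the customers who have arrived by then, and the queue started at
`s` is the same function of the later increments and of the later uniform variables.

If `v = J` at the accessible states, then all terms of the sum vanish, because a state that is occupied
with positive probability at time `s` remains so at later times: with positive probability nothing
happens for a while (`QueueModel.prob_queue_eq_zero_of_not_accessible`). Conversely, the choice
`A = {X_s = x}` gives `v (s, x) = J (s, x)` whenever `P (X_s = x) > 0`. An accessible state at time `t`
is only known to be occupied with positive probability after time `t`, and the equality at `t` itself
follows since `v` is continuous and `J` is right-continuous in time
(`QueueModel.tendsto_valueFunction`).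
-/

/-! ### Counting paths and their jump times -/

/-- A monotone right-continuous `ℕ`-valued path. -/
structure IsCountingPath (N : ℝ → ℕ) : Prop where
  mono : Monotone N
  right_cts : ∀ t, ContinuousWithinAt N (Ioi t) t

namespace IsCountingPath

lemma exists_eq_right {N : ℝ → ℕ} (hN : IsCountingPath N) (t : ℝ) :
    ∃ b, t < b ∧ ∀ s ∈ Ico t b, N s = N t := by
  have h1 : ∀ᶠ s in nhdsWithin t (Ioi t), N s = N t :=
    (hN.right_cts t).eventually_mem (mem_nhds_discrete.mpr rfl : {N t} ∈ nhds (N t))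
  obtain ⟨b, hb, hsub⟩ := mem_nhdsGT_iff_exists_Ioo_subset.mp h1
  refine ⟨b, hb, fun s hs => ?_⟩
  rcases hs.1.eq_or_lt with h | h
  · rw [h]
  · exact hsub ⟨h, hs.2⟩

lemma add {M N : ℝ → ℕ} (hM : IsCountingPath M) (hN : IsCountingPath N) :
    IsCountingPath fun t => M t + N t :=
  ⟨hM.mono.add hN.mono, fun t => (hM.right_cts t).add (hN.right_cts t)⟩

/-- The part of a counting path after time `t`, stopped at time `T`. -/
lemma after {N : ℝ → ℕ} (hN : IsCountingPath N) (t T : ℝ) :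
    IsCountingPath fun s => N (max t (min s T)) - N t := by
  refine ⟨fun r s h => Nat.sub_le_sub_right (hN.mono (by gcongr)) _, fun s => ?_⟩
  have h1 : Monotone fun s => max t (min s T) := fun r s h => by dsimp only; gcongr
  obtain ⟨b, hb, hb'⟩ := hN.exists_eq_right (max t (min s T))
  refine ContinuousWithinAt.congr_of_eventuallyEq continuousWithinAt_const ?_ rfl
  have h2 : ∀ᶠ r in nhdsWithin s (Ioi s), max t (min r T) < b :=
    nhdsWithin_le_nhds ((by fun_prop : Continuous fun r => max t (min r T)).continuousAt.eventually
      (gt_mem_nhds hb))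
  filter_upwards [h2, self_mem_nhdsWithin] with r hr hr'
  rw [hb' _ ⟨h1 (le_of_lt hr'), hr⟩]

end IsCountingPath

/-- The time of the `n`-th jump of `N` after `t₀`, and `T` if there are fewer than `n` jumps in
`(t₀, T]`. A jump of size `k` counts as `k` jumps at the same time. -/
noncomputable def jumpTime (T : ℝ) (N : ℝ → ℕ) (t₀ : ℝ) (n : ℕ) : ℝ :=
  sInf {t | t₀ ≤ t ∧ t ≤ T ∧ (N t₀ + n ≤ N t ∨ t = T)}

section jumpTime

variable {T : ℝ} {N : ℝ → ℕ} {t₀ : ℝ}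

lemma jumpTime_mem (h₀ : t₀ ≤ T) (n : ℕ) : jumpTime T N t₀ n ∈ Icc t₀ T := by
  rw [jumpTime]
  exact ⟨le_csInf ⟨T, h₀, le_rfl, Or.inr rfl⟩ fun _ h => h.1,
    csInf_le ⟨t₀, fun _ h => h.1⟩ ⟨h₀, le_rfl, Or.inr rfl⟩⟩

lemma jumpTime_zero (h₀ : t₀ ≤ T) : jumpTime T N t₀ 0 = t₀ :=
  le_antisymm (csInf_le ⟨t₀, fun _ h => h.1⟩ ⟨le_rfl, h₀, Or.inl le_rfl⟩) (jumpTime_mem h₀ 0).1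

/-- Right-continuity makes the infimum in the definition of the jump time a minimum. -/
lemma le_apply_jumpTime (hN : IsCountingPath N) (h₀ : t₀ ≤ T) {n : ℕ} (hn : N t₀ + n ≤ N T) :
    N t₀ + n ≤ N (jumpTime T N t₀ n) := by
  obtain ⟨b, hb, hb'⟩ := hN.exists_eq_right (jumpTime T N t₀ n)
  have hne : {t | t₀ ≤ t ∧ t ≤ T ∧ (N t₀ + n ≤ N t ∨ t = T)}.Nonempty :=
    ⟨T, h₀, le_rfl, Or.inr rfl⟩
  obtain ⟨t, ⟨h1, h2, h3⟩, h4⟩ := (csInf_lt_iff ⟨t₀, fun _ h => h.1⟩ hne).1 hb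
  have h5 : jumpTime T N t₀ n ≤ t := csInf_le ⟨t₀, fun _ h => h.1⟩ ⟨h1, h2, h3⟩
  rw [← hb' t ⟨h5, h4⟩]
  rcases h3 with h3 | rfl
  · exact h3
  · exact hn

lemma jumpTime_le_iff (hN : IsCountingPath N) {n : ℕ} (hn : N t₀ + n ≤ N T) {s : ℝ}
    (h1 : t₀ ≤ s) (h2 : s ≤ T) : jumpTime T N t₀ n ≤ s ↔ N t₀ + n ≤ N s :=
  ⟨fun h => (le_apply_jumpTime hN (h1.trans h2) hn).trans (hN.mono h),
    fun h => csInf_le ⟨t₀, fun _ h => h.1⟩ ⟨h1, h2, Or.inl h⟩⟩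

/-- Two paths with the same increments over `[t₀', t₁]` have the same jump times there; for the path
that is observed from `t₀` on, the numbering is shifted by the jumps in `(t₀, t₀']`. -/
lemma jumpTime_eq_of_increments_eq {N' : ℝ → ℕ} (hN : IsCountingPath N) (hN' : IsCountingPath N')
    {t₀' t₁ : ℝ} (h01 : t₀ ≤ t₀') (h12 : t₀' ≤ t₁) (h2T : t₁ ≤ T)
    (hinc : ∀ s ∈ Icc t₀' t₁, N s + N' t₀' = N' s + N t₀') {n : ℕ} (hn0 : 0 < n)
    (hn : N t₀' + n ≤ N t₁) :
    jumpTime T N t₀ (N t₀' - N t₀ + n) = jumpTime T N' t₀' n := by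
  have hk := hN.mono h01
  have hT := hN.mono h2T
  have hT' := hN'.mono h2T
  have h1 := hinc t₁ ⟨h12, le_rfl⟩
  have hn1 : N t₀ + (N t₀' - N t₀ + n) ≤ N T := by omega
  have hn2 : N' t₀' + n ≤ N' T := by omega
  have e1 : jumpTime T N t₀ (N t₀' - N t₀ + n) ≤ t₁ :=
    (jumpTime_le_iff hN hn1 (h01.trans h12) h2T).2 (by omega)
  have e2 : jumpTime T N' t₀' n ≤ t₁ := (jumpTime_le_iff hN' hn2 h12 h2T).2 (by omega)
  have m1 := jumpTime_mem (N := N) (h01.trans (h12.trans h2T)) (N t₀' - N t₀ + n)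
  have m2 := jumpTime_mem (N := N') (h12.trans h2T) n
  have e3 : t₀' ≤ jumpTime T N t₀ (N t₀' - N t₀ + n) := by
    by_contra h
    have h3 := (jumpTime_le_iff hN hn1 h01 (h12.trans h2T)).1 (not_le.1 h).le
    omega
  refine le_antisymm ?_ ?_
  · rw [jumpTime_le_iff hN hn1 (h01.trans m2.1) m2.2]
    have := (jumpTime_le_iff hN' hn2 m2.1 m2.2).1 le_rfl
    have := hinc _ ⟨m2.1, e2⟩
    omega
  · rw [jumpTime_le_iff hN' hn2 e3 m1.2]
    have := (jumpTime_le_iff hN hn1 m1.1 m1.2).1 le_rfl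
    have := hinc _ ⟨e3, e1⟩
    omega

end jumpTime

/-! ### The queue as a function of its driver -/

/-- A realization of the primitive random objects: the paths of the arrival and service processes
and the sequence of uniform variables. If `k` customers have arrived, counting the present one, then
the admission of the present customer is decided by `unif k`; `unif 0` is never used. -/
structure QueuePath where
  arr : ℝ → ℕ
  srv : ℝ → ℕ
  unif : ℕ → ℝ

namespace QueuePath

/-- Both processes are counting paths. -/
structure IsCounting (w : QueuePath) : Prop where
  arr : IsCountingPath w.arr
  srv : IsCountingPath w.srv

/-- The number of events in `[0, t]`. -/
def events (w : QueuePath) (t : ℝ) : ℕ := w.arr t + w.srv t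

lemma IsCounting.events {w : QueuePath} (hw : w.IsCounting) : IsCountingPath w.events :=
  hw.arr.add hw.srv

open scoped Classical in
/-- The numbers of admissions and departures after the `n`-th event in `(t₀, T]`, for the queue that
holds `x₀` customers at time `t₀` and admits with probability `p e x` at time `e` in state `x`. -/
noncomputable def counts (T : ℝ) (p : ℝ → ℕ → ℝ) (w : QueuePath) (t₀ : ℝ) (x₀ : ℕ) : ℕ → ℕ × ℕ
  | 0 => (0, 0)
  | n + 1 =>
    let AD := counts T p w t₀ x₀ n
    let x := x₀ + AD.1 - AD.2
    let e := jumpTime T w.events t₀ (n + 1)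
    if w.arr (jumpTime T w.events t₀ n) < w.arr e then
      if w.unif (w.arr e) < p e x then (AD.1 + 1, AD.2) else AD
    else
      if 0 < x then (AD.1, AD.2 + 1) else AD

/-- The number of events in `(t₀, t]`, where `t` is first projected to `[t₀, T]`. -/
def numEvents (T : ℝ) (w : QueuePath) (t₀ t : ℝ) : ℕ :=
  w.events (max t₀ (min t T)) - w.events t₀

/-- The numbers of admissions and departures in `(t₀, t]`. -/
noncomputable def countsAt (T : ℝ) (p : ℝ → ℕ → ℝ) (w : QueuePath) (t₀ : ℝ) (x₀ : ℕ) (t : ℝ) :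
    ℕ × ℕ :=
  counts T p w t₀ x₀ (numEvents T w t₀ t)

/-- The queue length at time `t`, for the queue that holds `x₀` customers at time `t₀`. -/
noncomputable def state (T : ℝ) (p : ℝ → ℕ → ℝ) (w : QueuePath) (t₀ : ℝ) (x₀ : ℕ) (t : ℝ) : ℕ :=
  x₀ + (countsAt T p w t₀ x₀ t).1 - (countsAt T p w t₀ x₀ t).2

variable {T : ℝ} {p : ℝ → ℕ → ℝ} {w w' : QueuePath} {t₀ t₀' t₁ : ℝ} {x₀ x₀' : ℕ}

lemma counts_succ_cases (n : ℕ) :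
    counts T p w t₀ x₀ (n + 1) = counts T p w t₀ x₀ n ∨
    counts T p w t₀ x₀ (n + 1) = ((counts T p w t₀ x₀ n).1 + 1, (counts T p w t₀ x₀ n).2) ∨
    counts T p w t₀ x₀ (n + 1) = ((counts T p w t₀ x₀ n).1, (counts T p w t₀ x₀ n).2 + 1) := by
  simp only [counts]
  split_ifs <;> simp

lemma counts_fst_le (n : ℕ) : (counts T p w t₀ x₀ n).1 ≤ n := by
  induction n with
  | zero => simp [counts]
  | succ n ih => rcases counts_succ_cases (T := T) (p := p) (w := w) (t₀ := t₀) (x₀ := x₀) n with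
      h | h | h <;> rw [h] <;> grind

lemma counts_snd_le (n : ℕ) :
    (counts T p w t₀ x₀ n).2 ≤ x₀ + (counts T p w t₀ x₀ n).1 := by
  induction n with
  | zero => simp [counts]
  | succ n ih =>
    simp only [counts]
    split_ifs <;> grind

/-- The queue never exceeds the capacity, because nobody is admitted to the full system. -/
lemma counts_state_le {C : ℕ} (hp : ∀ t ∈ Icc t₀ T, p t C = 0) (hu : ∀ k, 0 ≤ w.unif k)
    (h₀ : t₀ ≤ T) (hx : x₀ ≤ C) (n : ℕ) :
    x₀ + (counts T p w t₀ x₀ n).1 - (counts T p w t₀ x₀ n).2 ≤ C := by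
  induction n with
  | zero => simpa [counts]
  | succ n ih =>
    simp only [counts]
    have := counts_snd_le (T := T) (p := p) (w := w) (t₀ := t₀) (x₀ := x₀) n
    split_ifs with h1 h2 h3 <;> try grind
    rcases ih.lt_or_eq with h | h
    · omega
    · rw [h, hp _ (jumpTime_mem h₀ _)] at h2
      exact absurd h2 (not_lt.2 (hu _))

lemma state_le {C : ℕ} (hp : ∀ t ∈ Icc t₀ T, p t C = 0) (hu : ∀ k, 0 ≤ w.unif k)
    (h₀ : t₀ ≤ T) (hx : x₀ ≤ C) (t : ℝ) : state T p w t₀ x₀ t ≤ C :=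
  counts_state_le hp hu h₀ hx _

lemma numEvents_of_mem {t : ℝ} (ht : t ∈ Icc t₀ T) :
    numEvents T w t₀ t = w.events t - w.events t₀ := by
  rw [numEvents, min_eq_left ht.2, max_eq_right ht.1]

lemma numEvents_self (h₀ : t₀ ≤ T) : numEvents T w t₀ t₀ = 0 := by
  rw [numEvents_of_mem ⟨le_rfl, h₀⟩, Nat.sub_self]

lemma countsAt_self (h₀ : t₀ ≤ T) : countsAt T p w t₀ x₀ t₀ = 0 := by
  rw [countsAt, numEvents_self h₀]; rfl

lemma numEvents_mono (hw : w.IsCounting) : Monotone (numEvents T w t₀) := fun r s h =>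
  Nat.sub_le_sub_right (hw.events.mono (by gcongr)) _

/-- The flow property together with the dependence of the queue on its drivers: if two drivers have
the same increments over `[t₀', t₁]` and use the same uniform variables there, then the first queue,
started at `t₀ ≤ t₀'`, continues after `t₀'` like the second one started from its state there. -/
lemma counts_add (hw : w.IsCounting) (hw' : w'.IsCounting) (h01 : t₀ ≤ t₀') (h12 : t₀' ≤ t₁)
    (h2T : t₁ ≤ T) (ha : ∀ s ∈ Icc t₀' t₁, w.arr s + w'.arr t₀' = w'.arr s + w.arr t₀')
    (hb : ∀ s ∈ Icc t₀' t₁, w.srv s + w'.srv t₀' = w'.srv s + w.srv t₀')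
    (hu : ∀ k, 0 < k → w.arr t₀' + k ≤ w.arr t₁ →
      w.unif (w.arr t₀' + k) = w'.unif (w'.arr t₀' + k))
    (hx : x₀' = x₀ + (counts T p w t₀ x₀ (w.events t₀' - w.events t₀)).1
      - (counts T p w t₀ x₀ (w.events t₀' - w.events t₀)).2)
    (n : ℕ) (hn : w.events t₀' + n ≤ w.events t₁) :
    counts T p w t₀ x₀ (w.events t₀' - w.events t₀ + n) =
      counts T p w t₀ x₀ (w.events t₀' - w.events t₀) + counts T p w' t₀' x₀' n := by
  have hinc : ∀ s ∈ Icc t₀' t₁, w.events s + w'.events t₀' = w'.events s + w.events t₀' := by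
    intro s hs
    have := ha s hs
    have := hb s hs
    simp only [events]; omega
  induction n with
  | zero => simp [counts]
  | succ n ih =>
    specialize ih (by omega)
    set k := w.events t₀' - w.events t₀ with hk
    have he : jumpTime T w.events t₀ (k + (n + 1)) = jumpTime T w'.events t₀' (n + 1) :=
      jumpTime_eq_of_increments_eq hw.events hw'.events h01 h12 h2T hinc n.succ_pos hn
    have hm := jumpTime_mem (N := w'.events) (h12.trans h2T) (n + 1)
    have hmono := hw.events.mono h01
    have hT := hw.events.mono h2T
    have hle : jumpTime T w.events t₀ (k + (n + 1)) ≤ t₁ :=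
      (jumpTime_le_iff hw.events (by omega) (h01.trans h12) h2T).2 (by omega)
    have hae : w.arr (jumpTime T w.events t₀ (k + (n + 1))) + w'.arr t₀' =
        w'.arr (jumpTime T w'.events t₀' (n + 1)) + w.arr t₀' := by
      rw [he] at hle ⊢
      exact ha _ ⟨hm.1, hle⟩
    have hae' : w.arr (jumpTime T w.events t₀ (k + n)) + w'.arr t₀' =
        w'.arr (jumpTime T w'.events t₀' n) + w.arr t₀' := by
      rcases n.eq_zero_or_pos with rfl | hn0
      · -- there is no event between the `k`-th event after `t₀` and time `t₀'`
        rw [jumpTime_zero (h12.trans h2T), add_zero, add_comm]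
        have h1 : jumpTime T w.events t₀ k ≤ t₀' :=
          (jumpTime_le_iff hw.events (by omega) h01 (h12.trans h2T)).2 (by omega)
        have h2 := le_apply_jumpTime hw.events (h01.trans (h12.trans h2T)) (n := k) (by omega)
        have h3 := hw.arr.mono h1
        have h4 := hw.srv.mono h1
        simp only [events] at h2 hk hmono
        omega
      · have he' : jumpTime T w.events t₀ (k + n) = jumpTime T w'.events t₀' n :=
          jumpTime_eq_of_increments_eq hw.events hw'.events h01 h12 h2T hinc hn0 (by omega)
        have hle' : jumpTime T w.events t₀ (k + n) ≤ t₁ :=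
          (jumpTime_le_iff hw.events (by omega) (h01.trans h12) h2T).2 (by omega)
        rw [he'] at hle' ⊢
        exact ha _ ⟨(jumpTime_mem (h12.trans h2T) n).1, hle'⟩
    have hstate : x₀ + (counts T p w t₀ x₀ (k + n)).1 - (counts T p w t₀ x₀ (k + n)).2 =
        x₀' + (counts T p w' t₀' x₀' n).1 - (counts T p w' t₀' x₀' n).2 := by
      have h1 := counts_snd_le (T := T) (p := p) (w := w) (t₀ := t₀) (x₀ := x₀) k
      have h2 := counts_snd_le (T := T) (p := p) (w := w') (t₀ := t₀') (x₀ := x₀') n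
      rw [ih]
      simp only [Prod.fst_add, Prod.snd_add]
      omega
    have hiff : (w.arr (jumpTime T w.events t₀ (k + n)) <
        w.arr (jumpTime T w.events t₀ (k + (n + 1)))) ↔
        w'.arr (jumpTime T w'.events t₀' n) < w'.arr (jumpTime T w'.events t₀' (n + 1)) := by
      omega
    rw [← add_assoc, counts, counts]
    simp only [hstate, add_assoc, hiff]
    by_cases h : w'.arr (jumpTime T w'.events t₀' n) < w'.arr (jumpTime T w'.events t₀' (n + 1))
    · have hmono' := hw'.arr.mono (jumpTime_mem (N := w'.events) (h12.trans h2T) n).1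
      have h1 := hw.arr.mono hle
      have hk' := hu (w'.arr (jumpTime T w'.events t₀' (n + 1)) - w'.arr t₀') (by omega) (by omega)
      have e1 : w.unif (w.arr (jumpTime T w.events t₀ (k + (n + 1)))) =
          w'.unif (w'.arr (jumpTime T w'.events t₀' (n + 1))) := by
        convert hk' using 2 <;> omega
      rw [e1, he, ih]
      split_ifs <;> (simp [Prod.ext_iff]; try omega)
    · rw [ih]
      split_ifs <;> (simp [Prod.ext_iff]; try omega)

lemma countsAt_add (hw : w.IsCounting) (hw' : w'.IsCounting) (h01 : t₀ ≤ t₀') (h12 : t₀' ≤ t₁)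
    (h2T : t₁ ≤ T) (ha : ∀ s ∈ Icc t₀' t₁, w.arr s + w'.arr t₀' = w'.arr s + w.arr t₀')
    (hb : ∀ s ∈ Icc t₀' t₁, w.srv s + w'.srv t₀' = w'.srv s + w.srv t₀')
    (hu : ∀ k, 0 < k → w.arr t₀' + k ≤ w.arr t₁ →
      w.unif (w.arr t₀' + k) = w'.unif (w'.arr t₀' + k))
    (hx : x₀' = state T p w t₀ x₀ t₀') {t : ℝ} (ht : t ∈ Icc t₀' t₁) :
    countsAt T p w t₀ x₀ t = countsAt T p w t₀ x₀ t₀' + countsAt T p w' t₀' x₀' t := by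
  have e1 : numEvents T w t₀ t₀' = w.events t₀' - w.events t₀ :=
    numEvents_of_mem ⟨h01, h12.trans h2T⟩
  have e2 : numEvents T w t₀ t = w.events t - w.events t₀ :=
    numEvents_of_mem ⟨h01.trans ht.1, ht.2.trans h2T⟩
  have e3 : numEvents T w' t₀' t = w.events t - w.events t₀' := by
    rw [numEvents_of_mem ⟨ht.1, ht.2.trans h2T⟩]
    have := ha t ht
    have := hb t ht
    have := hw.arr.mono ht.1
    have := hw.srv.mono ht.1
    simp only [events]; omega
  have m1 := hw.events.mono h01
  have m2 := hw.events.mono ht.1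
  have m3 := hw.events.mono ht.2
  rw [state, countsAt, e1] at hx
  rw [countsAt, countsAt, countsAt, e1, e2, e3,
    ← counts_add hw hw' h01 h12 h2T ha hb hu hx _ (by omega)]
  congr 1
  omega

/-- The flow property of the queue. -/
lemma countsAt_flow (hw : w.IsCounting) (h01 : t₀ ≤ t₀') {t : ℝ} (ht : t ∈ Icc t₀' T) :
    countsAt T p w t₀ x₀ t =
      countsAt T p w t₀ x₀ t₀' + countsAt T p w t₀' (state T p w t₀ x₀ t₀') t :=
  countsAt_add hw hw h01 (ht.1.trans ht.2) le_rfl (fun _ _ => rfl) (fun _ _ => rfl)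
    (fun _ _ _ => rfl) rfl ht

lemma state_flow (hw : w.IsCounting) (h01 : t₀ ≤ t₀') {t : ℝ} (ht : t ∈ Icc t₀' T) :
    state T p w t₀ x₀ t = state T p w t₀' (state T p w t₀ x₀ t₀') t := by
  have h1 := counts_snd_le (T := T) (p := p) (w := w) (t₀ := t₀) (x₀ := x₀) (numEvents T w t₀ t₀')
  rw [← countsAt] at h1
  set y := state T p w t₀ x₀ t₀' with hy
  rw [state, countsAt_flow hw h01 ht, ← hy, state]
  rw [state] at hy
  simp only [Prod.fst_add, Prod.snd_add]
  omega

/-- The queue depends only on the increments of its drivers and on the uniform variables that are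
used after the starting time. -/
lemma countsAt_congr (hw : w.IsCounting) (hw' : w'.IsCounting) (h12 : t₀ ≤ t₁)
    (h2T : t₁ ≤ T) (ha : ∀ s ∈ Icc t₀ t₁, w.arr s + w'.arr t₀ = w'.arr s + w.arr t₀)
    (hb : ∀ s ∈ Icc t₀ t₁, w.srv s + w'.srv t₀ = w'.srv s + w.srv t₀)
    (hu : ∀ k, 0 < k → w.arr t₀ + k ≤ w.arr t₁ →
      w.unif (w.arr t₀ + k) = w'.unif (w'.arr t₀ + k)) {t : ℝ} (ht : t ∈ Icc t₀ t₁) :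
    countsAt T p w t₀ x₀ t = countsAt T p w' t₀ x₀ t := by
  have h0 : countsAt T p w t₀ x₀ t₀ = 0 := countsAt_self (h12.trans h2T)
  rw [countsAt_add hw hw' le_rfl h12 h2T ha hb hu (x₀' := x₀) (by simp [state, h0]) ht, h0,
    zero_add]

end QueuePath

/-! ### Stieltjes integrals against piecewise smooth paths -/

section Stieltjes

/-- A function whose increments are dominated by those of a bounded monotone function has bounded
variation. -/
lemma boundedVariationOn_of_edist_le {f h : ℝ → ℝ} {C : ℝ} (hh : Monotone h) (hC : ∀ t, |h t| ≤ C)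
    (hfh : ∀ s t, s ≤ t → |f t - f s| ≤ h t - h s) : BoundedVariationOn f univ := by
  have h1 : BoundedVariationOn h univ :=
    (hh.monotoneOn univ).boundedVariationOn (C := C) fun x _ => hC x
  refine ne_top_of_le_ne_top h1 (iSup_le fun ⟨n, u, hu, _⟩ => ?_)
  refine le_trans (Finset.sum_le_sum fun i _ => ?_)
    (eVariationOn.sum_le (f := h) (n := n) hu fun i => mem_univ (u i))
  have h2 := hfh _ _ (hu i.le_succ)
  rw [edist_dist, edist_dist, Real.dist_eq, Real.dist_eq]
  exact ENNReal.ofReal_le_ofReal (h2.trans (le_abs_self _))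

lemma monotone_measureReal_Iic (μ : Measure ℝ) [IsFiniteMeasure μ] :
    Monotone fun t => μ.real (Iic t) := fun _ _ h => measureReal_mono (Iic_subset_Iic.2 h)

/-- Distribution functions are right-continuous. -/
lemma continuousWithinAt_measureReal_Iic (μ : Measure ℝ) [IsFiniteMeasure μ] (t : ℝ) :
    ContinuousWithinAt (fun t => μ.real (Iic t)) (Ioi t) t := by
  have h1 : Filter.Tendsto (fun s => μ (Iic s)) (nhdsWithin t (Ioi t)) (nhds (μ (Iic t))) := by
    have h2 : Iic t = ⋂ r > t, Iic r := by
      ext x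
      simp only [mem_Iic, mem_iInter]
      exact ⟨fun h r hr => h.trans hr.le, fun h => le_of_forall_gt_imp_ge_of_dense h⟩
    rw [h2]
    exact tendsto_measure_biInter_gt (fun _ _ => measurableSet_Iic.nullMeasurableSet)
      (fun _ _ _ h => Iic_subset_Iic.2 h) ⟨t + 1, by simp, measure_ne_top _ _⟩
  exact (ENNReal.tendsto_toReal (measure_ne_top _ _)).comp h1

variable {f : ℝ → ℝ} {c : ℝ} {μ₁ μ₂ : Measure ℝ} [IsFiniteMeasure μ₁] [IsFiniteMeasure μ₂]

lemma boundedVariationOn_of_eq_measureReal (hf : ∀ t, f t = c + μ₁.real (Iic t) - μ₂.real (Iic t)) :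
    BoundedVariationOn f univ := by
  refine boundedVariationOn_of_edist_le (C := μ₁.real univ + μ₂.real univ)
    ((monotone_measureReal_Iic μ₁).add (monotone_measureReal_Iic μ₂)) (fun t => ?_)
    fun s t hst => ?_
  · rw [abs_of_nonneg (by positivity)]
    exact add_le_add (measureReal_mono (subset_univ _)) (measureReal_mono (subset_univ _))
  · have h1 := monotone_measureReal_Iic μ₁ hst
    have h2 := monotone_measureReal_Iic μ₂ hst
    simp only at h1 h2 ⊢
    rw [hf, hf, abs_le]
    constructor <;> linarith

lemma measureReal_Ioc_eq (μ : Measure ℝ) [IsFiniteMeasure μ] {a b : ℝ} (h : a ≤ b) :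
    μ.real (Ioc a b) = μ.real (Iic b) - μ.real (Iic a) := by
  rw [← Iic_sdiff_Iic, measureReal_sdiff (Iic_subset_Iic.2 h) measurableSet_Iic]

/-- On `(0, T]`, the signed measure of `c + F₁ - F₂` with `F₁`, `F₂` the distribution functions of
`μ₁`, `μ₂` is `μ₁ - μ₂`: they agree on half-open intervals. -/
lemma restrict_vectorMeasure_eq (hf : ∀ t, f t = c + μ₁.real (Iic t) - μ₂.real (Iic t))
    (hb : BoundedVariationOn f univ) {T : ℝ} :
    hb.vectorMeasure.restrict (Ioc 0 T) =
      (μ₁.restrict (Ioc 0 T)).toSignedMeasure - (μ₂.restrict (Ioc 0 T)).toSignedMeasure := by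
  have hr : ∀ t, f.rightLim t = f t := fun t => by
    refine ContinuousWithinAt.rightLim_eq ?_
    rw [funext hf, ← continuousWithinAt_Ioi_iff_Ici]
    exact (continuousWithinAt_const.add (continuousWithinAt_measureReal_Iic μ₁ t)).sub
      (continuousWithinAt_measureReal_Iic μ₂ t)
  have key : ∀ a b, a ≤ b → hb.vectorMeasure (Ioc a b) = μ₁.real (Ioc a b) - μ₂.real (Ioc a b) := by
    intro a b hab
    rw [hb.vectorMeasure_Ioc hab, hr, hr, hf, hf, measureReal_Ioc_eq _ hab,
      measureReal_Ioc_eq _ hab]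
    ring
  have key' : ∀ a b, hb.vectorMeasure (Ioc a b) = μ₁.real (Ioc a b) - μ₂.real (Ioc a b) := by
    intro a b
    rcases le_total a b with h | h
    · exact key a b h
    · simp [Ioc_eq_empty_of_le h]
  refine VectorMeasure.ext_of_generateFrom {s | ∃ u v, u ≤ v ∧ s = Ioc u v} ?_ ?_ ?_ ?_
  · rintro s ⟨u, v, -, rfl⟩
    rw [VectorMeasure.restrict_apply _ measurableSet_Ioc measurableSet_Ioc, sub_apply,
      Measure.toSignedMeasure_apply_measurable measurableSet_Ioc,
      Measure.toSignedMeasure_apply_measurable measurableSet_Ioc,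
      measureReal_restrict_apply measurableSet_Ioc, measureReal_restrict_apply measurableSet_Ioc,
      Ioc_inter_Ioc, key']
  · rw [BorelSpace.measurable_eq (α := ℝ), borel_eq_generateFrom_Ioc_le ℝ]
    congr 1
    ext s
    simp only [mem_ofPred_eq, eq_comm]
  · rintro _ ⟨a, b, -, rfl⟩ _ ⟨a', b', -, rfl⟩ ⟨x, hx⟩
    rw [Ioc_inter_Ioc] at hx ⊢
    exact ⟨_, _, (hx.1.trans_le hx.2).le, rfl⟩
  · rw [VectorMeasure.restrict_apply _ measurableSet_Ioc MeasurableSet.univ,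
      sub_apply, Measure.toSignedMeasure_apply_measurable MeasurableSet.univ,
      Measure.toSignedMeasure_apply_measurable MeasurableSet.univ,
      measureReal_restrict_apply MeasurableSet.univ, measureReal_restrict_apply MeasurableSet.univ,
      univ_inter, key']

/-- The integral against a function that is, up to a constant, the difference of the distribution
functions of two finite measures. -/
lemma stieltjesIntegral_eq_sub (hf : ∀ t, f t = c + μ₁.real (Iic t) - μ₂.real (Iic t)) (T : ℝ)
    {g : ℝ → ℝ} (hg : Measurable g) {B : ℝ} (hB : ∀ t, |g t| ≤ B) :
    QueueModel.stieltjesIntegral T g f = (∫ t in Ioc 0 T, g t ∂μ₁) - ∫ t in Ioc 0 T, g t ∂μ₂ := by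
  have hb := boundedVariationOn_of_eq_measureReal hf
  have hint : ∀ (μ : Measure ℝ) [IsFiniteMeasure μ], μ.toSignedMeasure.Integrable g := by
    intro μ _
    rw [VectorMeasure.Integrable, Measure.variation_toSignedMeasure]
    exact Integrable.of_bound hg.aestronglyMeasurable B (.of_forall hB)
  have hflip : (ContinuousLinearMap.lsmul ℝ ℝ : ℝ →L[ℝ] ℝ →L[ℝ] ℝ) =
      (ContinuousLinearMap.lsmul ℝ ℝ).flip := by
    ext; simp
  rw [QueueModel.stieltjesIntegral, dif_pos hb, restrict_vectorMeasure_eq hf hb,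
    VectorMeasure.integral_sub_vectorMeasure (hint _) (hint _), hflip,
    VectorMeasure.integral_toSignedMeasure, VectorMeasure.integral_toSignedMeasure]

end Stieltjes

section JumpFormula

/-- The measure with density `G⁺` on `(0, T]` and with atoms of mass `(Δ k)⁺` at the points `e k`,
`k < κ`. -/
noncomputable def jumpMeasure (T : ℝ) (G : ℝ → ℝ) (κ : ℕ) (e Δ : ℕ → ℝ) : Measure ℝ :=
  (volume.restrict (Ioc 0 T)).withDensity (fun t => ENNReal.ofReal (G t)) +
    ∑ k ∈ Finset.range κ, ENNReal.ofReal (Δ k) • Measure.dirac (e k)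

variable {T : ℝ} {G : ℝ → ℝ} {κ : ℕ} {e Δ : ℕ → ℝ} {M : ℝ}

lemma isFiniteMeasure_withDensity_of_bounded (hG : ∀ t, |G t| ≤ M) :
    IsFiniteMeasure ((volume.restrict (Ioc 0 T)).withDensity fun t => ENNReal.ofReal (G t)) := by
  refine isFiniteMeasure_withDensity (ne_of_lt ?_)
  calc ∫⁻ t in Ioc 0 T, ENNReal.ofReal (G t) ≤ ∫⁻ _ in Ioc 0 T, ENNReal.ofReal M :=
        lintegral_mono fun t => ENNReal.ofReal_le_ofReal ((le_abs_self _).trans (hG t))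
    _ < ⊤ := by
        rw [setLIntegral_const]
        exact ENNReal.mul_lt_top ENNReal.ofReal_lt_top (by simp)

lemma isFiniteMeasure_jumpMeasure (hG : ∀ t, |G t| ≤ M) :
    IsFiniteMeasure (jumpMeasure T G κ e Δ) := by
  have := isFiniteMeasure_withDensity_of_bounded (T := T) hG
  have h2 : IsFiniteMeasure
      (∑ k ∈ Finset.range κ, ENNReal.ofReal (Δ k) • Measure.dirac (e k) : Measure ℝ) := by
    refine ⟨?_⟩
    rw [Measure.finsetSum_apply]
    refine ENNReal.sum_lt_top.2 fun k _ => ?_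
    simp
  rw [jumpMeasure]
  infer_instance

lemma integral_jumpMeasure (hGm : Measurable G) (hG : ∀ t, |G t| ≤ M) {g : ℝ → ℝ}
    (hg : Measurable g) {B : ℝ} (hB : ∀ t, |g t| ≤ B) :
    ∫ t, g t ∂jumpMeasure T G κ e Δ =
      (∫ t in Ioc 0 T, max (G t) 0 * g t) + ∑ k ∈ Finset.range κ, max (Δ k) 0 * g (e k) := by
  have := isFiniteMeasure_withDensity_of_bounded (T := T) hG
  have hint : ∀ k, Integrable g (ENNReal.ofReal (Δ k) • Measure.dirac (e k)) := fun k =>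
    (integrable_dirac' hg.stronglyMeasurable (by simp)).smul_measure ENNReal.ofReal_ne_top
  rw [jumpMeasure, integral_add_measure
    (Integrable.of_bound hg.aestronglyMeasurable B (.of_forall hB))
    (integrable_finsetSum_measure.2 fun k _ => hint k :
      Integrable g (∑ k ∈ Finset.range κ, ENNReal.ofReal (Δ k) • Measure.dirac (e k))),
    integral_finsetSum_measure fun k _ => hint k,
    integral_withDensity_eq_integral_toReal_smul (by fun_prop) (.of_forall fun _ => by simp)]
  congr 1
  refine Finset.sum_congr rfl fun k _ => ?_
  rw [integral_smul_measure, integral_dirac' _ _ hg.stronglyMeasurable, smul_eq_mul,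
    ENNReal.toReal_ofReal']

/-- Replacing `G` and `Δ` by their negatives gives the measure of the negative parts, so that the
difference of the two integrals is the integral against the signed rate `G` and the signed jumps
`Δ`. -/
lemma integral_jumpMeasure_sub (hGm : Measurable G) (hG : ∀ t, |G t| ≤ M) {g : ℝ → ℝ}
    (hg : Measurable g) {B : ℝ} (hB : ∀ t, |g t| ≤ B) :
    (∫ t, g t ∂jumpMeasure T G κ e Δ) - ∫ t, g t ∂jumpMeasure T (-G) κ e (-Δ) =
      (∫ t in Ioc 0 T, G t * g t) + ∑ k ∈ Finset.range κ, Δ k * g (e k) := by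
  have hpos : ∀ x : ℝ, max x 0 - max (-x) 0 = x := fun x => by
    rcases le_total 0 x with h | h <;> simp [h]
  have hint : ∀ {F : ℝ → ℝ}, Measurable F → (∀ t, |F t| ≤ M) →
      IntegrableOn (fun t => max (F t) 0 * g t) (Ioc 0 T) := by
    intro F hFm hF
    have : IsFiniteMeasure (volume.restrict (Ioc 0 T)) := ⟨by simp⟩
    refine Integrable.of_bound (by fun_prop) (M * B) (.of_forall fun t => ?_)
    rw [norm_mul, Real.norm_eq_abs, Real.norm_eq_abs]
    have h1 : |max (F t) 0| ≤ M := by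
      rw [abs_of_nonneg (le_max_right _ _)]
      exact max_le ((le_abs_self _).trans (hF t)) ((abs_nonneg _).trans (hF t))
    exact mul_le_mul h1 (hB t) (abs_nonneg _) ((abs_nonneg _).trans (hF t))
  have hG' : ∀ t, |(-G) t| ≤ M := fun t => by simpa using hG t
  rw [integral_jumpMeasure hGm hG hg hB, integral_jumpMeasure hGm.neg hG' hg hB,
    add_sub_add_comm, ← integral_sub (hint hGm hG) (hint hGm.neg hG'), ← Finset.sum_sub_distrib]
  simp only [Pi.neg_apply, ← sub_mul, hpos]

end JumpFormula

section PiecewiseSmooth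

variable {T : ℝ} {N : ℝ → ℕ}

/-- The number of jumps of `N` in `(0, t]`, where `t` is first projected to `[0, T]`. -/
def jumpCount (T : ℝ) (N : ℝ → ℕ) (t : ℝ) : ℕ := N (max 0 (min t T)) - N 0

lemma jumpCount_of_mem {t : ℝ} (ht : t ∈ Icc 0 T) : jumpCount T N t = N t - N 0 := by
  rw [jumpCount, min_eq_left ht.2, max_eq_right ht.1]

lemma monotone_jumpCount (hN : IsCountingPath N) : Monotone (jumpCount T N) :=
  (hN.after 0 T).mono

lemma jumpTime_le_iff_le_jumpCount (hN : IsCountingPath N) {n : ℕ} (hn : n ≤ jumpCount T N T)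
    {s : ℝ} (hs : s ∈ Icc 0 T) : jumpTime T N 0 n ≤ s ↔ n ≤ jumpCount T N s := by
  have h0 := hN.mono (hs.1.trans hs.2)
  have h1 := hN.mono hs.1
  rw [jumpCount_of_mem ⟨hs.1.trans hs.2, le_rfl⟩] at hn
  rw [jumpCount_of_mem hs, jumpTime_le_iff hN (by omega) hs.1 hs.2]
  omega

lemma measurable_comp_jumpCount (hN : IsCountingPath N) {g : ℝ → ℕ → ℝ}
    (hg : ∀ n, Measurable fun t => g t n) : Measurable fun t => g t (jumpCount T N t) :=
  (measurable_from_prod_countable_right (f := fun z : ℕ × ℝ => g z.2 z.1) hg).comp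
    ((monotone_jumpCount hN).measurable.prodMk measurable_id)

variable {W g : ℝ → ℕ → ℝ} {M : ℝ}

/-- The fundamental theorem of calculus for `t ↦ W t n` with `n` the number of jumps of `N` up to
time `t`: between the jumps the path grows with rate `g`, and the `k`-th jump adds the difference
of `W · k` and `W · (k - 1)`. -/
lemma piecewise_eq_integral_add_sum (hT : 0 ≤ T) (hN : IsCountingPath N)
    (hWc : ∀ n, ContinuousOn (fun t => W t n) (Icc 0 T))
    (hWd : ∀ n, ∀ t ∈ Ioo 0 T, HasDerivAt (fun t => W t n) (g t n) t)
    (hg : ∀ n, Measurable fun t => g t n) (hM : ∀ t n, |g t n| ≤ M) {t : ℝ} (ht : t ∈ Icc 0 T) :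
    W t (jumpCount T N t) = W 0 0 + (∫ r in 0..t, g r (jumpCount T N r)) +
      ∑ k ∈ Finset.range (jumpCount T N t),
        (W (jumpTime T N 0 (k + 1)) (k + 1) - W (jumpTime T N 0 (k + 1)) k) := by
  have hgm := measurable_comp_jumpCount (T := T) hN hg
  have hint : ∀ a b, IntervalIntegrable (fun r => g r (jumpCount T N r)) volume a b := fun a b =>
    (intervalIntegrable_const (c := M)).mono_fun hgm.aestronglyMeasurable
      (.of_forall fun r => (hM _ _).trans (le_abs_self M))
  have hint' : ∀ n a b, IntervalIntegrable (fun r => g r n) volume a b := fun n a b =>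
    (intervalIntegrable_const (c := M)).mono_fun (hg n).aestronglyMeasurable
      (.of_forall fun r => (hM _ _).trans (le_abs_self M))
  -- the increment over an interval without jumps in its interior
  have hpiece : ∀ k, ∀ a ∈ Icc 0 T, ∀ b ∈ Icc 0 T, a ≤ b →
      (∀ r ∈ Ioo a b, jumpCount T N r = k) →
      W b k = W a k + ∫ r in a..b, g r (jumpCount T N r) := by
    intro k a ha b hb hab hk
    have h1 : ∫ r in a..b, g r k = W b k - W a k :=
      intervalIntegral.integral_eq_sub_of_hasDerivAt_of_le hab
        ((hWc k).mono (Icc_subset_Icc ha.1 hb.2))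
        (fun x hx => hWd k x ⟨ha.1.trans_lt hx.1, hx.2.trans_le hb.2⟩) (hint' k a b)
    have h2 : ∫ r in a..b, g r (jumpCount T N r) = ∫ r in a..b, g r k := by
      rw [intervalIntegral.integral_of_le hab, intervalIntegral.integral_of_le hab,
        integral_Ioc_eq_integral_Ioo, integral_Ioc_eq_integral_Ioo]
      exact setIntegral_congr_fun measurableSet_Ioo fun r hr => by simp only [hk r hr]
    rw [h2, h1]; ring
  set e := jumpTime T N 0 with he
  have hmem : ∀ n, e n ∈ Icc 0 T := fun n => jumpTime_mem hT n
  have hTT : jumpCount T N t ≤ jumpCount T N T := monotone_jumpCount hN ht.2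
  have hstep : ∀ k ≤ jumpCount T N T, W (e k) k = W 0 0 + (∫ r in 0..e k, g r (jumpCount T N r)) +
      ∑ k ∈ Finset.range k, (W (e (k + 1)) (k + 1) - W (e (k + 1)) k) := by
    intro k
    induction k with
    | zero => intro _; simp [he, jumpTime_zero hT]
    | succ k ih =>
      intro hk
      specialize ih (by omega)
      have hle : e k ≤ e (k + 1) := by
        rw [he, jumpTime_le_iff_le_jumpCount hN (by omega) (hmem _)]
        exact (Nat.le_succ k).trans ((jumpTime_le_iff_le_jumpCount hN hk (hmem _)).1 le_rfl)
      have h1 := hpiece k _ (hmem k) _ (hmem (k + 1)) hle fun r hr => by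
        have hr' : r ∈ Icc 0 T := ⟨(hmem k).1.trans hr.1.le, hr.2.le.trans (hmem (k + 1)).2⟩
        have h2 := (jumpTime_le_iff_le_jumpCount hN (by omega) hr').1 hr.1.le
        have h3 := (jumpTime_le_iff_le_jumpCount hN hk hr').not.1 (not_le.2 hr.2)
        omega
      rw [Finset.sum_range_succ, ← intervalIntegral.integral_add_adjacent_intervals (hint 0 (e k))
        (hint (e k) (e (k + 1)))]
      linarith
  have hle : e (jumpCount T N t) ≤ t := (jumpTime_le_iff_le_jumpCount hN hTT ht).2 le_rfl
  have h1 := hpiece (jumpCount T N t) _ (hmem _) _ ht hle fun r hr => by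
    have hr' : r ∈ Icc 0 T := ⟨(hmem _).1.trans hr.1.le, hr.2.le.trans ht.2⟩
    have h2 := (jumpTime_le_iff_le_jumpCount hN hTT hr').1 hr.1.le
    exact le_antisymm (monotone_jumpCount hN hr.2.le) h2
  rw [h1, hstep _ hTT, ← intervalIntegral.integral_add_adjacent_intervals
    (hint 0 (e (jumpCount T N t))) (hint (e (jumpCount T N t)) t)]
  ring

/-- The Stieltjes integral against a path that is smooth between the jumps of `N`. By
`piecewise_eq_integral_add_sum`, this path is a constant plus the difference of the distribution
functions of two measures `jumpMeasure`. -/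
lemma stieltjesIntegral_piecewise (hT : 0 ≤ T) (hN : IsCountingPath N)
    (hWc : ∀ n, ContinuousOn (fun t => W t n) (Icc 0 T))
    (hWd : ∀ n, ∀ t ∈ Ioo 0 T, HasDerivAt (fun t => W t n) (g t n) t)
    (hg : ∀ n, Measurable fun t => g t n) (hM : ∀ t n, |g t n| ≤ M)
    {ξ : ℝ → ℝ} (hξ : Measurable ξ) {B : ℝ} (hB : ∀ t, |ξ t| ≤ B) :
    QueueModel.stieltjesIntegral T ξ (fun t => W (max 0 (min t T)) (jumpCount T N t)) =
      (∫ t in 0..T, ξ t * g t (jumpCount T N t)) +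
      ∑ k ∈ Finset.range (jumpCount T N T), ξ (jumpTime T N 0 (k + 1)) *
        (W (jumpTime T N 0 (k + 1)) (k + 1) - W (jumpTime T N 0 (k + 1)) k) := by
  set G : ℝ → ℝ := fun t => g t (jumpCount T N t) with hG
  set κ := jumpCount T N T with hκ
  set e : ℕ → ℝ := fun k => jumpTime T N 0 (k + 1) with he
  set Δ : ℕ → ℝ := fun k => W (e k) (k + 1) - W (e k) k with hΔ
  have hGm : Measurable G := measurable_comp_jumpCount hN hg
  have hGM : ∀ t, |G t| ≤ M := fun t => hM _ _
  have hGM' : ∀ t, |(-G) t| ≤ M := fun t => by simpa using hM _ _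
  have hmem : ∀ k, e k ∈ Icc 0 T := fun n => jumpTime_mem hT _
  have := isFiniteMeasure_jumpMeasure (T := T) (κ := κ) (e := e) (Δ := Δ) hGM
  have := isFiniteMeasure_jumpMeasure (T := T) (κ := κ) (e := e) (Δ := -Δ) hGM'
  have hpos : ∀ k < κ, 0 < e k := by
    intro k hk
    by_contra h
    have h1 := (jumpTime_le_iff_le_jumpCount hN (Nat.succ_le_of_lt hk)
      (left_mem_Icc.2 hT)).1 (not_lt.1 h)
    rw [jumpCount_of_mem (left_mem_Icc.2 hT)] at h1
    omega
  have hf : ∀ t, W (max 0 (min t T)) (jumpCount T N t) = W 0 0 +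
      (jumpMeasure T G κ e Δ).real (Iic t) - (jumpMeasure T (-G) κ e (-Δ)).real (Iic t) := by
    intro t
    set s := max 0 (min t T) with hs
    have hs' : s ∈ Icc 0 T := ⟨le_max_left _ _, max_le hT (min_le_right _ _)⟩
    have hst : jumpCount T N t = jumpCount T N s := by rw [jumpCount_of_mem hs']; rfl
    have h1 := integral_jumpMeasure_sub (T := T) (κ := κ) (e := e) (Δ := Δ) (B := 1)
      (g := (Iic t).indicator 1) hGm hGM (measurable_one.indicator measurableSet_Iic) fun r => by
        by_cases h : r ∈ Iic t <;> simp [h]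
    rw [integral_indicator_one measurableSet_Iic, integral_indicator_one measurableSet_Iic] at h1
    rw [add_sub_assoc, h1, hst, piecewise_eq_integral_add_sum hT hN hWc hWd hg hM hs', add_assoc]
    congr 2
    · rw [intervalIntegral.integral_of_le hs'.1]
      have h2 : Ioc 0 s = Ioc 0 T ∩ Iic t := by
        ext r
        simp only [hs, mem_Ioc, mem_inter_iff, mem_Iic, le_max_iff, le_min_iff]
        grind
      have h3 : ∀ r, G r * (Iic t).indicator 1 r = (Iic t).indicator G r := fun r => by
        by_cases h : r ∈ Iic t <;> simp [h]
      simp_rw [h3]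
      rw [h2, setIntegral_indicator measurableSet_Iic]
    · have h4 : jumpCount T N s ≤ κ := monotone_jumpCount hN hs'.2
      rw [← Finset.sum_subset (Finset.range_subset_range.2 h4)]
      · refine Finset.sum_congr rfl fun k hk => ?_
        have hk' := Finset.mem_range.1 hk
        have h5 : e k ≤ s := (jumpTime_le_iff_le_jumpCount hN (by omega) hs').2 (by omega)
        have h6 : e k ≤ t := by
          have := hpos k (by omega)
          rcases le_max_iff.1 h5 with h | h
          · linarith
          · exact h.trans (min_le_left _ _)
        rw [indicator_of_mem (mem_Iic.2 h6)]
        simp [hΔ, he]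
      · intro k hk hk'
        have hk1 := Finset.mem_range.1 hk
        rw [Finset.mem_range, not_lt] at hk'
        have h5 : ¬ e k ≤ s := (jumpTime_le_iff_le_jumpCount hN (by omega) hs').not.2 (by omega)
        rw [indicator_of_notMem, mul_zero]
        intro h
        exact h5 (le_max_of_le_right (le_min h (hmem k).2))
  rw [stieltjesIntegral_eq_sub hf T hξ hB, ← integral_indicator measurableSet_Ioc,
    ← integral_indicator measurableSet_Ioc, integral_jumpMeasure_sub hGm hGM
      (hξ.indicator measurableSet_Ioc) (B := B) fun t => ?_]
  · rw [intervalIntegral.integral_of_le hT]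
    congr 1
    · exact setIntegral_congr_fun measurableSet_Ioc fun t ht => by
        simp only [indicator_of_mem ht, mul_comm, hG]
    · refine Finset.sum_congr rfl fun k hk => ?_
      have h7 : e k ∈ Ioc 0 T := ⟨hpos k (Finset.mem_range.1 hk), (hmem k).2⟩
      rw [indicator_of_mem h7, mul_comm]
  · by_cases h : t ∈ Ioc 0 T
    · simpa [h] using hB t
    · simpa [h] using (abs_nonneg _).trans (hB t)

end PiecewiseSmooth

/-! ### Measurability of the queue and its rewards -/

lemma measurable_jumpTime {Ω : Type*} {mΩ : MeasurableSpace Ω} {N : ℝ → Ω → ℕ}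
    (hN : ∀ t, Measurable (N t)) (hc : ∀ ω, IsCountingPath fun t => N t ω) {T t₀ : ℝ}
    (h₀ : t₀ ≤ T) (n : ℕ) : Measurable fun ω => jumpTime T (fun t => N t ω) t₀ n := by
  have key : ∀ c : ℝ, {ω | jumpTime T (fun t => N t ω) t₀ n ≤ c} =
      {_ω | T ≤ c} ∪ {ω | t₀ ≤ c ∧ N t₀ ω + n ≤ N c ω} := by
    intro c
    ext ω
    have hmem := jumpTime_mem (N := fun t => N t ω) h₀ n
    simp only [mem_ofPred_eq, mem_union]
    constructor
    · intro h
      rcases le_or_gt T c with hc' | hc'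
      · exact Or.inl hc'
      · refine Or.inr ⟨hmem.1.trans h, ?_⟩
        have hlt : jumpTime T (fun t => N t ω) t₀ n < T := h.trans_lt hc'
        by_cases hn : N t₀ ω + n ≤ N T ω
        · exact (jumpTime_le_iff (hc ω) hn (hmem.1.trans h) hc'.le).1 h
        · -- fewer than `n` jumps: the truncation makes the jump time equal to `T`
          refine absurd hlt (not_lt.2 ?_)
          refine le_csInf ⟨T, h₀, le_rfl, Or.inr rfl⟩ fun t ht => ?_
          rcases ht.2.2 with h3 | h3
          · exact absurd (h3.trans ((hc ω).mono ht.2.1)) hn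
          · exact h3.ge
    · rintro (h | ⟨h1, h2⟩)
      · exact hmem.2.trans h
      · rcases le_total c T with h3 | h3
        · exact csInf_le ⟨t₀, fun _ h => h.1⟩ ⟨h1, h3, Or.inl h2⟩
        · exact hmem.2.trans h3
  refine measurable_of_Iic fun c => ?_
  change MeasurableSet {ω | jumpTime T (fun t => N t ω) t₀ n ≤ c}
  rw [key c]
  exact (MeasurableSet.const _).union ((MeasurableSet.const _).inter
    (measurableSet_le ((hN t₀).add_const n) (hN c)))

namespace QueuePath

/-- A driver of the queue that depends measurably on chance, with counting processes for the
arrivals and the services. -/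
structure IsRandomDriver {Ω : Type*} [MeasurableSpace Ω] (w : Ω → QueuePath) : Prop where
  counting : ∀ ω, (w ω).IsCounting
  arr : ∀ t, Measurable fun ω => (w ω).arr t
  srv : ∀ t, Measurable fun ω => (w ω).srv t
  unif : ∀ k, Measurable fun ω => (w ω).unif k

namespace IsRandomDriver

variable {Ω : Type*} {mΩ : MeasurableSpace Ω} {w : Ω → QueuePath} {T : ℝ} {p : ℝ → ℕ → ℝ} {t₀ : ℝ}

lemma events (hw : IsRandomDriver w) (t : ℝ) : Measurable fun ω => (w ω).events t :=
  (hw.arr t).add (hw.srv t)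

lemma comp {Ω' : Type*} {mΩ' : MeasurableSpace Ω'} (hw : IsRandomDriver w) {f : Ω' → Ω}
    (hf : Measurable f) : IsRandomDriver fun ω' => w (f ω') :=
  ⟨fun _ => hw.counting _, fun t => (hw.arr t).comp hf, fun t => (hw.srv t).comp hf,
    fun k => (hw.unif k).comp hf⟩

lemma measurable_jumpTime (hw : IsRandomDriver w) (h₀ : t₀ ≤ T) (n : ℕ) :
    Measurable fun ω => jumpTime T (w ω).events t₀ n :=
  _root_.measurable_jumpTime (N := fun t ω => (w ω).events t) hw.events
    (fun ω => (hw.counting ω).events) h₀ n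

lemma measurable_arr_comp (hw : IsRandomDriver w) {e : Ω → ℝ} (he : Measurable e) :
    Measurable fun ω => (w ω).arr (e ω) :=
  QueueModel.measurable_at_random_time (N := fun t ω => (w ω).arr t) hw.arr
    (fun ω => (hw.counting ω).arr.mono) (fun ω => (hw.counting ω).arr.right_cts) he

lemma measurable_events_comp (hw : IsRandomDriver w) {e : Ω → ℝ} (he : Measurable e) :
    Measurable fun ω => (w ω).events (e ω) :=
  QueueModel.measurable_at_random_time (N := fun t ω => (w ω).events t) hw.events
    (fun ω => (hw.counting ω).events.mono) (fun ω => (hw.counting ω).events.right_cts) he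

lemma measurable_counts (hw : IsRandomDriver w) (hp : ∀ x, Measurable fun t => p t x)
    (h₀ : t₀ ≤ T) (x₀ n : ℕ) : Measurable fun ω => counts T p (w ω) t₀ x₀ n := by
  classical
  induction n with
  | zero => exact measurable_const
  | succ n ih =>
    have harr : ∀ n, Measurable fun ω => (w ω).arr (jumpTime T (w ω).events t₀ n) := fun n =>
      hw.measurable_arr_comp (hw.measurable_jumpTime h₀ n)
    have hx : Measurable fun ω =>
        x₀ + (counts T p (w ω) t₀ x₀ n).1 - (counts T p (w ω) t₀ x₀ n).2 :=
      (measurable_of_countable fun z : ℕ × ℕ => x₀ + z.1 - z.2).comp ih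
    have hU : Measurable fun ω =>
        (w ω).unif ((w ω).arr (jumpTime T (w ω).events t₀ (n + 1))) :=
      (measurable_from_prod_countable_right (f := fun z : ℕ × Ω => (w z.2).unif z.1)
        hw.unif).comp ((harr (n + 1)).prodMk measurable_id)
    have hp' : Measurable fun ω => p (jumpTime T (w ω).events t₀ (n + 1))
        (x₀ + (counts T p (w ω) t₀ x₀ n).1 - (counts T p (w ω) t₀ x₀ n).2) :=
      (measurable_from_prod_countable_right (f := fun z : ℕ × ℝ => p z.2 z.1) hp).comp
        (hx.prodMk (hw.measurable_jumpTime h₀ (n + 1)))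
    simp only [counts]
    refine Measurable.ite (measurableSet_lt (harr n) (harr (n + 1))) ?_ ?_
    · exact Measurable.ite (measurableSet_lt hU hp')
        ((measurable_of_countable fun z : ℕ × ℕ => (z.1 + 1, z.2)).comp ih) ih
    · exact Measurable.ite (measurableSet_lt measurable_const hx)
        ((measurable_of_countable fun z : ℕ × ℕ => (z.1, z.2 + 1)).comp ih) ih

lemma measurable_countsAt_comp (hw : IsRandomDriver w) (hp : ∀ x, Measurable fun t => p t x)
    (h₀ : t₀ ≤ T) (x₀ : ℕ) {e : Ω → ℝ} (he : Measurable e) :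
    Measurable fun ω => countsAt T p (w ω) t₀ x₀ (e ω) := by
  have hn : Measurable fun ω => numEvents T (w ω) t₀ (e ω) :=
    (hw.measurable_events_comp (measurable_const.max (he.min measurable_const))).sub (hw.events t₀)
  exact (measurable_from_prod_countable_right (f := fun z : ℕ × Ω => counts T p (w z.2) t₀ x₀ z.1)
    (hw.measurable_counts hp h₀ x₀)).comp (hn.prodMk measurable_id)

lemma measurable_countsAt (hw : IsRandomDriver w) (hp : ∀ x, Measurable fun t => p t x)
    (h₀ : t₀ ≤ T) (x₀ : ℕ) (t : ℝ) : Measurable fun ω => countsAt T p (w ω) t₀ x₀ t :=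
  hw.measurable_countsAt_comp hp h₀ x₀ measurable_const

lemma measurable_state_comp (hw : IsRandomDriver w) (hp : ∀ x, Measurable fun t => p t x)
    (h₀ : t₀ ≤ T) (x₀ : ℕ) {e : Ω → ℝ} (he : Measurable e) :
    Measurable fun ω => state T p (w ω) t₀ x₀ (e ω) :=
  (measurable_of_countable fun z : ℕ × ℕ => x₀ + z.1 - z.2).comp
    (hw.measurable_countsAt_comp hp h₀ x₀ he)

lemma measurable_state (hw : IsRandomDriver w) (hp : ∀ x, Measurable fun t => p t x)
    (h₀ : t₀ ≤ T) (x₀ : ℕ) (t : ℝ) : Measurable fun ω => state T p (w ω) t₀ x₀ t :=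
  hw.measurable_state_comp hp h₀ x₀ measurable_const

/-- Joint measurability in time and chance of a function of time and of the queue length. -/
lemma measurable_comp_state (hw : IsRandomDriver w) (hp : ∀ x, Measurable fun t => p t x)
    (h₀ : t₀ ≤ T) (x₀ : ℕ) {h : ℝ → ℕ → ℝ} (hh : ∀ x, Measurable fun t => h t x) :
    Measurable fun z : ℝ × Ω => h z.1 (state T p (w z.2) t₀ x₀ z.1) :=
  (measurable_from_prod_countable_right (f := fun z : ℕ × ℝ => h z.2 z.1) hh).comp
    (((hw.comp measurable_snd).measurable_state_comp hp h₀ x₀ measurable_fst).prodMk measurable_fst)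

end IsRandomDriver

/-- The total reward collected after time `t₀` by the queue that holds `x₀` customers at time `t₀`:
`K` for each admitted customer, the running reward `h`, and the terminal reward `G`. -/
noncomputable def reward (T : ℝ) (p : ℝ → ℕ → ℝ) (K : ℝ) (h : ℝ → ℕ → ℝ) (G : ℕ → ℝ)
    (w : QueuePath) (t₀ : ℝ) (x₀ : ℕ) : ℝ :=
  K * (countsAt T p w t₀ x₀ T).1 + (∫ s in t₀..T, h s (state T p w t₀ x₀ s)) +
    G (state T p w t₀ x₀ T)

section reward

variable {T : ℝ} {p : ℝ → ℕ → ℝ} {K : ℝ} {h : ℝ → ℕ → ℝ} {G : ℕ → ℝ} {t₀ : ℝ}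

lemma IsRandomDriver.measurable_reward {Ω : Type*} {mΩ : MeasurableSpace Ω} {w : Ω → QueuePath}
    (hw : IsRandomDriver w) (hp : ∀ x, Measurable fun t => p t x)
    (hh : ∀ x, Measurable fun t => h t x) (h₀ : t₀ ≤ T) (x₀ : ℕ) :
    Measurable fun ω => reward T p K h G (w ω) t₀ x₀ := by
  have h1 : Measurable fun ω => ∫ s in t₀..T, h s (state T p (w ω) t₀ x₀ s) := by
    simp only [intervalIntegral.integral_of_le h₀]
    exact (StronglyMeasurable.integral_prod_left'
      (hw.measurable_comp_state hp h₀ x₀ hh).stronglyMeasurable).measurable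
  have h2 : Measurable fun ω => ((countsAt T p (w ω) t₀ x₀ T).1 : ℝ) :=
    (measurable_of_countable fun z : ℕ × ℕ => (z.1 : ℝ)).comp (hw.measurable_countsAt hp h₀ x₀ T)
  have h3 : Measurable fun ω => G (state T p (w ω) t₀ x₀ T) :=
    (measurable_of_countable G).comp (hw.measurable_state hp h₀ x₀ T)
  exact ((h2.const_mul K).add h1).add h3

lemma abs_reward_le {Mh MG : ℝ} (hh : ∀ t x, |h t x| ≤ Mh) (hG : ∀ x, |G x| ≤ MG) (h₀ : t₀ ≤ T)
    (w : QueuePath) (x₀ : ℕ) :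
    |reward T p K h G w t₀ x₀| ≤ |K| * numEvents T w t₀ T + Mh * (T - t₀) + MG := by
  have h1 : |∫ s in t₀..T, h s (state T p w t₀ x₀ s)| ≤ Mh * (T - t₀) := by
    have := intervalIntegral.norm_integral_le_of_norm_le_const (a := t₀) (b := T) (C := Mh)
      (f := fun s => h s (state T p w t₀ x₀ s)) fun s _ => hh _ _
    rwa [abs_of_nonneg (sub_nonneg.2 h₀)] at this
  have h2 : |K * ((countsAt T p w t₀ x₀ T).1 : ℝ)| ≤ |K| * numEvents T w t₀ T := by
    rw [abs_mul, Nat.abs_cast]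
    gcongr
    exact counts_fst_le _
  exact (abs_add_three _ _ _).trans (add_le_add (add_le_add h2 h1) (hG _))

/-- The reward after `t₀` is a function of the increments of the drivers after `t₀` and of the
uniform variables of the customers that arrive after `t₀`. -/
lemma reward_congr {w w' : QueuePath} (hw : w.IsCounting) (hw' : w'.IsCounting) (h₀ : t₀ ≤ T)
    (ha : ∀ s ∈ Icc t₀ T, w.arr s + w'.arr t₀ = w'.arr s + w.arr t₀)
    (hb : ∀ s ∈ Icc t₀ T, w.srv s + w'.srv t₀ = w'.srv s + w.srv t₀)
    (hu : ∀ k, 0 < k → w.arr t₀ + k ≤ w.arr T →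
      w.unif (w.arr t₀ + k) = w'.unif (w'.arr t₀ + k)) (x₀ : ℕ) :
    reward T p K h G w t₀ x₀ = reward T p K h G w' t₀ x₀ := by
  have key : ∀ t ∈ Icc t₀ T, countsAt T p w t₀ x₀ t = countsAt T p w' t₀ x₀ t := fun t ht =>
    countsAt_congr hw hw' h₀ le_rfl ha hb hu ht
  have key' : ∀ t ∈ Icc t₀ T, state T p w t₀ x₀ t = state T p w' t₀ x₀ t := fun t ht => by
    rw [state, state, key t ht]
  have hint : ∫ s in t₀..T, h s (state T p w t₀ x₀ s) = ∫ s in t₀..T, h s (state T p w' t₀ x₀ s) :=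
    intervalIntegral.integral_congr fun s hs => by
      rw [uIcc_of_le h₀] at hs
      simp only [key' s hs]
  rw [reward, reward, key T ⟨h₀, le_rfl⟩, key' T ⟨h₀, le_rfl⟩, hint]

/-- The reward after a later time `t`, along the queue started at `t₀`. -/
lemma reward_state {w : QueuePath} (hw : w.IsCounting) {t : ℝ} (h0t : t₀ ≤ t) (htT : t ≤ T)
    (x₀ : ℕ) :
    reward T p K h G w t (state T p w t₀ x₀ t) =
      K * ((countsAt T p w t₀ x₀ T).1 - (countsAt T p w t₀ x₀ t).1) +
      (∫ s in t..T, h s (state T p w t₀ x₀ s)) + G (state T p w t₀ x₀ T) := by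
  have h1 := countsAt_flow (p := p) (x₀ := x₀) hw h0t (t := T) ⟨htT, le_rfl⟩
  have hint : ∫ s in t..T, h s (state T p w t (state T p w t₀ x₀ t) s) =
      ∫ s in t..T, h s (state T p w t₀ x₀ s) :=
    intervalIntegral.integral_congr fun s hs => by
      rw [uIcc_of_le htT] at hs
      simp only [← state_flow hw h0t hs]
  rw [reward, ← state_flow hw h0t ⟨htT, le_rfl⟩, hint, h1]
  simp

end reward

end QueuePath

/-! ### Independence of past and future increments -/

section Independence

variable {Ω : Type*} [MeasurableSpace Ω] {P : Measure Ω} [IsProbabilityMeasure P]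

lemma comap_prodMk_eq_generateFrom {Ω α β : Type*} [MeasurableSpace α] [MeasurableSpace β]
    (X : Ω → α) (Y : Ω → β) :
    MeasurableSpace.comap (fun ω => (X ω, Y ω)) inferInstance =
      MeasurableSpace.generateFrom (preimage (fun ω => (X ω, Y ω)) ''
        image2 (· ×ˢ ·) {s | MeasurableSet s} {t | MeasurableSet t}) := by
  rw [← MeasurableSpace.comap_generateFrom, generateFrom_prod]

/-- If `(X₁, Y₁)` is independent of `(X₂, Y₂)` and within each pair the components are independent,
then `(X₁, X₂)` is independent of `(Y₁, Y₂)`. -/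
lemma indepFun_prodMk_prodMk_of_indepFun {α₁ α₂ β₁ β₂ : Type*} [MeasurableSpace α₁]
    [MeasurableSpace α₂] [MeasurableSpace β₁] [MeasurableSpace β₂] {X₁ : Ω → α₁} {X₂ : Ω → α₂}
    {Y₁ : Ω → β₁} {Y₂ : Ω → β₂} (hX₁ : Measurable X₁) (hX₂ : Measurable X₂) (hY₁ : Measurable Y₁)
    (hY₂ : Measurable Y₂) (h₁ : IndepFun X₁ Y₁ P) (h₂ : IndepFun X₂ Y₂ P)
    (h : IndepFun (fun ω => (X₁ ω, Y₁ ω)) (fun ω => (X₂ ω, Y₂ ω)) P) :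
    IndepFun (fun ω => (X₁ ω, X₂ ω)) (fun ω => (Y₁ ω, Y₂ ω)) P := by
  refine IndepSets.indep (hX₁.prodMk hX₂).comap_le (hY₁.prodMk hY₂).comap_le
    (isPiSystem_prod.comap _) (isPiSystem_prod.comap _) (comap_prodMk_eq_generateFrom X₁ X₂)
    (comap_prodMk_eq_generateFrom Y₁ Y₂) ?_
  rw [IndepSets_iff]
  rintro _ _ ⟨_, ⟨s₁, hs₁, s₂, hs₂, rfl⟩, rfl⟩ ⟨_, ⟨t₁, ht₁, t₂, ht₂, rfl⟩, rfl⟩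
  rw [indepFun_iff_measure_inter_preimage_eq_mul] at h h₁ h₂
  have e1 := h (s₁ ×ˢ univ) (s₂ ×ˢ univ) (hs₁.prod .univ) (hs₂.prod .univ)
  have e2 := h (univ ×ˢ t₁) (univ ×ˢ t₂) (.prod .univ ht₁) (.prod .univ ht₂)
  have e3 := h (s₁ ×ˢ t₁) (s₂ ×ˢ t₂) (.prod hs₁ ht₁) (.prod hs₂ ht₂)
  have e4 := h₁ s₁ t₁ hs₁ ht₁
  have e5 := h₂ s₂ t₂ hs₂ ht₂
  simp only [mk_preimage_prod, preimage_univ, univ_inter, inter_univ] at e1 e2 e3 ⊢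
  rw [inter_inter_inter_comm, e3, e1, e2, e4, e5]
  ring

/-- A finite set is contained in the range of a monotone sequence that runs through it. -/
lemma exists_monotone_seq_of_finset {α : Type*} [LinearOrder α] (H : Finset α) (hH : H.Nonempty) :
    ∃ τ : ℕ → α, Monotone τ ∧ ∀ h ∈ H, ∃ i, τ i = h := by
  have hpos := hH.card_pos
  refine ⟨fun i => H.orderEmbOfFin rfl ⟨min i (H.card - 1), by omega⟩, fun i j hij => ?_,
    fun h hh => ?_⟩
  · exact (H.orderEmbOfFin rfl).monotone (Fin.mk_le_mk.2 (by gcongr))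
  · rw [← Finset.mem_coe, ← H.range_orderEmbOfFin rfl] at hh
    obtain ⟨i, hi⟩ := hh
    refine ⟨i, ?_⟩
    rw [← hi]
    exact congrArg _ (Fin.ext (min_eq_left (by omega)))

/-- The increments of `N` over `[0, t]` are independent of those over `[t, T]`. -/
lemma indepFun_past_future {T : ℝ} {N : ℝ → Ω → ℕ} (hm : ∀ t, Measurable (N t))
    (hmono : ∀ ω, Monotone fun t => N t ω)
    (hN : HasIndepIncrements (fun (t : Icc (0 : ℝ) T) ω => N t ω) P) {t : ℝ} (ht : t ∈ Icc 0 T) :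
    IndepFun (fun ω (s : ℝ) => N (max 0 (min s t)) ω - N 0 ω)
      (fun ω (s : ℝ) => N (max t (min s T)) ω - N t ω) P := by
  refine IndepFun.process_indepFun_process (fun s => (hm _).sub (hm _))
    (fun s => (hm _).sub (hm _)) fun I J => ?_
  have hT : 0 ≤ T := ht.1.trans ht.2
  let a : ℝ → Icc (0 : ℝ) T := fun s =>
    ⟨max 0 (min s t), le_max_left _ _, max_le hT ((min_le_right _ _).trans ht.2)⟩
  let b : ℝ → Icc (0 : ℝ) T := fun s =>
    ⟨max t (min s T), ht.1.trans (le_max_left _ _), max_le ht.2 (min_le_right _ _)⟩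
  have ha : ∀ s, a s ≤ ⟨t, ht⟩ := fun s => Subtype.mk_le_mk.2 (max_le ht.1 (min_le_right _ _))
  have hb : ∀ s, ⟨t, ht⟩ ≤ b s := fun s => Subtype.mk_le_mk.2 (le_max_left _ _)
  -- a partition of `[0, T]` that contains all the times that occur
  obtain ⟨τ, hτ, hτH⟩ := exists_monotone_seq_of_finset
    (insert ⟨0, le_rfl, hT⟩ (insert ⟨t, ht⟩ (I.image a ∪ J.image b))) (by simp)
  obtain ⟨i₀, hi₀⟩ := hτH ⟨0, le_rfl, hT⟩ (by simp)
  obtain ⟨k, hk⟩ := hτH ⟨t, ht⟩ (by simp)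
  have hτ0 : τ 0 = ⟨0, le_rfl, hT⟩ :=
    le_antisymm (hi₀ ▸ hτ (Nat.zero_le i₀)) (Subtype.mk_le_mk.2 (τ 0).2.1)
  have hI : ∀ s : I, ∃ i ≤ k, τ i = a s := by
    intro s
    have hs : a s ∈ insert ⟨0, le_rfl, hT⟩ (insert ⟨t, ht⟩ (I.image a ∪ J.image b)) := by
      simp only [Finset.mem_insert, Finset.mem_union, Finset.mem_image]
      exact Or.inr (Or.inr (Or.inl ⟨s, s.2, rfl⟩))
    obtain ⟨i, hi⟩ := hτH (a s) hs
    rcases le_total i k with h | h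
    · exact ⟨i, h, hi⟩
    · exact ⟨k, le_rfl, le_antisymm (hi ▸ hτ h) (hk ▸ ha s)⟩
  have hJ : ∀ s : J, ∃ i, τ (k + i) = b s := by
    intro s
    have hs : b s ∈ insert ⟨0, le_rfl, hT⟩ (insert ⟨t, ht⟩ (I.image a ∪ J.image b)) := by
      simp only [Finset.mem_insert, Finset.mem_union, Finset.mem_image]
      exact Or.inr (Or.inr (Or.inr ⟨s, s.2, rfl⟩))
    obtain ⟨i, hi⟩ := hτH (b s) hs
    rcases le_total k i with h | h
    · exact ⟨i - k, by rw [Nat.add_sub_cancel' h, hi]⟩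
    · exact ⟨0, le_antisymm (hk ▸ hb s) (hi ▸ hτ h)⟩
  choose i hik hi using hI
  choose j hj using hJ
  set inc : ℕ → Ω → ℕ := fun n ω => N (τ (n + 1)) ω - N (τ n) ω with hinc
  have hincm : ∀ n, Measurable (inc n) := fun n => (hm _).sub (hm _)
  have hmono' : ∀ ω, Monotone fun n => N (τ n) ω := fun ω _ _ h => hmono ω (hτ h)
  obtain ⟨m, hmj⟩ : ∃ m, ∀ s, j s ≤ m :=
    ⟨Finset.univ.sup j, fun s => Finset.le_sup (Finset.mem_univ s)⟩
  have hind := iIndepFun.indepFun_finset (Finset.range k) (Finset.Ico k (k + m))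
    (by rw [Finset.disjoint_left]; intro x; simp; omega) (hN.nat hτ) hincm
  have hind' := hind.comp
    (φ := fun (z : Finset.range k → ℕ) (s : I) => ∑ n : Fin (i s), z ⟨n, by
      have := hik s; have := n.2; simp; omega⟩)
    (ψ := fun (z : Finset.Ico k (k + m) → ℕ) (s : J) => ∑ n : Fin (j s), z ⟨k + n, by
      have := hmj s; have := n.2; simp; omega⟩) (by fun_prop) (by fun_prop)
  convert hind' using 1
  · ext ω s
    have h1 : N (max 0 (min (s : ℝ) t)) ω = N (τ (i s)) ω := by rw [hi s]
    have h2 : N 0 ω = N (τ 0) ω := by rw [hτ0]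
    rw [h1, h2, ← Finset.sum_range_tsub (hmono' ω), Finset.sum_range]
    rfl
  · ext ω s
    have h1 : N (max t (min (s : ℝ) T)) ω = N (τ (k + j s)) ω := by rw [hj s]
    have h2 : N t ω = N (τ (k + 0)) ω := by rw [add_zero, hk]
    have h3 : Monotone fun n => N (τ (k + n)) ω := fun _ _ h => hmono ω (hτ (by omega))
    rw [h1, h2, ← Finset.sum_range_tsub h3, Finset.sum_range]
    rfl

end Independence

/-! ### The Markov property of the driver -/

/-- The space of counting paths; as a subtype of `ℝ → ℕ` it carries the σ-algebra generated by the
evaluations. -/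
abbrev CountingPath : Type := {N : ℝ → ℕ // IsCountingPath N}

section increments

variable {Ω : Type*} {N : ℝ → Ω → ℕ}

/-- The path of the increments `N s - N a`, `s ∈ [a, b]`, extended to the line by constants. -/
def increments (N : ℝ → Ω → ℕ) (hN : ∀ ω, IsCountingPath fun t => N t ω) (a b : ℝ) (ω : Ω) :
    CountingPath :=
  ⟨fun s => N (max a (min s b)) ω - N a ω, (hN ω).after a b⟩

lemma measurable_increments {m : MeasurableSpace Ω} (hN : ∀ ω, IsCountingPath fun t => N t ω)
    {a b : ℝ} (hab : a ≤ b) (hm : ∀ s ∈ Icc a b, Measurable (N s)) :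
    Measurable (increments N hN a b) :=
  (measurable_pi_lambda _ fun _ => (hm _ ⟨le_max_left _ _, max_le hab (min_le_right _ _)⟩).sub
    (hm _ ⟨le_rfl, hab⟩)).subtype_mk

lemma measurable_increments_prodMk {m : MeasurableSpace Ω} {M : ℝ → Ω → ℕ}
    (hN : ∀ ω, IsCountingPath fun t => N t ω) (hM : ∀ ω, IsCountingPath fun t => M t ω)
    {a b : ℝ} (hab : a ≤ b) (hNm : ∀ s ∈ Icc a b, Measurable (N s))
    (hMm : ∀ s ∈ Icc a b, Measurable (M s)) :
    Measurable fun ω => (increments N hN a b ω, increments M hM a b ω) :=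
  (measurable_increments _ hab hNm).prodMk (measurable_increments _ hab hMm)

lemma comap_pi_le {ι β : Type*} [MeasurableSpace β] {m : MeasurableSpace Ω} {F : Ω → ι → β}
    (h : ∀ i, Measurable fun ω => F ω i) : MeasurableSpace.comap F inferInstance ≤ m :=
  (measurable_pi_lambda _ h).comap_le

lemma comap_prodMk_le {α β : Type*} [MeasurableSpace α] [MeasurableSpace β]
    {m : MeasurableSpace Ω} {X : Ω → α} {Y : Ω → β}
    (hX : Measurable X) (hY : Measurable Y) :
    MeasurableSpace.comap (fun ω => (X ω, Y ω)) inferInstance ≤ m :=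
  (hX.prodMk hY).comap_le

lemma measurable_comap_eval {ι β : Type*} [MeasurableSpace β] (F : Ω → ι → β) (i : ι) :
    Measurable[MeasurableSpace.comap F inferInstance] fun ω => F ω i :=
  (measurable_pi_apply i).comp (comap_measurable F)

lemma measurable_comap_of_comp {ι α β : Type*} [MeasurableSpace α] [MeasurableSpace β]
    (F : Ω → α) {g : α → ι → β} (hg : Measurable g) (i : ι) :
    Measurable[MeasurableSpace.comap F inferInstance] fun ω => g (F ω) i :=
  ((measurable_pi_apply i).comp hg).comp (comap_measurable F)

lemma measurable_biSup_comap {ι β : Type*} [MeasurableSpace β] (f : ι → Ω → β) {S : Set ι} {i : ι}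
    (hi : i ∈ S) :
    Measurable[⨆ i ∈ S, MeasurableSpace.comap (f i) inferInstance] (f i) :=
  Measurable.of_comap_le (le_biSup (fun k => MeasurableSpace.comap (f k) inferInstance) hi)

lemma comap_increments (hN : ∀ ω, IsCountingPath fun t => N t ω) (a b : ℝ) :
    MeasurableSpace.comap (increments N hN a b) inferInstance =
      MeasurableSpace.comap (fun ω (s : ℝ) => N (max a (min s b)) ω - N a ω) inferInstance := by
  have : (fun ω (s : ℝ) => N (max a (min s b)) ω - N a ω) =
    Subtype.val ∘ increments N hN a b := rfl
  rw [this, ← MeasurableSpace.comap_comp]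
  rfl

end increments

namespace QueuePath

/-- The driver with given arrivals, services and uniform variables, where the `k`-th arriving
customer uses the uniform variable with index `k`. -/
def ofPast (z : (CountingPath × CountingPath) × (ℕ → ℝ)) : QueuePath :=
  ⟨z.1.1.1, z.1.2.1, z.2⟩

/-- The driver with given arrivals and services, where the first arriving customer uses the
uniform variable with index `0`. -/
def ofFuture (z : (CountingPath × CountingPath) × (ℕ → ℝ)) : QueuePath :=
  ⟨z.1.1.1, z.1.2.1, fun k => z.2 (k - 1)⟩

lemma isRandomDriver_ofPast : IsRandomDriver ofPast where
  counting z := ⟨z.1.1.2, z.1.2.2⟩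
  arr t := (measurable_pi_apply t).comp
    (measurable_subtype_coe.comp (measurable_fst.comp measurable_fst))
  srv t := (measurable_pi_apply t).comp
    (measurable_subtype_coe.comp (measurable_snd.comp measurable_fst))
  unif k := (measurable_pi_apply k).comp measurable_snd

lemma isRandomDriver_ofFuture : IsRandomDriver ofFuture where
  counting z := ⟨z.1.1.2, z.1.2.2⟩
  arr t := (measurable_pi_apply t).comp
    (measurable_subtype_coe.comp (measurable_fst.comp measurable_fst))
  srv t := (measurable_pi_apply t).comp
    (measurable_subtype_coe.comp (measurable_snd.comp measurable_fst))
  unif k := (measurable_pi_apply (k - 1)).comp measurable_snd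

end QueuePath

namespace QueueModel

variable {Ω : Type*} [MeasurableSpace Ω] {P : Measure Ω} (Q : QueueModel Ω P)

lemma isCountingPath_arr (ω : Ω) : IsCountingPath fun t => Q.arr t ω :=
  ⟨Q.arr_poisson.mono ω, Q.arr_poisson.right_cts ω⟩

lemma isCountingPath_srv (ω : Ω) : IsCountingPath fun t => Q.srv t ω :=
  ⟨Q.srv_poisson.mono ω, Q.srv_poisson.right_cts ω⟩

/-- The realization of the primitive random objects of the model. -/
def path (ω : Ω) : QueuePath := ⟨fun t => Q.arr t ω, fun t => Q.srv t ω, fun k => Q.unif k ω⟩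

lemma isRandomDriver_path : QueuePath.IsRandomDriver Q.path where
  counting ω := ⟨Q.isCountingPath_arr ω, Q.isCountingPath_srv ω⟩
  arr := Q.arr_poisson.measurable
  srv := Q.srv_poisson.measurable
  unif := Q.unif_measurable

/-- The increments of the arrival and the service process over `[a, b]`. -/
def incr (a b : ℝ) (ω : Ω) : CountingPath × CountingPath :=
  (increments Q.arr Q.isCountingPath_arr a b ω, increments Q.srv Q.isCountingPath_srv a b ω)

lemma measurable_incr {a b : ℝ} (hab : a ≤ b) : Measurable (Q.incr a b) :=
  measurable_increments_prodMk _ _ hab (fun s _ => Q.arr_poisson.measurable s)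
    fun s _ => Q.srv_poisson.measurable s

/-- The uniform variables of the first `m` customers, extended by the last one to a sequence. -/
def unifPast (m : ℕ) (ω : Ω) (k : ℕ) : ℝ := Q.unif (min k m) ω

/-- The uniform variables of the customers after the first `m`; the next customer uses the one with
index `m + 1`. -/
def unifFuture (m : ℕ) (ω : Ω) (k : ℕ) : ℝ := Q.unif (m + 1 + k) ω

lemma measurable_unifPast (m : ℕ) : Measurable (Q.unifPast m) :=
  measurable_pi_lambda _ fun _ => Q.unif_measurable _

lemma measurable_unifFuture (m : ℕ) : Measurable (Q.unifFuture m) :=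
  measurable_pi_lambda _ fun _ => Q.unif_measurable _

lemma indepFun_unifPast_unifFuture (m : ℕ) : IndepFun (Q.unifPast m) (Q.unifFuture m) P := by
  have h := indep_iSup_of_disjoint (fun k => (Q.unif_measurable k).comap_le) Q.unif_indep
    (S := Iic m) (T := Ioi m) (Iic_disjoint_Ioi le_rfl)
  refine indep_of_indep_of_le_left (indep_of_indep_of_le_right h ?_) ?_
  · exact comap_pi_le fun k => measurable_biSup_comap Q.unif (mem_Ioi.2 (by omega))
  · exact comap_pi_le fun k => measurable_biSup_comap Q.unif (mem_Iic.2 (min_le_right k m))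

variable [IsProbabilityMeasure P]

omit [IsProbabilityMeasure P] in
lemma comap_incr_le {a b : ℝ} (ha : 0 ≤ a) (hab : a ≤ b) (hb : b ≤ Q.T) :
    MeasurableSpace.comap (Q.incr a b) inferInstance ≤
      MeasurableSpace.comap (fun ω => (fun t : Icc (0 : ℝ) Q.T => Q.arr t ω,
        fun t : Icc (0 : ℝ) Q.T => Q.srv t ω)) inferInstance := by
  refine Measurable.comap_le (measurable_increments_prodMk _ _ hab (fun s hs => ?_) fun s hs => ?_)
  · exact measurable_comap_of_comp _ measurable_fst
      (⟨s, ha.trans hs.1, hs.2.trans hb⟩ : Icc (0 : ℝ) Q.T)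
  · exact measurable_comap_of_comp _ measurable_snd
      (⟨s, ha.trans hs.1, hs.2.trans hb⟩ : Icc (0 : ℝ) Q.T)

/-- The increments of both processes up to time `t` are independent of those after time `t`. -/
lemma indepFun_incr {t : ℝ} (ht : t ∈ Icc 0 Q.T) : IndepFun (Q.incr 0 t) (Q.incr t Q.T) P := by
  have hm : ∀ {N : ℝ → Ω → ℕ} (hN : ∀ ω, IsCountingPath fun t => N t ω)
      (_ : ∀ t, Measurable (N t)) {a b : ℝ} (_ : a ≤ b), Measurable (increments N hN a b) :=
    fun hN h _ _ hab => measurable_increments hN hab fun s _ => h s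
  refine indepFun_prodMk_prodMk_of_indepFun (hm _ Q.arr_poisson.measurable ht.1)
    (hm _ Q.srv_poisson.measurable ht.1) (hm _ Q.arr_poisson.measurable ht.2)
    (hm _ Q.srv_poisson.measurable ht.2) ?_ ?_ ?_
  · rw [IndepFun_iff_Indep, comap_increments, comap_increments, ← IndepFun_iff_Indep]
    exact indepFun_past_future Q.arr_poisson.measurable Q.arr_poisson.mono Q.arr_poisson.indep ht
  · rw [IndepFun_iff_Indep, comap_increments, comap_increments, ← IndepFun_iff_Indep]
    exact indepFun_past_future Q.srv_poisson.measurable Q.srv_poisson.mono Q.srv_poisson.indep ht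
  · have key : ∀ {N : ℝ → Ω → ℕ} (hN : ∀ ω, IsCountingPath fun t => N t ω),
        MeasurableSpace.comap (fun ω => (increments N hN 0 t ω, increments N hN t Q.T ω))
          inferInstance ≤
        MeasurableSpace.comap (fun ω (t : Icc (0 : ℝ) Q.T) => N t ω) inferInstance := by
      intro N hN
      have hN' : ∀ s ∈ Icc 0 Q.T, Measurable[MeasurableSpace.comap
          (fun ω (t : Icc (0 : ℝ) Q.T) => N t ω) inferInstance] (N s) := fun s hs =>
        measurable_comap_eval (fun ω (t : Icc (0 : ℝ) Q.T) => N t ω) ⟨s, hs⟩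
      exact comap_prodMk_le
        (measurable_increments _ ht.1 fun s hs => hN' s ⟨hs.1, hs.2.trans ht.2⟩)
        (measurable_increments _ ht.2 fun s hs => hN' s ⟨ht.1.trans hs.1, hs.2⟩)
    exact indep_of_indep_of_le_left (indep_of_indep_of_le_right Q.arr_indep_srv (key _)) (key _)

/-- What happens up to time `t` to the first `m` customers is independent of the increments of the
processes after `t` and of the uniform variables of the later customers. -/
lemma indepFun_past_future {t : ℝ} (ht : t ∈ Icc 0 Q.T) (m : ℕ) :
    IndepFun (fun ω => (Q.incr 0 t ω, Q.unifPast m ω))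
      (fun ω => (Q.incr t Q.T ω, Q.unifFuture m ω)) P := by
  refine indepFun_prodMk_prodMk_of_indepFun (Q.measurable_incr ht.1) (Q.measurable_unifPast m)
    (Q.measurable_incr ht.2) (Q.measurable_unifFuture m) (Q.indepFun_incr ht)
    (Q.indepFun_unifPast_unifFuture m) ?_
  refine indep_of_indep_of_le_left (indep_of_indep_of_le_right Q.unif_indep_arr_srv.symm ?_) ?_
  · exact comap_prodMk_le
      (.of_comap_le (comap_pi_le fun k => measurable_comap_eval (fun ω k => Q.unif k ω) (min k m)))
      (.of_comap_le (comap_pi_le fun k =>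
        measurable_comap_eval (fun ω k => Q.unif k ω) (m + 1 + k)))
  · exact comap_prodMk_le (.of_comap_le (Q.comap_incr_le le_rfl ht.1 ht.2))
      (.of_comap_le (Q.comap_incr_le ht.1 ht.2 le_rfl))

/-- The law of the future does not depend on the number `m` of customers that have arrived. -/
lemma map_future {t : ℝ} (ht : t ∈ Icc 0 Q.T) (m : ℕ) :
    P.map (fun ω => (Q.incr t Q.T ω, Q.unifFuture m ω)) =
      (P.map (Q.incr t Q.T)).prod
        (Measure.infinitePi fun _ : ℕ => volume.restrict (Icc (0 : ℝ) 1)) := by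
  have hind : IndepFun (Q.incr t Q.T) (Q.unifFuture m) P :=
    indep_of_indep_of_le_left (indep_of_indep_of_le_right Q.unif_indep_arr_srv.symm
      (comap_pi_le fun k => measurable_comap_eval (fun ω k => Q.unif k ω) (m + 1 + k)))
      (Q.comap_incr_le ht.1 ht.2 le_rfl)
  rw [hind.map_prod_eq_prod_map_map (Q.measurable_incr ht.2).aemeasurable
    (Q.measurable_unifFuture m).aemeasurable]
  have h2 : iIndepFun (fun k => Q.unif (m + 1 + k)) P :=
    Q.unif_indep.precomp (add_right_injective (m + 1))
  have h3 := h2.map_fun_eq_infinitePi_map fun k => Q.unif_measurable _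
  simp only [Q.unif_law] at h3
  rw [← h3]
  rfl

/-- The increments after time `t` and the uniform variables of the customers after time `t`. -/
def future (t : ℝ) (ω : Ω) : (CountingPath × CountingPath) × (ℕ → ℝ) :=
  (Q.incr t Q.T ω, Q.unifFuture (Q.arr t ω) ω)

/-- The set `A` is an event of the past of `t`: on the event that exactly `m` customers have arrived
by time `t`, it depends only on the increments up to `t` and on the first `m` uniform variables. -/
def IsPastEvent (t : ℝ) (A : Set Ω) : Prop :=
  ∀ m, MeasurableSet[MeasurableSpace.comap (fun ω => (Q.incr 0 t ω, Q.unifPast m ω)) inferInstance]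
    (A ∩ {ω | Q.arr t ω = m})

variable {Q}

omit [IsProbabilityMeasure P] in
lemma isPastEvent_univ {t : ℝ} (ht : 0 ≤ t) : Q.IsPastEvent t univ := by
  intro m
  refine ⟨{z | z.1.1.1 t = m}, ?_, ?_⟩
  · have h : Measurable fun z : (CountingPath × CountingPath) × (ℕ → ℝ) => z.1.1.1 t :=
      (measurable_pi_apply t).comp (measurable_subtype_coe.comp
        (measurable_fst.comp measurable_fst))
    exact h (measurableSet_singleton m)
  · ext ω
    simp [incr, increments, ht, Q.arr_poisson.zero]

/-- The events of the past are independent of the future: the Markov property. The index of the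
first uniform variable of the future is random, but on the event that `m` customers have arrived by
time `t` it is `m + 1`, and the law of the future does not depend on `m`. -/
theorem setIntegral_future {t : ℝ} (ht : t ∈ Icc 0 Q.T) {A : Set Ω} (hA : Q.IsPastEvent t A)
    {Φ : (CountingPath × CountingPath) × (ℕ → ℝ) → ℝ} (hΦ : Measurable Φ)
    (hint : Integrable (fun ω => Φ (Q.future t ω)) P) :
    ∫ ω in A, Φ (Q.future t ω) ∂P = P.real A * ∫ ω, Φ (Q.future t ω) ∂P := by
  set c := ∫ z, Φ z ∂((P.map (Q.incr t Q.T)).prod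
        (Measure.infinitePi fun _ : ℕ => volume.restrict (Icc (0 : ℝ) 1))) with hc
  have key : ∀ B, Q.IsPastEvent t B → ∫ ω in B, Φ (Q.future t ω) ∂P = P.real B * c := by
    intro B hB
    have hpm : ∀ m, Measurable fun ω => (Q.incr 0 t ω, Q.unifPast m ω) := fun m =>
      (Q.measurable_incr ht.1).prodMk (Q.measurable_unifPast m)
    have hfm : ∀ m, Measurable fun ω => (Q.incr t Q.T ω, Q.unifFuture m ω) := fun m =>
      (Q.measurable_incr ht.2).prodMk (Q.measurable_unifFuture m)
    have hBm : ∀ m, MeasurableSet (B ∩ {ω | Q.arr t ω = m}) := fun m => (hpm m).comap_le _ (hB m)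
    have hdisj : Pairwise (Function.onFun Disjoint fun m => B ∩ {ω | Q.arr t ω = m}) := by
      intro i j hij
      refine Set.disjoint_left.2 fun ω h1 h2 => hij ?_
      exact h1.2.symm.trans h2.2
    have hB' : B = ⋃ m, B ∩ {ω | Q.arr t ω = m} := by
      ext ω; simp
    have hpiece : ∀ m, ∫ ω in B ∩ {ω | Q.arr t ω = m}, Φ (Q.future t ω) ∂P =
        ∫ _ in B ∩ {ω | Q.arr t ω = m}, c ∂P := by
      intro m
      obtain ⟨S, hS, hS'⟩ := hB m
      have h1 : ∫ ω in B ∩ {ω | Q.arr t ω = m}, Φ (Q.future t ω) ∂P =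
          ∫ ω, S.indicator (fun _ => (1 : ℝ)) (Q.incr 0 t ω, Q.unifPast m ω) *
            Φ (Q.incr t Q.T ω, Q.unifFuture m ω) ∂P := by
        rw [← integral_indicator (hBm m)]
        congr 1
        ext ω
        by_cases hω : ω ∈ B ∩ {ω | Q.arr t ω = m}
        · have h2 : (Q.incr 0 t ω, Q.unifPast m ω) ∈ S := by rwa [← hS'] at hω
          have h3 : Q.arr t ω = m := hω.2
          rw [indicator_of_mem hω, indicator_of_mem h2, future, h3]
          simp
        · have h2 : (Q.incr 0 t ω, Q.unifPast m ω) ∉ S := by rwa [← hS'] at hω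
          rw [indicator_of_notMem hω, indicator_of_notMem h2, zero_mul]
      have hSm : Measurable (S.indicator (fun _ => (1 : ℝ))) := measurable_const.indicator hS
      have h4 := ((Q.indepFun_past_future ht m).comp hSm hΦ).integral_fun_mul_eq_mul_integral
        (hSm.comp (hpm m)).aestronglyMeasurable (hΦ.comp (hfm m)).aestronglyMeasurable
      have h5 : ∫ ω, S.indicator (fun _ => (1 : ℝ)) (Q.incr 0 t ω, Q.unifPast m ω) ∂P =
          P.real (B ∩ {ω | Q.arr t ω = m}) := by
        rw [← integral_indicator_one (hBm m), ← hS']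
        congr 1
      have h6 : ∫ ω, Φ (Q.incr t Q.T ω, Q.unifFuture m ω) ∂P = c := by
        rw [hc, ← Q.map_future ht m, integral_map (hfm m).aemeasurable hΦ.aestronglyMeasurable]
      simp only [Function.comp_apply] at h4
      rw [h1, h4, h5, h6, setIntegral_const, smul_eq_mul]
    rw [hB', integral_iUnion hBm hdisj hint.integrableOn]
    simp only [hpiece]
    rw [← integral_iUnion hBm hdisj (integrable_const c).integrableOn, setIntegral_const,
      smul_eq_mul]
  have h := key univ (isPastEvent_univ ht.1)
  rw [setIntegral_univ, probReal_univ, one_mul] at h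
  rw [key A hA, h]

end QueueModel

/-! ### The value function and the natural filtration of the queue -/

/-- Poisson distributions have a finite mean. -/
lemma integrable_natCast_poissonMeasure (r : ℝ≥0) :
    Integrable (fun n : ℕ => (n : ℝ)) (poissonMeasure r) := by
  rw [integrable_poissonMeasure_iff, ← summable_nat_add_iff 1]
  refine ((Real.summable_pow_div_factorial (r : ℝ)).mul_left (Real.exp (-r) * r)).congr fun n => ?_
  rw [Nat.factorial_succ, Real.norm_natCast, pow_succ]
  push_cast
  field_simp

/-- If on a set `B` of `m₂` every set of `m₁` agrees with a set of `m₂`, then the intersections of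
the sets of `m₁` with `B` belong to `m₂`. -/
lemma measurableSet_inter_of_le_comap {α : Type*} {m₁ m₂ : MeasurableSpace α} {A B : Set α}
    (h : m₁ ≤ (m₂.comap ((↑) : B → α)).map ((↑) : B → α)) (hA : MeasurableSet[m₁] A)
    (hB : MeasurableSet[m₂] B) : MeasurableSet[m₂] (A ∩ B) := by
  obtain ⟨A', hA', hAA'⟩ := h A hA
  have : A ∩ B = A' ∩ B := by
    rw [inter_comm A, inter_comm A', ← Subtype.image_preimage_coe, ← Subtype.image_preimage_coe,
      hAA']
  rw [this]
  exact MeasurableSet.inter hA' hB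

namespace QueueModel

variable {Ω : Type*} [MeasurableSpace Ω] {P : Measure Ω} {Q : QueueModel Ω P}

/-- The admission probability, with time projected to `[0, T]`. -/
def Policy.clampedProb (π : Q.Policy) (t : ℝ) (x : ℕ) : ℝ := π.prob (max 0 (min t Q.T)) x

lemma clamp_mem (Q : QueueModel Ω P) (t : ℝ) : max 0 (min t Q.T) ∈ Icc 0 Q.T :=
  ⟨le_max_left _ _, max_le Q.T_pos.le (min_le_right _ _)⟩

lemma clamp_of_mem {t : ℝ} (ht : t ∈ Icc 0 Q.T) : max 0 (min t Q.T) = t := by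
  rw [min_eq_left ht.2, max_eq_right ht.1]

lemma Policy.measurable_clampedProb (π : Q.Policy) (x : ℕ) :
    Measurable fun t => π.clampedProb t x := by
  have h : Measurable fun t : ℝ => (⟨max 0 (min t Q.T), Q.clamp_mem t⟩ : Icc (0 : ℝ) Q.T) :=
    (by fun_prop : Measurable fun t : ℝ => max 0 (min t Q.T)).subtype_mk
  exact (π.measurable_prob x).comp h

lemma Policy.clampedProb_full (π : Q.Policy) (t : ℝ) : π.clampedProb t Q.C = 0 :=
  π.prob_full _ (Q.clamp_mem t)

/-- The queue of the model is the one driven by `Q.path ω`; projecting the time in the admission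
probabilities to `[0, T]` makes no difference, as the event times lie in `[0, T]`. -/
lemma counts_eq (π : Q.Policy) {t₀ : ℝ} (h₀ : t₀ ∈ Icc 0 Q.T) (x₀ : ℕ) (ω : Ω) (n : ℕ) :
    counts π t₀ x₀ ω n = QueuePath.counts Q.T π.clampedProb (Q.path ω) t₀ x₀ n := by
  induction n with
  | zero => rfl
  | succ n ih =>
    have h1 := jumpTime_mem (N := (Q.path ω).events) h₀.2 (n + 1)
    have h2 : ∀ x, π.clampedProb (jumpTime Q.T (Q.path ω).events t₀ (n + 1)) x =
        π.prob (jumpTime Q.T (Q.path ω).events t₀ (n + 1)) x := fun x => by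
      rw [Policy.clampedProb, clamp_of_mem ⟨h₀.1.trans h1.1, h1.2⟩]
    rw [counts, QueuePath.counts, ih]
    simp only [h2]
    rfl

lemma admitted_eq (π : Q.Policy) {t₀ : ℝ} (h₀ : t₀ ∈ Icc 0 Q.T) (x₀ : ℕ) (t : ℝ) (ω : Ω) :
    admitted π t₀ x₀ t ω = (QueuePath.countsAt Q.T π.clampedProb (Q.path ω) t₀ x₀ t).1 := by
  rw [admitted, counts_eq π h₀]; rfl

lemma queue_eq (π : Q.Policy) {t₀ : ℝ} (h₀ : t₀ ∈ Icc 0 Q.T) (x₀ : ℕ) (t : ℝ) (ω : Ω) :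
    queue π t₀ x₀ t ω = QueuePath.state Q.T π.clampedProb (Q.path ω) t₀ x₀ t := by
  rw [queue, admitted, departed, counts_eq π h₀]; rfl

/-- The left limits of the queue differ from the queue only at countably many times. -/
lemma queueLeft_ae_eq (π : Q.Policy) {t₀ : ℝ} (h₀ : t₀ ∈ Icc 0 Q.T) (x₀ : ℕ) (ω : Ω) :
    ∀ᵐ t : ℝ, queueLeft π t₀ x₀ t ω =
      QueuePath.state Q.T π.clampedProb (Q.path ω) t₀ x₀ t := by
  have hmono : Monotone (QueuePath.numEvents Q.T (Q.path ω) t₀) :=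
    QueuePath.numEvents_mono (Q.isRandomDriver_path.counting ω)
  filter_upwards [hmono.countable_not_continuousAt.ae_notMem volume] with t ht
  have hc : ContinuousAt (QueuePath.numEvents Q.T (Q.path ω) t₀) t := by simpa using ht
  have hc' : ContinuousAt (fun s => queue π t₀ x₀ s ω) t := by
    simp only [queue_eq π h₀]
    exact (continuous_of_discreteTopology (f := fun n =>
      x₀ + (QueuePath.counts Q.T π.clampedProb (Q.path ω) t₀ x₀ n).1 -
        (QueuePath.counts Q.T π.clampedProb (Q.path ω) t₀ x₀ n).2)).continuousAt.comp hc
  rw [queueLeft, hc'.continuousWithinAt.leftLim_eq, queue_eq π h₀]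

/-- The running reward, with time projected to `[0, T]` and the state to `{0, …, C}`. -/
noncomputable def Policy.running (π : Q.Policy) (t : ℝ) (x : ℕ) : ℝ :=
  -Q.K₂ * (min x Q.C : ℕ) + Q.γ * π.entropy (max 0 (min t Q.T)) (min x Q.C)

/-- The terminal reward, with the state projected to `{0, …, C}`. -/
def terminal (Q : QueueModel Ω P) (x : ℕ) : ℝ := -Q.K₃ * (min x Q.C : ℕ)

lemma Policy.measurable_running (π : Q.Policy) (x : ℕ) : Measurable fun t => π.running t x := by
  have h := π.measurable_clampedProb (min x Q.C)
  have h1 : Measurable fun t => Real.negMulLog (π.clampedProb t (min x Q.C)) :=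
    Real.continuous_negMulLog.measurable.comp h
  have h2 : Measurable fun t => Real.negMulLog (1 - π.clampedProb t (min x Q.C)) :=
    Real.continuous_negMulLog.measurable.comp (h.const_sub 1)
  exact ((h1.add h2).const_mul Q.γ).const_add _

lemma Policy.exists_running_le (π : Q.Policy) : ∃ M, ∀ t x, |π.running t x| ≤ M := by
  obtain ⟨B, hB⟩ := (isCompact_Icc (a := (0 : ℝ)) (b := 1)).exists_bound_of_continuousOn
    Real.continuous_negMulLog.continuousOn
  refine ⟨|Q.K₂| * Q.C + |Q.γ| * (B + B), fun t x => ?_⟩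
  have hp := π.prob_mem _ (Q.clamp_mem t) (min x Q.C) (min_le_right _ _)
  have h1 := hB _ hp
  have h2 := hB (1 - π.prob (max 0 (min t Q.T)) (min x Q.C))
    ⟨by linarith [hp.2], by linarith [hp.1]⟩
  refine (abs_add_le _ _).trans (add_le_add ?_ ?_)
  · rw [abs_mul, abs_neg, Nat.abs_cast]
    gcongr
    exact min_le_right _ _
  · rw [abs_mul]
    gcongr
    exact (abs_add_le _ _).trans (add_le_add h1 h2)

lemma exists_terminal_le (Q : QueueModel Ω P) : ∃ M, ∀ x, |Q.terminal x| ≤ M := by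
  refine ⟨|Q.K₃| * Q.C, fun x => ?_⟩
  rw [terminal, abs_mul, abs_neg, Nat.abs_cast]
  gcongr
  exact min_le_right _ _

/-- The reward collected after time `t` by the queue that is started with `x` customers at `t`. -/
noncomputable def Policy.reward (π : Q.Policy) (t : ℝ) (x : ℕ) (ω : Ω) : ℝ :=
  QueuePath.reward Q.T π.clampedProb Q.K₁ π.running Q.terminal (Q.path ω) t x

/-- Almost surely no uniform variable is negative, so that nobody is ever admitted with admission
probability `0`; this keeps the queue within its capacity. -/
lemma ae_unif_nonneg (Q : QueueModel Ω P) : ∀ᵐ ω ∂P, ∀ k, 0 ≤ Q.unif k ω := by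
  rw [ae_all_iff]
  intro k
  have h : ∀ᵐ u ∂(P.map (Q.unif k)), 0 ≤ u := by
    rw [Q.unif_law]
    filter_upwards [ae_restrict_mem measurableSet_Icc] with u hu using hu.1
  exact ae_of_ae_map (Q.unif_measurable k).aemeasurable h

lemma state_le_capacity (π : Q.Policy) {ω : Ω} (hω : ∀ k, 0 ≤ Q.unif k ω) {t₀ : ℝ}
    (h₀ : t₀ ≤ Q.T) {x₀ : ℕ} (hx : x₀ ≤ Q.C) (t : ℝ) :
    QueuePath.state Q.T π.clampedProb (Q.path ω) t₀ x₀ t ≤ Q.C :=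
  QueuePath.state_le (fun t _ => π.clampedProb_full t) hω h₀ hx t

lemma intervalIntegrable_of_bounded {f : ℝ → ℝ} (hf : Measurable f) {M : ℝ}
    (hM : ∀ t, |f t| ≤ M) (a b : ℝ) : IntervalIntegrable f volume a b :=
  (intervalIntegrable_const (c := M)).mono_fun hf.aestronglyMeasurable
    (.of_forall fun t => (hM t).trans (le_abs_self M))

lemma measurable_comp_state (π : Q.Policy) {h : ℝ → ℕ → ℝ} (hh : ∀ x, Measurable fun t => h t x)
    {t₀ : ℝ} (h₀ : t₀ ≤ Q.T) (x₀ : ℕ) (ω : Ω) :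
    Measurable fun t => h t (QueuePath.state Q.T π.clampedProb (Q.path ω) t₀ x₀ t) :=
  (Q.isRandomDriver_path.measurable_comp_state π.measurable_clampedProb h₀ x₀ hh).comp
    (measurable_id.prodMk measurable_const)

/-- The running costs and rewards, written with left limits and two separate integrals, in terms of
the bounded running reward. -/
lemma integral_running_eq (π : Q.Policy) {ω : Ω} (hω : ∀ k, 0 ≤ Q.unif k ω) {t : ℝ}
    (ht : t ∈ Icc 0 Q.T) {x : ℕ} (hx : x ≤ Q.C) {ξ : ℝ → ℝ} (hξ : Measurable ξ) {B : ℝ}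
    (hB : ∀ s, |ξ s| ≤ B) :
    -Q.K₂ * (∫ s in t..Q.T, ξ s * (queueLeft π t x s ω : ℝ)) +
      Q.γ * (∫ s in t..Q.T, ξ s * π.entropy s (queueLeft π t x s ω)) =
    ∫ s in t..Q.T, ξ s * π.running s (QueuePath.state Q.T π.clampedProb (Q.path ω) t x s) := by
  set X := QueuePath.state Q.T π.clampedProb (Q.path ω) t x with hX
  have hXC : ∀ s, X s ≤ Q.C := fun s => state_le_capacity π hω ht.2 hx s
  obtain ⟨E, hE⟩ := (isCompact_Icc (a := (0 : ℝ)) (b := 1)).exists_bound_of_continuousOn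
    Real.continuous_negMulLog.continuousOn
  have hmul : ∀ {f : ℝ → ℝ} (_ : Measurable f) {M : ℝ} (_ : ∀ t, |f t| ≤ M),
      IntervalIntegrable (fun s => ξ s * f s) volume t Q.T := fun hf M hM =>
    intervalIntegrable_of_bounded (M := B * M) (hξ.mul hf) (fun s => by
      rw [Pi.mul_apply, abs_mul]
      exact mul_le_mul (hB s) (hM s) (abs_nonneg _) ((abs_nonneg _).trans (hB s))) _ _
  have hi1 : IntervalIntegrable (fun s => ξ s * (min (X s) Q.C : ℕ)) volume t Q.T :=
    hmul (M := Q.C) (measurable_comp_state π (h := fun _ x => ((min x Q.C : ℕ) : ℝ))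
      (fun _ => measurable_const) ht.2 x ω) fun s => by
        rw [Nat.abs_cast]; exact_mod_cast min_le_right _ _
  have hent : ∀ x, Measurable fun s => π.entropy (max 0 (min s Q.T)) (min x Q.C) := fun x =>
    (Real.continuous_negMulLog.measurable.comp (π.measurable_clampedProb _)).add
      (Real.continuous_negMulLog.measurable.comp ((π.measurable_clampedProb _).const_sub 1))
  have hi2 : IntervalIntegrable (fun s => ξ s * π.entropy (max 0 (min s Q.T)) (min (X s) Q.C))
      volume t Q.T :=
    hmul (M := E + E) (measurable_comp_state π
      (h := fun s x => π.entropy (max 0 (min s Q.T)) (min x Q.C)) hent ht.2 x ω) fun s => by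
        have hp := π.prob_mem _ (Q.clamp_mem s) (min (X s) Q.C) (min_le_right _ _)
        exact (abs_add_le _ _).trans (add_le_add (hE _ hp)
          (hE _ ⟨by linarith [hp.2], by linarith [hp.1]⟩))
  have e1 : ∫ s in t..Q.T, ξ s * (queueLeft π t x s ω : ℝ) =
      ∫ s in t..Q.T, ξ s * (min (X s) Q.C : ℕ) := by
    refine intervalIntegral.integral_congr_ae ?_
    filter_upwards [queueLeft_ae_eq π ht x ω] with s hs _
    rw [hs, min_eq_left (hXC s)]
  have e2 : ∫ s in t..Q.T, ξ s * π.entropy s (queueLeft π t x s ω) =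
      ∫ s in t..Q.T, ξ s * π.entropy (max 0 (min s Q.T)) (min (X s) Q.C) := by
    refine intervalIntegral.integral_congr_ae ?_
    filter_upwards [queueLeft_ae_eq π ht x ω] with s hs hs'
    rw [uIoc_of_le ht.2] at hs'
    rw [hs, min_eq_left (hXC s), clamp_of_mem ⟨ht.1.trans hs'.1.le, hs'.2⟩]
  rw [e1, e2, ← intervalIntegral.integral_const_mul, ← intervalIntegral.integral_const_mul,
    ← intervalIntegral.integral_add (hi1.const_mul _) (hi2.const_mul _)]
  refine intervalIntegral.integral_congr fun s _ => ?_
  simp only [Policy.running]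
  ring

/-- The value function is the expectation of the reward of the queue driven by `Q.path ω`. -/
lemma valueFunction_eq (π : Q.Policy) {t : ℝ} (ht : t ∈ Icc 0 Q.T) {x : ℕ} (hx : x ≤ Q.C) :
    valueFunction π t x = ∫ ω, π.reward t x ω ∂P := by
  refine integral_congr_ae ?_
  filter_upwards [Q.ae_unif_nonneg] with ω hω
  have h1 := integral_running_eq π hω ht hx (ξ := fun _ => 1) measurable_const (B := 1) (by simp)
  simp only [one_mul] at h1
  have h2 : Q.terminal (QueuePath.state Q.T π.clampedProb (Q.path ω) t x Q.T) =
      -Q.K₃ * (queue π t x Q.T ω : ℝ) := by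
    rw [terminal, min_eq_left (state_le_capacity π hω ht.2 hx _), queue_eq π ht]
  rw [Policy.reward, QueuePath.reward, ← h1, h2, admitted_eq π ht]
  ring

section integrability

variable (Q)

lemma integrable_of_isPoissonProcess {T : ℝ} {rate : ℝ → ℝ} {N : ℝ → Ω → ℕ}
    (hN : IsPoissonProcess P T rate N) (hT : 0 ≤ T) : Integrable (fun ω => (N T ω : ℝ)) P := by
  have h := integrable_natCast_poissonMeasure (∫ u in 0..T, rate u).toNNReal
  have hm : Measurable fun ω => N T ω - N 0 ω := (hN.measurable T).sub (hN.measurable 0)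
  rw [← hN.law 0 T le_rfl hT le_rfl, integrable_map_measure (by fun_prop) hm.aemeasurable] at h
  simpa [Function.comp_def, hN.zero] using h

/-- The number of events has a finite mean. -/
lemma integrable_events : Integrable (fun ω => ((Q.path ω).events Q.T : ℝ)) P := by
  have h := (integrable_of_isPoissonProcess Q.arr_poisson Q.T_pos.le).add
    (integrable_of_isPoissonProcess Q.srv_poisson Q.T_pos.le)
  refine h.congr (.of_forall fun ω => ?_)
  simp [QueuePath.events, path]

lemma numEvents_le (t₀ t : ℝ) (ω : Ω) (h₀ : t₀ ≤ Q.T) :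
    QueuePath.numEvents Q.T (Q.path ω) t₀ t ≤ (Q.path ω).events Q.T :=
  (Nat.sub_le _ _).trans ((Q.isRandomDriver_path.counting ω).events.mono
    (max_le h₀ (min_le_right _ _)))

variable {Q}

/-- All rewards have a common integrable bound. -/
lemma exists_reward_le (π : Q.Policy) : ∃ M, ∀ t ∈ Icc 0 Q.T, ∀ x ω,
    |π.reward t x ω| ≤ |Q.K₁| * (Q.path ω).events Q.T + M := by
  obtain ⟨Mh, hMh⟩ := π.exists_running_le
  obtain ⟨MG, hMG⟩ := Q.exists_terminal_le
  refine ⟨Mh * Q.T + MG, fun t ht x ω => ?_⟩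
  refine (QueuePath.abs_reward_le hMh hMG ht.2 _ _).trans ?_
  have h1 : ((QueuePath.numEvents Q.T (Q.path ω) t Q.T : ℕ) : ℝ) ≤ (Q.path ω).events Q.T := by
    exact_mod_cast Q.numEvents_le t Q.T ω ht.2
  have h2 : Mh * (Q.T - t) ≤ Mh * Q.T :=
    mul_le_mul_of_nonneg_left (by linarith [ht.1]) ((abs_nonneg _).trans (hMh 0 0))
  have h3 := mul_le_mul_of_nonneg_left h1 (abs_nonneg Q.K₁)
  linarith

lemma measurable_reward (π : Q.Policy) {t : ℝ} (ht : t ∈ Icc 0 Q.T) (x : ℕ) :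
    Measurable (π.reward t x) :=
  Q.isRandomDriver_path.measurable_reward π.measurable_clampedProb π.measurable_running ht.2 x

lemma integrable_reward [IsProbabilityMeasure P] (π : Q.Policy) {t : ℝ} (ht : t ∈ Icc 0 Q.T)
    (x : ℕ) : Integrable (π.reward t x) P := by
  obtain ⟨M, hM⟩ := exists_reward_le π
  exact ((Q.integrable_events.const_mul |Q.K₁|).add (integrable_const M)).mono'
    (measurable_reward π ht x).aestronglyMeasurable (.of_forall fun ω => hM t ht x ω)

end integrability

section Markov

variable [IsProbabilityMeasure P]

omit [IsProbabilityMeasure P] in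
/-- The reward after time `t` is a function of the future. -/
lemma reward_eq_future (π : Q.Policy) {t : ℝ} (ht : t ∈ Icc 0 Q.T) (x : ℕ) (ω : Ω) :
    π.reward t x ω = QueuePath.reward Q.T π.clampedProb Q.K₁ π.running Q.terminal
      (QueuePath.ofFuture (Q.future t ω)) t x := by
  have h1 : max t (min t Q.T) = t := by rw [min_eq_left ht.2, max_self]
  refine QueuePath.reward_congr (Q.isRandomDriver_path.counting ω)
    (QueuePath.isRandomDriver_ofFuture.counting _) ht.2 (fun s hs => ?_) (fun s hs => ?_)
    (fun k hk _ => ?_) x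
  · have := Q.arr_poisson.mono ω hs.1
    simp only [path, QueuePath.ofFuture, future, incr, increments, h1, min_eq_left hs.2,
      max_eq_right hs.1] at this ⊢
    omega
  · have := Q.srv_poisson.mono ω hs.1
    simp only [path, QueuePath.ofFuture, future, incr, increments, h1, min_eq_left hs.2,
      max_eq_right hs.1] at this ⊢
    omega
  · simp only [path, QueuePath.ofFuture, future, incr, increments, h1, unifFuture]
    congr 1
    omega

/-- The Markov property for the rewards: the expected reward after `t`, on an event of the past. -/
lemma setIntegral_reward (π : Q.Policy) {t : ℝ} (ht : t ∈ Icc 0 Q.T) {x : ℕ} (hx : x ≤ Q.C)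
    {A : Set Ω} (hA : Q.IsPastEvent t A) :
    ∫ ω in A, π.reward t x ω ∂P = P.real A * valueFunction π t x := by
  have hint := integrable_reward π ht x
  rw [valueFunction_eq π ht hx]
  simp only [funext (reward_eq_future π ht x)] at hint ⊢
  exact setIntegral_future ht hA (QueuePath.isRandomDriver_ofFuture.measurable_reward
    π.measurable_clampedProb π.measurable_running ht.2 x) hint

omit [IsProbabilityMeasure P] in
/-- Up to time `t`, if `m` customers have arrived by then, the queue depends only on the past. -/
lemma state_eq_past (π : Q.Policy) {t : ℝ} (ht : t ∈ Icc 0 Q.T) {s : ℝ} (hs : s ∈ Icc 0 t)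
    {ω : Ω} {m : ℕ} (hm : Q.arr t ω = m) :
    QueuePath.state Q.T π.clampedProb (Q.path ω) 0 0 s = QueuePath.state Q.T π.clampedProb
      (QueuePath.ofPast (Q.incr 0 t ω, Q.unifPast m ω)) 0 0 s := by
  have h1 : max 0 (min 0 t) = 0 := by rw [min_eq_left ht.1, max_self]
  rw [QueuePath.state, QueuePath.state, QueuePath.countsAt_congr
    (Q.isRandomDriver_path.counting ω) (QueuePath.isRandomDriver_ofPast.counting
      (Q.incr 0 t ω, Q.unifPast m ω)) ht.1 ht.2 (fun r hr => ?_) (fun r hr => ?_)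
      (fun k _ hk => ?_) hs]
  · simp only [path, QueuePath.ofPast, incr, increments, h1, min_eq_left hr.2, max_eq_right hr.1,
      Q.arr_poisson.zero]
    omega
  · simp only [path, QueuePath.ofPast, incr, increments, h1, min_eq_left hr.2, max_eq_right hr.1,
      Q.srv_poisson.zero]
    omega
  · simp only [path, Q.arr_poisson.zero, zero_add] at hk
    simp only [path, QueuePath.ofPast, incr, increments, h1, Q.arr_poisson.zero, zero_add,
      unifPast, Nat.sub_self]
    rw [min_eq_left (hk.trans hm.le)]

omit [IsProbabilityMeasure P] in
/-- The natural filtration of the queue consists of events of the past. -/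
lemma isPastEvent_of_measurableSet (π : Q.Policy) {t : ℝ≥0} (ht : (t : ℝ) ≤ Q.T) {A : Set Ω}
    (hA : MeasurableSet[naturalFiltration π t] A) : Q.IsPastEvent t A := by
  intro m
  have ht' : (t : ℝ) ∈ Icc 0 Q.T := ⟨t.2, ht⟩
  have hBm := isPastEvent_univ (Q := Q) t.2 m
  rw [univ_inter] at hBm
  refine measurableSet_inter_of_le_comap (iSup₂_le fun s hs => ?_) hA hBm
  rintro _ ⟨S, hS, rfl⟩
  have hs' : (s : ℝ) ∈ Icc 0 (t : ℝ) := ⟨s.2, hs⟩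
  refine ⟨{ω | QueuePath.state Q.T π.clampedProb
    (QueuePath.ofPast (Q.incr 0 t ω, Q.unifPast m ω)) 0 0 s ∈ S}, ⟨{z | QueuePath.state Q.T
      π.clampedProb (QueuePath.ofPast z) 0 0 s ∈ S}, ?_, rfl⟩, ?_⟩
  · exact QueuePath.isRandomDriver_ofPast.measurable_state π.measurable_clampedProb Q.T_pos.le 0 s
      (.of_discrete (s := S))
  · ext ⟨ω, hω⟩
    simp only [mem_preimage, mem_ofPred_eq, queue_eq π ⟨le_rfl, Q.T_pos.le⟩,
      state_eq_past π ht' hs' hω]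

omit [IsProbabilityMeasure P] in
lemma prob_jumpFree_pos {rate : ℝ → ℝ} {N : ℝ → Ω → ℕ} (hN : IsPoissonProcess P Q.T rate N)
    {t s : ℝ} (ht : 0 ≤ t) (hts : t ≤ s) (hs : s ≤ Q.T) :
    0 < P {ω | N s ω - N t ω = 0} := by
  have h1 := hN.law t s ht hts hs
  have h2 : P {ω | N s ω - N t ω = 0} = P.map (fun ω => N s ω - N t ω) {0} := by
    have hm : Measurable fun ω => N s ω - N t ω := (hN.measurable s).sub (hN.measurable t)
    rw [Measure.map_apply hm (measurableSet_singleton 0)]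
    rfl
  rw [h2, h1, poissonMeasure_singleton]
  exact ENNReal.ofReal_pos.2 (by simp [Real.exp_pos])

omit [IsProbabilityMeasure P] in
/-- With positive probability, nothing happens between two given times. -/
lemma prob_noEvents_pos {t s : ℝ} (ht : 0 ≤ t) (hts : t ≤ s) (hs : s ≤ Q.T) :
    0 < P {ω | Q.arr s ω - Q.arr t ω + (Q.srv s ω - Q.srv t ω) = 0} := by
  have h1 : {ω | Q.arr s ω - Q.arr t ω + (Q.srv s ω - Q.srv t ω) = 0} =
      {ω | Q.arr s ω - Q.arr t ω = 0} ∩ {ω | Q.srv s ω - Q.srv t ω = 0} := by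
    ext ω; simp only [mem_ofPred_eq, mem_inter_iff]; omega
  have hm : Measurable fun f : Icc (0 : ℝ) Q.T → ℕ =>
      f ⟨s, ht.trans hts, hs⟩ - f ⟨t, ht, hts.trans hs⟩ :=
    (measurable_pi_apply _).sub (measurable_pi_apply _)
  have h2 := Q.arr_indep_srv.measure_inter_preimage_eq_mul
    {f | f ⟨s, ht.trans hts, hs⟩ - f ⟨t, ht, hts.trans hs⟩ = 0}
    {f | f ⟨s, ht.trans hts, hs⟩ - f ⟨t, ht, hts.trans hs⟩ = 0}
    (hm (measurableSet_singleton 0))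
    (hm (measurableSet_singleton 0))
  rw [h1]
  refine lt_of_lt_of_eq ?_ h2.symm
  exact ENNReal.mul_pos (prob_jumpFree_pos Q.arr_poisson ht hts hs).ne'
    (prob_jumpFree_pos Q.srv_poisson ht hts hs).ne'

omit [IsProbabilityMeasure P] in
lemma measurableSet_queue_eq (π : Q.Policy) (t : ℝ≥0) (x : ℕ) :
    MeasurableSet[naturalFiltration π t] {ω | queue π 0 0 t ω = x} :=
  ((Filtration.stronglyAdapted_natural fun t : ℝ≥0 =>
    (measurable_queue π ⟨le_rfl, Q.T_pos.le⟩ 0 t).stronglyMeasurable) t).measurable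
      (measurableSet_singleton x)

/-- A state that is occupied with positive probability remains so: with positive probability
nothing happens for a while. -/
lemma prob_queue_eq_pos_mono (π : Q.Policy) {t s : ℝ} (ht : 0 ≤ t) (hts : t ≤ s) (hs : s ≤ Q.T)
    {x : ℕ} (h : 0 < P {ω | queue π 0 0 t ω = x}) : 0 < P {ω | queue π 0 0 s ω = x} := by
  have ht' : t ∈ Icc 0 Q.T := ⟨ht, hts.trans hs⟩
  set A := {ω | queue π 0 0 t ω = x} with hA
  have hpast : Q.IsPastEvent t A :=
    isPastEvent_of_measurableSet π (t := ⟨t, ht⟩) ht'.2 (measurableSet_queue_eq π ⟨t, ht⟩ x)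
  set E := {ω | Q.arr s ω - Q.arr t ω + (Q.srv s ω - Q.srv t ω) = 0} with hE
  have hEm : MeasurableSet E := (((Q.arr_poisson.measurable s).sub (Q.arr_poisson.measurable t)).add
    ((Q.srv_poisson.measurable s).sub (Q.srv_poisson.measurable t))) (measurableSet_singleton 0)
  set S : Set ((CountingPath × CountingPath) × (ℕ → ℝ)) :=
    {z | z.1.1.1 s + z.1.2.1 s = 0} with hS
  have hSm : MeasurableSet S := by
    have h := QueuePath.isRandomDriver_ofFuture.events s
    exact h (measurableSet_singleton 0)
  have hind : ∀ ω, S.indicator (fun _ => (1 : ℝ)) (Q.future t ω) = E.indicator 1 ω := by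
    intro ω
    have : Q.future t ω ∈ S ↔ ω ∈ E := by
      simp only [hS, hE, future, incr, increments, mem_ofPred_eq, min_eq_left hs, max_eq_right hts]
    by_cases h : ω ∈ E
    · simp [h, this.2 h]
    · simp [h, this.not.2 h]
  have hmark := setIntegral_future ht' hpast (Φ := S.indicator fun _ => (1 : ℝ))
    (measurable_const.indicator hSm) (by
      simp only [hind]
      exact (integrable_const (1 : ℝ)).indicator hEm)
  simp only [hind] at hmark
  rw [integral_indicator_one hEm, integral_indicator_one hEm, measureReal_restrict_apply hEm]
    at hmark
  have hpos : 0 < P.real (E ∩ A) := by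
    rw [hmark]
    exact mul_pos (ENNReal.toReal_pos h.ne' (measure_ne_top _ _))
      (ENNReal.toReal_pos (prob_noEvents_pos ht hts hs).ne' (measure_ne_top _ _))
  refine lt_of_lt_of_le (ENNReal.toReal_pos_iff.1 hpos).1 (measure_mono fun ω hω => ?_)
  have h1 : (Q.path ω).events s = (Q.path ω).events t := by
    have h2 : Q.arr s ω - Q.arr t ω + (Q.srv s ω - Q.srv t ω) = 0 := hω.1
    have h3 := Q.arr_poisson.mono ω hts
    have h4 := Q.srv_poisson.mono ω hts
    simp only [QueuePath.events, path] at h2 h3 h4 ⊢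
    omega
  have h5 : queue π 0 0 t ω = x := hω.2
  rw [queue_eq π ⟨le_rfl, Q.T_pos.le⟩] at h5
  change queue π 0 0 s ω = x
  rw [queue_eq π ⟨le_rfl, Q.T_pos.le⟩, ← h5, QueuePath.state, QueuePath.state, QueuePath.countsAt,
    QueuePath.countsAt, QueuePath.numEvents_of_mem ⟨ht.trans hts, hs⟩,
    QueuePath.numEvents_of_mem ht', h1]

/-- A state that is not accessible from time `t` on is not occupied at time `t`. -/
lemma prob_queue_eq_zero_of_not_accessible (π : Q.Policy) {t : ℝ} (ht : 0 ≤ t) {x : ℕ}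
    (h : ¬ Accessible π t x) : P {ω | queue π 0 0 t ω = x} = 0 := by
  simp only [Accessible, not_forall] at h
  obtain ⟨s, hts, hs, h⟩ := h
  by_contra h0
  exact h (prob_queue_eq_pos_mono π ht hts.le hs (pos_iff_ne_zero.2 h0))

/-- The value function is right-continuous in time: for each realization, the queues started with
`x` customers at times `s > t` close to `t` are the same as the queue started at `t`. -/
lemma tendsto_valueFunction (π : Q.Policy) {t : ℝ} (ht : t ∈ Ico 0 Q.T) {x : ℕ} (hx : x ≤ Q.C) :
    Filter.Tendsto (fun s => valueFunction π s x) (nhdsWithin t (Ioi t))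
      (nhds (valueFunction π t x)) := by
  have ht' : t ∈ Icc 0 Q.T := ⟨ht.1, ht.2.le⟩
  obtain ⟨M, hM⟩ := exists_reward_le π
  obtain ⟨Mh, hMh⟩ := π.exists_running_le
  have hev : ∀ᶠ s in nhdsWithin t (Ioi t), s ∈ Icc 0 Q.T := by
    filter_upwards [Ioo_mem_nhdsGT ht.2] with s hs using ⟨ht.1.trans hs.1.le, hs.2.le⟩
  have key : Filter.Tendsto (fun s => ∫ ω, π.reward s x ω ∂P) (nhdsWithin t (Ioi t))
      (nhds (∫ ω, π.reward t x ω ∂P)) := by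
    refine tendsto_integral_filter_of_dominated_convergence
      (fun ω => |Q.K₁| * (Q.path ω).events Q.T + M) ?_ ?_
      ((Q.integrable_events.const_mul |Q.K₁|).add (integrable_const M)) (.of_forall fun ω => ?_)
    · filter_upwards [hev] with s hs using (measurable_reward π hs x).aestronglyMeasurable
    · filter_upwards [hev] with s hs using .of_forall fun ω => hM s hs x ω
    · have hw := Q.isRandomDriver_path.counting ω
      obtain ⟨b, hb, hb'⟩ := hw.events.exists_eq_right t
      set X := QueuePath.state Q.T π.clampedProb (Q.path ω) t x with hX
      have hXi : ∀ a b, IntervalIntegrable (fun r => π.running r (X r)) volume a b :=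
        intervalIntegrable_of_bounded (measurable_comp_state π π.measurable_running ht'.2 x ω)
          fun r => hMh _ _
      have hprim : Filter.Tendsto (fun s => ∫ r in t..s, π.running r (X r))
          (nhdsWithin t (Ioi t)) (nhds 0) := by
        have := (intervalIntegral.continuous_primitive hXi t).tendsto t
        rw [intervalIntegral.integral_same] at this
        exact this.mono_left nhdsWithin_le_nhds
      have hsub : Filter.Tendsto
          (fun s => π.reward t x ω - ∫ r in t..s, π.running r (X r)) (nhdsWithin t (Ioi t))
          (nhds (π.reward t x ω)) := by
        simpa using hprim.const_sub (π.reward t x ω)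
      refine hsub.congr' ?_
      filter_upwards [Ioo_mem_nhdsGT hb, hev, self_mem_nhdsWithin] with s hsb hs hst
      have hst : t ≤ s := le_of_lt hst
      have hcs : QueuePath.countsAt Q.T π.clampedProb (Q.path ω) t x s = 0 := by
        rw [QueuePath.countsAt, QueuePath.numEvents_of_mem ⟨hst, hs.2⟩,
          hb' s ⟨hst, hsb.2⟩, Nat.sub_self]
        rfl
      have hXs : X s = x := by simp [hX, QueuePath.state, hcs]
      have h1 := QueuePath.reward_state (p := π.clampedProb) (K := Q.K₁) (h := π.running)
        (G := Q.terminal) hw hst hs.2 x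
      rw [← hX, hXs, hcs] at h1
      rw [Policy.reward, Policy.reward, h1, QueuePath.reward, ← hX,
        ← intervalIntegral.integral_add_adjacent_intervals (hXi t s) (hXi s Q.T)]
      simp
      ring
  rw [valueFunction_eq π ht' hx]
  refine key.congr' ?_
  filter_upwards [hev] with s hs using (valueFunction_eq π hs hx).symm

end Markov

end QueueModel

/-! ### A monotone class theorem for signed functionals -/

section monotoneClass

variable {Z Z₁ Z₂ E : Type*} [MeasurableSpace Z] [MeasurableSpace Z₁] [MeasurableSpace Z₂]
  [m : MeasurableSpace E]

/-- The image under `τ` of the measure with density the positive part of `φ`. -/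
noncomputable def mapPosPart (ρ : Measure Z) (φ : Z → ℝ) (τ : Z → E) : Measure E :=
  (ρ.withDensity fun z => ENNReal.ofReal (φ z)).map τ

lemma isFiniteMeasure_mapPosPart {ρ : Measure Z} {φ : Z → ℝ} (hφ : Integrable φ ρ) (τ : Z → E) :
    IsFiniteMeasure (mapPosPart ρ φ τ) := by
  have := isFiniteMeasure_withDensity_ofReal hφ.2
  exact Measure.isFiniteMeasure_map _ _

lemma integral_mapPosPart {ρ : Measure Z} {φ : Z → ℝ} (hφm : Measurable φ) {τ : Z → E}
    (hτ : Measurable τ) {f : E → ℝ} (hf : StronglyMeasurable f) :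
    ∫ x, f x ∂(mapPosPart ρ φ τ) = ∫ z, max (φ z) 0 * f (τ z) ∂ρ := by
  rw [mapPosPart, integral_map hτ.aemeasurable hf.aestronglyMeasurable,
    integral_withDensity_eq_integral_toReal_smul hφm.ennreal_ofReal
      (.of_forall fun _ => ENNReal.ofReal_lt_top)]
  simp only [ENNReal.toReal_ofReal', smul_eq_mul]

/-- The images of the positive and of the negative part of `φ` represent, as a difference, the
functional `f ↦ ∫ (f ∘ τ) φ`. -/
lemma integral_mapPosPart_sub {ρ : Measure Z} {φ : Z → ℝ} (hφm : Measurable φ)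
    (hφ : Integrable φ ρ) {τ : Z → E} (hτ : Measurable τ) {f : E → ℝ} (hf : StronglyMeasurable f)
    {B : ℝ} (hB : ∀ x, |f x| ≤ B) :
    (∫ x, f x ∂(mapPosPart ρ φ τ)) - ∫ x, f x ∂(mapPosPart ρ (-φ) τ) =
      ∫ z, f (τ z) * φ z ∂ρ := by
  have hfm : AEStronglyMeasurable (fun z => f (τ z)) ρ :=
    (hf.comp_measurable hτ).aestronglyMeasurable
  have hb : ∀ᵐ z ∂ρ, ‖f (τ z)‖ ≤ B := .of_forall fun z => hB _
  rw [integral_mapPosPart hφm hτ hf, integral_mapPosPart hφm.neg hτ hf, ← integral_sub]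
  · refine integral_congr_ae (.of_forall fun z => ?_)
    simp only [Pi.neg_apply]
    rcases le_total 0 (φ z) with h | h
    · rw [max_eq_left h, max_eq_right (by linarith)]; ring
    · rw [max_eq_right h, max_eq_left (by linarith)]; ring
  · exact hφ.pos_part.mul_bdd hfm hb
  · exact hφ.neg.pos_part.mul_bdd hfm hb

/-- A monotone class theorem: a functional `f ↦ ∫ (f ∘ τ₁) φ₁ + ∫ (f ∘ τ₂) φ₂` which vanishes on the
indicators of the sets of a generating π-system and on constants vanishes on all bounded measurable
functions. -/
theorem integral_comp_mul_add_eq_zero {𝒞 : Set (Set E)} (hm : m = MeasurableSpace.generateFrom 𝒞)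
    (h𝒞 : IsPiSystem 𝒞) {ρ₁ : Measure Z₁} {ρ₂ : Measure Z₂} {φ₁ : Z₁ → ℝ} {φ₂ : Z₂ → ℝ}
    (hφm₁ : Measurable φ₁) (hφm₂ : Measurable φ₂) (hφ₁ : Integrable φ₁ ρ₁)
    (hφ₂ : Integrable φ₂ ρ₂) {τ₁ : Z₁ → E} {τ₂ : Z₂ → E} (hτ₁ : Measurable τ₁)
    (hτ₂ : Measurable τ₂)
    (h : ∀ S ∈ insert univ 𝒞, (∫ z, S.indicator 1 (τ₁ z) * φ₁ z ∂ρ₁) +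
      ∫ z, S.indicator 1 (τ₂ z) * φ₂ z ∂ρ₂ = 0)
    {f : E → ℝ} (hf : StronglyMeasurable f) {B : ℝ} (hB : ∀ x, |f x| ≤ B) :
    (∫ z, f (τ₁ z) * φ₁ z ∂ρ₁) + ∫ z, f (τ₂ z) * φ₂ z ∂ρ₂ = 0 := by
  have i₁ := isFiniteMeasure_mapPosPart hφ₁ τ₁
  have i₂ := isFiniteMeasure_mapPosPart hφ₂ τ₂
  have i₃ := isFiniteMeasure_mapPosPart hφ₁.neg τ₁
  have i₄ := isFiniteMeasure_mapPosPart hφ₂.neg τ₂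
  set ν₁ := mapPosPart ρ₁ φ₁ τ₁ + mapPosPart ρ₂ φ₂ τ₂ with hν₁
  set ν₂ := mapPosPart ρ₁ (-φ₁) τ₁ + mapPosPart ρ₂ (-φ₂) τ₂ with hν₂
  have key : ∀ {g : E → ℝ} (_ : StronglyMeasurable g) {b : ℝ} (_ : ∀ x, |g x| ≤ b),
      (∫ z, g (τ₁ z) * φ₁ z ∂ρ₁) + ∫ z, g (τ₂ z) * φ₂ z ∂ρ₂ =
        (∫ x, g x ∂ν₁) - ∫ x, g x ∂ν₂ := by
    intro g hg b hb
    have hi : ∀ (ν : Measure E) [IsFiniteMeasure ν], Integrable g ν := fun ν _ =>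
      Integrable.of_bound hg.aestronglyMeasurable b (.of_forall hb)
    rw [hν₁, hν₂, integral_add_measure (hi _) (hi _), integral_add_measure (hi _) (hi _),
      ← integral_mapPosPart_sub hφm₁ hφ₁ hτ₁ hg hb, ← integral_mapPosPart_sub hφm₂ hφ₂ hτ₂ hg hb]
    ring
  have hS : ∀ S ∈ insert univ 𝒞, ν₁ S = ν₂ S := by
    intro S hS
    have hSm : MeasurableSet S := by
      rcases hS with rfl | hS
      · exact MeasurableSet.univ
      · rw [hm]; exact MeasurableSpace.measurableSet_generateFrom hS
    have h1 := key (g := S.indicator 1) (stronglyMeasurable_one.indicator hSm) (b := 1) fun x => by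
      by_cases hx : x ∈ S <;> simp [hx]
    rw [h S hS, integral_indicator_one hSm, integral_indicator_one hSm] at h1
    exact (measureReal_eq_measureReal_iff).1 (by linarith)
  have hν : ν₁ = ν₂ := ext_of_generate_finite 𝒞 hm h𝒞 (fun S h => hS S (mem_insert_of_mem _ h))
    (hS univ (mem_insert _ _))
  rw [key hf hB, hν, sub_self]

end monotoneClass

/-! ### The pathwise integral -/

/-- Finitely many bounded functions have a common bound. -/
lemma exists_uniform_bound {α : Type*} {f : ℕ → α → ℝ} {s : Set α} {C : ℕ}
    (h : ∀ x ≤ C, ∃ M, ∀ t ∈ s, |f x t| ≤ M) : ∃ M, ∀ x ≤ C, ∀ t ∈ s, |f x t| ≤ M := by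
  choose! M hM using h
  refine ⟨∑ x ∈ Finset.range (C + 1), |M x|, fun x hx t ht => (hM x hx t ht).trans ?_⟩
  exact (le_abs_self _).trans (Finset.single_le_sum (f := fun x => |M x|)
    (fun _ _ => abs_nonneg _) (Finset.mem_range_succ_iff.2 hx))

namespace QueueModel

variable {Ω : Type*} [MeasurableSpace Ω] {P : Measure Ω} {Q : QueueModel Ω P}
  {v : ℝ → ℕ → ℝ}

/-- The time derivative of `v` in `(0, T)`, with the state projected to `{0, …, C}`, extended by
zero. -/
noncomputable def timeDeriv (Q : QueueModel Ω P) (v : ℝ → ℕ → ℝ) (t : ℝ) (x : ℕ) : ℝ :=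
  (Ioo 0 Q.T).indicator (deriv fun t => v t (min x Q.C)) t

lemma measurable_timeDeriv (x : ℕ) : Measurable fun t => Q.timeDeriv v t x :=
  (measurable_deriv _).indicator measurableSet_Ioo

lemma hasDerivAt_timeDeriv (hv : ∀ x ≤ Q.C, ContDiffOn ℝ 1 (fun t => v t x) (Icc 0 Q.T)) (x : ℕ)
    {t : ℝ} (ht : t ∈ Ioo 0 Q.T) :
    HasDerivAt (fun t => v t (min x Q.C)) (Q.timeDeriv v t x) t := by
  rw [timeDeriv, indicator_of_mem ht]
  have h := (hv _ (min_le_right x Q.C)).contDiffAt (Icc_mem_nhds ht.1 ht.2)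
  exact (h.differentiableAt one_ne_zero).hasDerivAt

lemma exists_timeDeriv_le (hv : ∀ x ≤ Q.C, ContDiffOn ℝ 1 (fun t => v t x) (Icc 0 Q.T)) :
    ∃ M, ∀ t x, |Q.timeDeriv v t x| ≤ M := by
  have h : ∃ M, ∀ x ≤ Q.C, ∀ t ∈ Icc 0 Q.T, |derivWithin (fun t => v t x) (Icc 0 Q.T) t| ≤ M :=
    exists_uniform_bound fun x hx => isCompact_Icc.exists_bound_of_continuousOn
      ((hv x hx).continuousOn_derivWithin (uniqueDiffOn_Icc Q.T_pos) le_rfl)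
  obtain ⟨M, hM⟩ := h
  refine ⟨M, fun t x => ?_⟩
  by_cases ht : t ∈ Ioo 0 Q.T
  · rw [timeDeriv, indicator_of_mem ht, ← derivWithin_of_mem_nhds (Icc_mem_nhds ht.1 ht.2)]
    exact hM _ (min_le_right _ _) t (Ioo_subset_Icc_self ht)
  · rw [timeDeriv, indicator_of_notMem ht, abs_zero]
    exact (abs_nonneg _).trans (hM 0 (Nat.zero_le _) 0 ⟨le_rfl, Q.T_pos.le⟩)

lemma exists_value_le (hv : ∀ x ≤ Q.C, ContDiffOn ℝ 1 (fun t => v t x) (Icc 0 Q.T)) :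
    ∃ M, ∀ x ≤ Q.C, ∀ t ∈ Icc 0 Q.T, |v t x| ≤ M :=
  exists_uniform_bound fun x hx =>
    isCompact_Icc.exists_bound_of_continuousOn (hv x hx).continuousOn

/-- The growth rate of `v (t, X_t)` plus the rewards, between the events. -/
noncomputable def Policy.rate (π : Q.Policy) (v : ℝ → ℕ → ℝ) (t : ℝ) (x : ℕ) : ℝ :=
  Q.timeDeriv v t x + π.running t x

/-- The numbers of admissions and departures after the `n`-th event. -/
noncomputable def Policy.countsAfter (π : Q.Policy) (ω : Ω) (n : ℕ) : ℕ × ℕ :=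
  QueuePath.counts Q.T π.clampedProb (Q.path ω) 0 0 n

/-- The queue length after the `n`-th event. -/
noncomputable def Policy.stateAfter (π : Q.Policy) (ω : Ω) (n : ℕ) : ℕ :=
  0 + (π.countsAfter ω n).1 - (π.countsAfter ω n).2

/-- The time of the `n`-th event, and `T` if there are fewer than `n` events. -/
noncomputable def epoch (Q : QueueModel Ω P) (n : ℕ) (ω : Ω) : ℝ :=
  jumpTime Q.T (Q.path ω).events 0 n

/-- The number of events in `(0, T]`. -/
def totalEvents (Q : QueueModel Ω P) (ω : Ω) : ℕ := jumpCount Q.T (Q.path ω).events Q.T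

/-- The jump of `v (t, X_t)` plus the admission reward, at the event with number `k + 1`. -/
noncomputable def Policy.jump (π : Q.Policy) (v : ℝ → ℕ → ℝ) (ω : Ω) (k : ℕ) : ℝ :=
  v (Q.epoch (k + 1) ω) (min (π.stateAfter ω (k + 1)) Q.C) -
    v (Q.epoch (k + 1) ω) (min (π.stateAfter ω k) Q.C) +
    Q.K₁ * ((π.countsAfter ω (k + 1)).1 - (π.countsAfter ω k).1)

/-- The queue started empty at time `0`. -/
noncomputable def Policy.state (π : Q.Policy) (ω : Ω) (t : ℝ) : ℕ :=
  QueuePath.state Q.T π.clampedProb (Q.path ω) 0 0 t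

lemma state_eq_stateAfter (π : Q.Policy) (ω : Ω) (t : ℝ) :
    π.state ω t = π.stateAfter ω (jumpCount Q.T (Q.path ω).events t) := rfl

section path

variable (hv : ∀ x ≤ Q.C, ContDiffOn ℝ 1 (fun t => v t x) (Icc 0 Q.T))
include hv

/-- The pathwise integral, split into its absolutely continuous and its discrete part. -/
lemma tdIntegral_eq (π : Q.Policy) {ω : Ω} (hω : ∀ k, 0 ≤ Q.unif k ω) {ξ : ℝ≥0 → Ω → ℝ}
    (hξ : Measurable fun t : ℝ => ξ t.toNNReal ω) {B : ℝ} (hB : ∀ t ω, |ξ t ω| ≤ B) :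
    tdIntegral π v ξ ω =
      (∫ t in 0..Q.T, ξ t.toNNReal ω * π.rate v t (π.state ω t)) +
      ∑ k ∈ Finset.range (Q.totalEvents ω), ξ (Q.epoch (k + 1) ω).toNNReal ω * π.jump v ω k := by
  have hN := (Q.isRandomDriver_path.counting ω).events
  have h0 : (0 : ℝ) ∈ Icc 0 Q.T := ⟨le_rfl, Q.T_pos.le⟩
  obtain ⟨M, hM⟩ := exists_timeDeriv_le hv
  obtain ⟨Mr, hMr⟩ := π.exists_running_le
  have h1 := stieltjesIntegral_piecewise Q.T_pos.le hN
    (W := fun t n => v t (min (π.stateAfter ω n) Q.C))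
    (g := fun t n => Q.timeDeriv v t (π.stateAfter ω n))
    (fun n => (hv _ (min_le_right _ _)).continuousOn) (fun n t ht => hasDerivAt_timeDeriv hv _ ht)
    (fun n => measurable_timeDeriv _) (fun t n => hM _ _) hξ (fun t => hB _ _)
  have h2 := stieltjesIntegral_piecewise Q.T_pos.le hN
    (W := fun t n => ((π.countsAfter ω n).1 : ℝ)) (g := fun t n => 0) (M := 0)
    (fun n => continuousOn_const) (fun n t ht => hasDerivAt_const _ _)
    (fun n => measurable_const) (fun t n => by simp) hξ (fun t => hB _ _)
  have e1 : (fun t => v (max 0 (min t Q.T)) (queue π 0 0 t ω)) = fun t =>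
      v (max 0 (min t Q.T)) (min (π.stateAfter ω (jumpCount Q.T (Q.path ω).events t)) Q.C) := by
    funext t
    rw [queue_eq π h0, ← state_eq_stateAfter, Policy.state,
      min_eq_left (state_le_capacity π hω h0.2 (Nat.zero_le _) t)]
  have e2 : (fun t => (admitted π 0 0 t ω : ℝ)) =
      fun t => ((π.countsAfter ω (jumpCount Q.T (Q.path ω).events t)).1 : ℝ) := by
    funext t
    rw [admitted_eq π h0]
    rfl
  have h3 := integral_running_eq π hω h0 (Nat.zero_le _) hξ (fun t => hB _ _)
  have hi : ∀ {h : ℝ → ℕ → ℝ} (_ : ∀ x, Measurable fun t => h t x) {b : ℝ} (_ : ∀ t x, |h t x| ≤ b),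
      IntervalIntegrable (fun t => ξ t.toNNReal ω * h t (π.state ω t)) volume 0 Q.T := by
    intro h hh b hb
    refine intervalIntegrable_of_bounded (M := B * b)
      (hξ.mul (measurable_comp_state π hh h0.2 0 ω)) (fun t => ?_) _ _
    rw [Pi.mul_apply, abs_mul]
    exact mul_le_mul (hB _ _) (hb _ _) (abs_nonneg _) ((abs_nonneg _).trans (hB 0 ω))
  have e3 : ∫ t in 0..Q.T, ξ t.toNNReal ω * π.rate v t (π.state ω t) =
      (∫ t in 0..Q.T, ξ t.toNNReal ω * Q.timeDeriv v t (π.state ω t)) +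
      ∫ t in 0..Q.T, ξ t.toNNReal ω * π.running t (π.state ω t) := by
    rw [← intervalIntegral.integral_add (hi measurable_timeDeriv hM)
      (hi π.measurable_running hMr)]
    refine intervalIntegral.integral_congr fun t _ => ?_
    simp only [Policy.rate]
    ring
  have e4 : ∑ k ∈ Finset.range (Q.totalEvents ω), ξ (Q.epoch (k + 1) ω).toNNReal ω * π.jump v ω k =
      (∑ k ∈ Finset.range (Q.totalEvents ω), ξ (Q.epoch (k + 1) ω).toNNReal ω *
        (v (Q.epoch (k + 1) ω) (min (π.stateAfter ω (k + 1)) Q.C) -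
          v (Q.epoch (k + 1) ω) (min (π.stateAfter ω k) Q.C))) +
      Q.K₁ * ∑ k ∈ Finset.range (Q.totalEvents ω), ξ (Q.epoch (k + 1) ω).toNNReal ω *
        ((π.countsAfter ω (k + 1)).1 - (π.countsAfter ω k).1) := by
    rw [Finset.mul_sum, ← Finset.sum_add_distrib]
    refine Finset.sum_congr rfl fun k _ => ?_
    rw [Policy.jump]
    ring
  rw [tdIntegral, e1, e2, h1, h2, e3, e4]
  simp only [mul_zero, intervalIntegral.integral_zero, zero_add]
  change _ = ∫ t in 0..Q.T, ξ t.toNNReal ω * π.running t (π.state ω t) at h3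
  rw [← h3]
  simp only [totalEvents, epoch, state_eq_stateAfter]
  ring

/-- For a test function that is the indicator of `(s, ∞)`, the pathwise integral is the reward after
time `s` minus the value at time `s`, if `v` has the right terminal values. -/
lemma integral_add_sum_indicator_Ioi (hvT : ∀ x ≤ Q.C, v Q.T x = -Q.K₃ * x) (π : Q.Policy) (ω : Ω)
    {s : ℝ} (hs : s ∈ Ico 0 Q.T) :
    (∫ t in 0..Q.T, (Ioi s).indicator 1 t * π.rate v t (π.state ω t)) +
      ∑ k ∈ Finset.range (Q.totalEvents ω),
        (Ioi s).indicator 1 (Q.epoch (k + 1) ω) * π.jump v ω k =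
    π.reward s (π.state ω s) ω - v s (min (π.state ω s) Q.C) := by
  have hw := Q.isRandomDriver_path.counting ω
  have hN := hw.events
  have h0 : (0 : ℝ) ∈ Icc 0 Q.T := ⟨le_rfl, Q.T_pos.le⟩
  have hsT : s ∈ Icc 0 Q.T := ⟨hs.1, hs.2.le⟩
  obtain ⟨M, hM⟩ := exists_timeDeriv_le hv
  obtain ⟨Mr, hMr⟩ := π.exists_running_le
  -- the path of `v (t, X_t) + K₁ A_t` at time `t`
  have hpath : ∀ t ∈ Icc 0 Q.T,
      v t (min (π.state ω t) Q.C) +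
        Q.K₁ * (π.countsAfter ω (jumpCount Q.T (Q.path ω).events t)).1 =
      v 0 (min (π.stateAfter ω 0) Q.C) + Q.K₁ * (π.countsAfter ω 0).1 +
      (∫ r in 0..t, Q.timeDeriv v r (π.state ω r)) +
      ∑ k ∈ Finset.range (jumpCount Q.T (Q.path ω).events t), π.jump v ω k := by
    intro t ht
    have := piecewise_eq_integral_add_sum Q.T_pos.le hN
      (W := fun t n => v t (min (π.stateAfter ω n) Q.C) + Q.K₁ * (π.countsAfter ω n).1)
      (g := fun t n => Q.timeDeriv v t (π.stateAfter ω n))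
      (fun n => (hv _ (min_le_right _ _)).continuousOn.add continuousOn_const)
      (fun n t ht => (hasDerivAt_timeDeriv hv _ ht).add_const _)
      (fun n => measurable_timeDeriv _) (fun t n => hM _ _) ht
    simp only [state_eq_stateAfter]
    rw [this]
    congr 1
    refine Finset.sum_congr rfl fun k _ => ?_
    rw [Policy.jump, epoch]
    ring
  have hm : ∀ {h : ℝ → ℕ → ℝ} (_ : ∀ x, Measurable fun t => h t x),
      Measurable fun t => h t (π.state ω t) := fun hh => measurable_comp_state π hh h0.2 0 ω
  have hi : ∀ {h : ℝ → ℕ → ℝ} (_ : ∀ x, Measurable fun t => h t x) {b : ℝ} (_ : ∀ t x, |h t x| ≤ b)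
      (c d : ℝ), IntervalIntegrable (fun t => h t (π.state ω t)) volume c d := fun hh b hb =>
    intervalIntegrable_of_bounded (hm hh) fun t => hb _ _
  have hint : ∫ t in 0..Q.T, (Ioi s).indicator 1 t * π.rate v t (π.state ω t) =
      (∫ t in s..Q.T, Q.timeDeriv v t (π.state ω t)) +
        ∫ t in s..Q.T, π.running t (π.state ω t) := by
    rw [← intervalIntegral.integral_add (hi measurable_timeDeriv hM _ _)
      (hi π.measurable_running hMr _ _), intervalIntegral.integral_of_le Q.T_pos.le,
      intervalIntegral.integral_of_le hsT.2]
    have e : Ioc s Q.T = Ioc 0 Q.T ∩ Ioi s := by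
      ext t; simp only [mem_Ioc, mem_inter_iff, mem_Ioi]; grind
    rw [e, ← setIntegral_indicator measurableSet_Ioi]
    refine integral_congr_ae (.of_forall fun t => ?_)
    by_cases ht : t ∈ Ioi s <;> simp [ht, Policy.rate]
  have hsum : ∑ k ∈ Finset.range (Q.totalEvents ω),
        (Ioi s).indicator 1 (Q.epoch (k + 1) ω) * π.jump v ω k =
      ∑ k ∈ Finset.range (Q.totalEvents ω), π.jump v ω k -
        ∑ k ∈ Finset.range (jumpCount Q.T (Q.path ω).events s), π.jump v ω k := by
    have hle : jumpCount Q.T (Q.path ω).events s ≤ Q.totalEvents ω :=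
      monotone_jumpCount hN hsT.2
    rw [← Finset.sum_range_add_sum_Ico _ hle, eq_sub_iff_add_eq', ← Finset.sum_range_add_sum_Ico
      _ hle, ← add_assoc]
    congr 1
    · rw [add_eq_left]
      refine Finset.sum_eq_zero fun k hk => ?_
      have h1 : Q.epoch (k + 1) ω ≤ s := (jumpTime_le_iff_le_jumpCount hN (n := k + 1)
        ((Finset.mem_range.1 hk).trans_le hle) hsT).2 (Finset.mem_range.1 hk)
      rw [indicator_of_notMem (notMem_Ioi.2 h1), zero_mul]
    · refine Finset.sum_congr rfl fun k hk => ?_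
      have hk' := Finset.mem_Ico.1 hk
      have h1 : ¬ Q.epoch (k + 1) ω ≤ s :=
        (jumpTime_le_iff_le_jumpCount hN (n := k + 1) hk'.2 hsT).not.2 (by omega)
      rw [indicator_of_mem (mem_Ioi.2 (not_le.1 h1)), Pi.one_apply, one_mul]
  have hrew := QueuePath.reward_state (p := π.clampedProb) (K := Q.K₁) (h := π.running)
    (G := Q.terminal) hw hsT.1 hsT.2 0
  have hterm : Q.terminal (π.state ω Q.T) = v Q.T (min (π.state ω Q.T) Q.C) := by
    rw [hvT _ (min_le_right _ _), terminal]
  have hadd := intervalIntegral.integral_add_adjacent_intervals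
    (hi (measurable_timeDeriv (Q := Q) (v := v)) hM 0 s) (hi measurable_timeDeriv hM s Q.T)
  have hT := hpath Q.T ⟨Q.T_pos.le, le_rfl⟩
  have hS := hpath s hsT
  change π.reward s (π.state ω s) ω = Q.K₁ *
    ((π.countsAfter ω (jumpCount Q.T (Q.path ω).events Q.T)).1 -
      (π.countsAfter ω (jumpCount Q.T (Q.path ω).events s)).1) +
    (∫ t in s..Q.T, π.running t (π.state ω t)) + Q.terminal (π.state ω Q.T) at hrew
  rw [hint, hsum, hrew, hterm]
  simp only [totalEvents]
  linarith

/-- All jumps have a common bound, since `v` is bounded and at most one customer is admitted at an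
event. -/
lemma exists_jump_le (π : Q.Policy) : ∃ c, ∀ ω k, |π.jump v ω k| ≤ c := by
  obtain ⟨M, hM⟩ := exists_value_le hv
  refine ⟨M + M + |Q.K₁|, fun ω k => ?_⟩
  have he : Q.epoch (k + 1) ω ∈ Icc 0 Q.T := jumpTime_mem Q.T_pos.le _
  have h1 : |((π.countsAfter ω (k + 1)).1 : ℝ) - (π.countsAfter ω k).1| ≤ 1 := by
    rcases QueuePath.counts_succ_cases (T := Q.T) (p := π.clampedProb) (w := Q.path ω) (t₀ := 0)
      (x₀ := 0) k with h | h | h <;> simp [Policy.countsAfter, h]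
  refine (abs_add_le _ _).trans (add_le_add ((abs_sub _ _).trans
    (add_le_add (hM _ (min_le_right _ _) _ he) (hM _ (min_le_right _ _) _ he))) ?_)
  rw [abs_mul]
  exact mul_le_of_le_one_right (abs_nonneg _) h1

end path

end QueueModel

/-! ### The expectation of the pathwise integral -/

/-- The generating sets of the predictable σ-algebra form a π-system. -/
lemma isPiSystem_predictable {Ω : Type*} {mΩ : MeasurableSpace Ω} (𝓕 : Filtration ℝ≥0 mΩ) :
    IsPiSystem ({s | ∃ A, MeasurableSet[𝓕 ⊥] A ∧ s = {⊥} ×ˢ A} ∪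
      {s | ∃ i A, MeasurableSet[𝓕 i] A ∧ s = Ioi i ×ˢ A}) := by
  rintro _ (⟨A, hA, rfl⟩ | ⟨i, A, hA, rfl⟩) _ (⟨B, hB, rfl⟩ | ⟨j, B, hB, rfl⟩) hne
  · exact Or.inl ⟨A ∩ B, hA.inter hB, by rw [prod_inter_prod, inter_self]⟩
  · obtain ⟨⟨t, ω⟩, ⟨rfl, _⟩, ⟨h, _⟩⟩ := hne
    exact absurd (mem_Ioi.1 h) not_lt_bot
  · obtain ⟨⟨t, ω⟩, ⟨h, _⟩, ⟨rfl, _⟩⟩ := hne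
    exact absurd (mem_Ioi.1 h) not_lt_bot
  · exact Or.inr ⟨max i j, A ∩ B, (𝓕.mono (le_max_left i j) _ hA).inter
      (𝓕.mono (le_max_right i j) _ hB), by rw [prod_inter_prod, Ioi_inter_Ioi]⟩

lemma predictable_le_prod {Ω : Type*} {mΩ : MeasurableSpace Ω} (𝓕 : Filtration ℝ≥0 mΩ) :
    𝓕.predictable ≤ Prod.instMeasurableSpace :=
  measurableSpace_le_predictable_of_measurableSet
    (fun A hA => (measurableSet_singleton _).prod (𝓕.le _ A hA))
    (fun _ A hA => measurableSet_Ioi.prod (𝓕.le _ A hA))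

lemma integrable_count_ite (n : ℕ) (g : ℕ → ℝ) :
    Integrable (fun k => if k < n then g k else 0) Measure.count :=
  integrable_count_iff.2 (summable_of_ne_finset_zero (s := Finset.range n) fun k hk => by
    rw [if_neg (by simpa using hk), norm_zero])

lemma integral_count_ite (n : ℕ) (g : ℕ → ℝ) :
    ∫ k, (if k < n then g k else 0) ∂Measure.count = ∑ k ∈ Finset.range n, g k := by
  rw [integral_countable (integrable_count_ite n g),
    tsum_eq_sum (s := Finset.range n) fun k hk => by rw [if_neg (by simpa using hk), smul_zero]]
  refine Finset.sum_congr rfl fun k hk => ?_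
  rw [if_pos (Finset.mem_range.1 hk)]
  simp

namespace QueueModel

variable {Ω : Type*} [MeasurableSpace Ω] {P : Measure Ω} {Q : QueueModel Ω P}
  {v : ℝ → ℕ → ℝ}

lemma measurable_stateAfter (π : Q.Policy) (k : ℕ) : Measurable fun ω => π.stateAfter ω k :=
  (measurable_of_countable fun z : ℕ × ℕ => 0 + z.1 - z.2).comp
    (Q.isRandomDriver_path.measurable_counts π.measurable_clampedProb Q.T_pos.le 0 k)

lemma measurable_epoch (k : ℕ) : Measurable (Q.epoch k) :=
  Q.isRandomDriver_path.measurable_jumpTime Q.T_pos.le k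

lemma measurable_totalEvents : Measurable Q.totalEvents :=
  (Q.isRandomDriver_path.events _).sub (Q.isRandomDriver_path.events 0)

lemma measurable_rate (π : Q.Policy) (x : ℕ) : Measurable fun t => π.rate v t x :=
  (measurable_timeDeriv x).add (π.measurable_running x)

/-- The density of the absolutely continuous part of the pathwise integral, as a function on
`Ω × ℝ`. -/
noncomputable def Policy.rateAt (π : Q.Policy) (v : ℝ → ℕ → ℝ) (z : Ω × ℝ) : ℝ :=
  π.rate v z.2 (π.state z.1 z.2)

/-- The density of the discrete part of the pathwise integral, as a function on `Ω × ℕ`. -/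
noncomputable def Policy.jumpAt (π : Q.Policy) (v : ℝ → ℕ → ℝ) (z : Ω × ℕ) : ℝ :=
  if z.2 < Q.totalEvents z.1 then π.jump v z.1 z.2 else 0

lemma measurable_rateAt (π : Q.Policy) : Measurable (π.rateAt v) := by
  have h := Q.isRandomDriver_path.measurable_comp_state (h := π.rate v) π.measurable_clampedProb
    Q.T_pos.le 0 (measurable_rate π)
  have h' := h.comp (measurable_swap (α := Ω) (β := ℝ))
  simp only [Function.comp_def, Prod.fst_swap, Prod.snd_swap] at h'
  exact h'

/-- The time and the chance at which the integrand is evaluated by the absolutely continuous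
part. -/
noncomputable def timePoint (z : Ω × ℝ) : ℝ≥0 × Ω := (z.2.toNNReal, z.1)

/-- The time and the chance at which the integrand is evaluated by the discrete part. -/
noncomputable def eventPoint (Q : QueueModel Ω P) (z : Ω × ℕ) : ℝ≥0 × Ω :=
  ((Q.epoch (z.2 + 1) z.1).toNNReal, z.1)

lemma measurable_timePoint : Measurable (timePoint : Ω × ℝ → ℝ≥0 × Ω) :=
  measurable_snd.real_toNNReal.prodMk measurable_fst

lemma measurable_eventPoint : Measurable Q.eventPoint :=
  (measurable_from_prod_countable_left (f := fun z : Ω × ℕ => Q.epoch (z.2 + 1) z.1)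
    fun k => Q.measurable_epoch (k + 1)).real_toNNReal.prodMk measurable_fst

section

variable (hv : ∀ x ≤ Q.C, ContDiffOn ℝ 1 (fun t => v t x) (Icc 0 Q.T))
include hv

lemma measurable_jump (π : Q.Policy) (k : ℕ) : Measurable fun ω => π.jump v ω k := by
  have hclamp : ∀ x, Measurable fun t => v (max 0 (min t Q.T)) (min x Q.C) := fun x =>
    ((hv _ (min_le_right x Q.C)).continuousOn.comp_continuous (by fun_prop) Q.clamp_mem).measurable
  have h : ∀ n, Measurable fun ω => v (Q.epoch (k + 1) ω) (min (π.stateAfter ω n) Q.C) := by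
    intro n
    have h1 := (measurable_from_prod_countable_right
      (f := fun z : ℕ × ℝ => v (max 0 (min z.2 Q.T)) (min z.1 Q.C)) hclamp).comp
        ((measurable_stateAfter π n).prodMk (Q.measurable_epoch (k + 1)))
    have he : ∀ ω, max 0 (min (Q.epoch (k + 1) ω) Q.T) = Q.epoch (k + 1) ω := fun ω =>
      clamp_of_mem (jumpTime_mem Q.T_pos.le _)
    simpa only [Function.comp_def, he] using h1
  have hA : ∀ n, Measurable fun ω => ((π.countsAfter ω n).1 : ℝ) := fun n =>
    (measurable_of_countable fun z : ℕ × ℕ => (z.1 : ℝ)).comp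
      (Q.isRandomDriver_path.measurable_counts π.measurable_clampedProb Q.T_pos.le 0 n)
  exact ((h (k + 1)).sub (h k)).add (((hA (k + 1)).sub (hA k)).const_mul Q.K₁)

lemma measurable_jumpAt (π : Q.Policy) : Measurable (π.jumpAt v) :=
  measurable_from_prod_countable_left fun k =>
    Measurable.ite (measurableSet_lt measurable_const measurable_totalEvents)
      (measurable_jump hv π k) measurable_const

variable [IsProbabilityMeasure P]

lemma integrable_rateAt (π : Q.Policy) :
    Integrable (π.rateAt v) (P.prod (volume.restrict (Ioc 0 Q.T))) := by
  obtain ⟨M, hM⟩ := exists_timeDeriv_le hv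
  obtain ⟨Mr, hMr⟩ := π.exists_running_le
  exact Integrable.of_bound (measurable_rateAt π).aestronglyMeasurable (M + Mr)
    (.of_forall fun z => (abs_add_le _ _).trans (add_le_add (hM _ _) (hMr _ _)))

omit [IsProbabilityMeasure P] in
/-- The jumps are bounded and the number of events has a finite mean. -/
lemma integrable_jumpAt (π : Q.Policy) : Integrable (π.jumpAt v) (P.prod Measure.count) := by
  obtain ⟨c, hc⟩ := exists_jump_le hv π
  have hm := measurable_jumpAt hv π
  have hnorm : ∀ ω, ∫ k, ‖π.jumpAt v (ω, k)‖ ∂Measure.count =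
      ∑ k ∈ Finset.range (Q.totalEvents ω), |π.jump v ω k| := by
    intro ω
    rw [← integral_count_ite]
    refine integral_congr_ae (.of_forall fun k => ?_)
    simp only [Policy.jumpAt]
    split_ifs <;> simp
  have hint : ∀ ω, Integrable (fun k => π.jumpAt v (ω, k)) Measure.count := fun ω =>
    integrable_count_ite (Q.totalEvents ω) (π.jump v ω)
  rw [integrable_prod_iff hm.aestronglyMeasurable]
  refine ⟨.of_forall hint, ?_⟩
  have hm' : StronglyMeasurable fun ω => ∫ k, ‖π.jumpAt v (ω, k)‖ ∂Measure.count :=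
    hm.stronglyMeasurable.norm.integral_prod_right'
  refine (Q.integrable_events.const_mul c).mono' hm'.aestronglyMeasurable (.of_forall fun ω => ?_)
  rw [hnorm, Real.norm_of_nonneg (Finset.sum_nonneg fun _ _ => abs_nonneg _)]
  refine (Finset.sum_le_sum fun k _ => hc ω k).trans ?_
  rw [Finset.sum_const, Finset.card_range, nsmul_eq_mul, mul_comm]
  have h2 : (Q.totalEvents ω : ℝ) ≤ (Q.path ω).events Q.T := by
    exact_mod_cast Q.numEvents_le 0 Q.T ω Q.T_pos.le
  exact mul_le_mul_of_nonneg_left h2 ((abs_nonneg _).trans (hc ω 0))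

/-- The expectation of the pathwise integral, as the sum of an integral over `Ω × ℝ` and an integral
over `Ω × ℕ`. -/
lemma integral_tdIntegral (π : Q.Policy) {ξ : ℝ≥0 → Ω → ℝ}
    (hξ : StronglyMeasurable (Function.uncurry ξ)) {B : ℝ} (hB : ∀ t ω, |ξ t ω| ≤ B) :
    ∫ ω, tdIntegral π v ξ ω ∂P =
      (∫ z, Function.uncurry ξ (timePoint z) * π.rateAt v z
        ∂(P.prod (volume.restrict (Ioc 0 Q.T)))) +
      ∫ z, Function.uncurry ξ (Q.eventPoint z) * π.jumpAt v z ∂(P.prod Measure.count) := by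
  have hi1 : Integrable (fun z => Function.uncurry ξ (timePoint z) * π.rateAt v z)
      (P.prod (volume.restrict (Ioc 0 Q.T))) := (integrable_rateAt hv π).bdd_mul
    (hξ.comp_measurable measurable_timePoint).aestronglyMeasurable (c := B)
    (.of_forall fun z => hB _ _)
  have hi2 : Integrable (fun z => Function.uncurry ξ (Q.eventPoint z) * π.jumpAt v z)
      (P.prod Measure.count) := (integrable_jumpAt hv π).bdd_mul
    (hξ.comp_measurable Q.measurable_eventPoint).aestronglyMeasurable (c := B)
    (.of_forall fun z => hB _ _)
  rw [integral_prod _ hi1, integral_prod _ hi2, ← integral_add hi1.integral_prod_left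
    hi2.integral_prod_left]
  refine integral_congr_ae ?_
  filter_upwards [Q.ae_unif_nonneg] with ω hω
  have hm : Measurable fun t : ℝ => ξ t.toNNReal ω :=
    (hξ.comp_measurable (measurable_timePoint.comp measurable_prodMk_left)).measurable
  rw [tdIntegral_eq hv π hω hm hB, intervalIntegral.integral_of_le Q.T_pos.le]
  congr 1
  have h : ∀ k, Function.uncurry ξ (Q.eventPoint (ω, k)) * π.jumpAt v (ω, k) =
      if k < Q.totalEvents ω then ξ (Q.epoch (k + 1) ω).toNNReal ω * π.jump v ω k else 0 :=
    fun k => by rw [Policy.jumpAt, mul_ite, mul_zero]; rfl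
  simp only [h]
  rw [integral_count_ite]

omit [IsProbabilityMeasure P] in
/-- The pathwise integral depends only on the integrand in `(0, T]`. -/
lemma tdIntegral_congr (π : Q.Policy) {ω : Ω} (hω : ∀ k, 0 ≤ Q.unif k ω) {ξ ξ' : ℝ≥0 → Ω → ℝ}
    (hξ : StronglyMeasurable (Function.uncurry ξ)) (hξ' : StronglyMeasurable (Function.uncurry ξ'))
    {B : ℝ} (hB : ∀ t ω, |ξ t ω| ≤ B) (hB' : ∀ t ω, |ξ' t ω| ≤ B)
    (h : ∀ t : ℝ≥0, 0 < t → (t : ℝ) ≤ Q.T → ξ t ω = ξ' t ω) :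
    tdIntegral π v ξ ω = tdIntegral π v ξ' ω := by
  have hm : ∀ {ξ : ℝ≥0 → Ω → ℝ}, StronglyMeasurable (Function.uncurry ξ) →
      Measurable fun t : ℝ => ξ t.toNNReal ω := fun hξ =>
    (hξ.comp_measurable (measurable_timePoint.comp measurable_prodMk_left)).measurable
  have h' : ∀ t : ℝ, 0 < t → t ≤ Q.T → ξ t.toNNReal ω = ξ' t.toNNReal ω := fun t h0 hT =>
    h _ (Real.toNNReal_pos.2 h0) (by rwa [Real.coe_toNNReal _ h0.le])
  rw [tdIntegral_eq hv π hω (hm hξ) hB, tdIntegral_eq hv π hω (hm hξ') hB',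
    intervalIntegral.integral_of_le Q.T_pos.le, intervalIntegral.integral_of_le Q.T_pos.le]
  congr 1
  · refine setIntegral_congr_fun measurableSet_Ioc fun t ht => ?_
    simp only [h' t ht.1 ht.2]
  · refine Finset.sum_congr rfl fun k hk => ?_
    have he : Q.epoch (k + 1) ω ∈ Icc 0 Q.T := jumpTime_mem Q.T_pos.le _
    have he0 : ¬ Q.epoch (k + 1) ω ≤ 0 := by
      have h0 := jumpTime_le_iff_le_jumpCount (Q.isRandomDriver_path.counting ω).events
        (n := k + 1) (Finset.mem_range.1 hk) (s := 0) ⟨le_rfl, Q.T_pos.le⟩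
      rw [jumpCount_of_mem ⟨le_rfl, Q.T_pos.le⟩, Nat.sub_self] at h0
      exact h0.not.2 (by omega)
    rw [h' _ (not_le.1 he0) he.2]

omit [IsProbabilityMeasure P] in
/-- The pathwise integral of the indicator of `(s, ∞) × A`. -/
lemma tdIntegral_indicator (hvT : ∀ x ≤ Q.C, v Q.T x = -Q.K₃ * x) (π : Q.Policy) {ω : Ω}
    (hω : ∀ k, 0 ≤ Q.unif k ω) {s : ℝ≥0} (hs : (s : ℝ) < Q.T) (A : Set Ω) :
    tdIntegral π v (fun t ω => (Ioi s ×ˢ A).indicator 1 (t, ω)) ω =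
      A.indicator (fun ω => π.reward s (π.state ω s) ω - v s (min (π.state ω s) Q.C)) ω := by
  have h1 : ∀ t : ℝ, (Ioi s ×ˢ A).indicator (1 : ℝ≥0 × Ω → ℝ) (t.toNNReal, ω) =
      (Ioi (s : ℝ)).indicator 1 t * A.indicator 1 ω := by
    intro t
    have h2 : s < t.toNNReal ↔ (s : ℝ) < t := Real.lt_toNNReal_iff_coe_lt
    by_cases ht : (s : ℝ) < t <;> by_cases hA : ω ∈ A <;> simp [indicator, ht, hA, h2]
  have hm : Measurable fun t : ℝ => (Ioi s ×ˢ A).indicator (1 : ℝ≥0 × Ω → ℝ) (t.toNNReal, ω) := by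
    simp only [h1]
    exact (measurable_one.indicator measurableSet_Ioi).mul_const _
  rw [tdIntegral_eq hv π hω hm (B := 1) fun t ω => by
    by_cases h : (t, ω) ∈ Ioi s ×ˢ A <;> simp [h]]
  simp only [h1]
  by_cases hA : ω ∈ A
  · simp only [indicator_of_mem hA, Pi.one_apply, mul_one]
    exact integral_add_sum_indicator_Ioi hv hvT π ω ⟨s.2, hs⟩
  · simp [indicator_of_notMem hA]

end

end QueueModel

/-! ### Martingale orthogonality characterizes the value function -/

namespace QueueModel

variable {Ω : Type*} [MeasurableSpace Ω] {P : Measure Ω} [IsProbabilityMeasure P]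
  {Q : QueueModel Ω P} {v : ℝ → ℕ → ℝ}

/-- Given the terminal condition, martingale orthogonality only has to be tested with the indicators
of the sets `(s, ∞) × A`, for which the pathwise integral is explicit. The other generators
`{0} × A` of the predictable σ-algebra and the sets with `s ≥ T` do not meet `(0, T] × Ω`. -/
theorem martingaleOrthogonality_iff
    (hv : ∀ x ≤ Q.C, ContDiffOn ℝ 1 (fun t => v t x) (Icc 0 Q.T)) (π : Q.Policy)
    (hvT : ∀ x ≤ Q.C, v Q.T x = -Q.K₃ * x) :
    MartingaleOrthogonality π v ↔ ∀ s : ℝ≥0, (s : ℝ) < Q.T → ∀ A,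
      MeasurableSet[naturalFiltration π s] A →
        ∫ ω in A, (π.reward s (π.state ω s) ω - v s (min (π.state ω s) Q.C)) ∂P = 0 := by
  have hind : ∀ {s : ℝ≥0}, (s : ℝ) < Q.T → ∀ {A : Set Ω}, MeasurableSet A →
      ∫ ω, tdIntegral π v (fun t ω => (Ioi s ×ˢ A).indicator 1 (t, ω)) ω ∂P =
        ∫ ω in A, (π.reward s (π.state ω s) ω - v s (min (π.state ω s) Q.C)) ∂P := by
    intro s hs A hA
    rw [← integral_indicator hA]
    refine integral_congr_ae ?_
    filter_upwards [Q.ae_unif_nonneg] with ω hω using tdIntegral_indicator hv hvT π hω hs A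
  have hbd : ∀ (S : Set (ℝ≥0 × Ω)) t ω, |S.indicator (1 : ℝ≥0 × Ω → ℝ) (t, ω)| ≤ 1 :=
    fun S t ω => by by_cases h : (t, ω) ∈ S <;> simp [h]
  constructor
  · intro h s hs A hA
    rw [← hind hs ((naturalFiltration π).le s A hA)]
    exact h _ (stronglyMeasurable_one.indicator (measurableSet_predictable_Ioi_prod hA))
      ⟨1, hbd _⟩
  · rintro h ξ hξ ⟨B, hB⟩
    have hle := predictable_le_prod (naturalFiltration π)
    rw [integral_tdIntegral hv π (hξ.mono hle) hB]
    refine integral_comp_mul_add_eq_zero (m := (naturalFiltration π).predictable) rfl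
      (isPiSystem_predictable (naturalFiltration π)) (measurable_rateAt π) (measurable_jumpAt hv π)
      (integrable_rateAt hv π) (integrable_jumpAt hv π) (measurable_timePoint.mono le_rfl hle)
      (Q.measurable_eventPoint.mono le_rfl hle) (fun S hS => ?_) hξ fun z => hB z.1 z.2
    have hm : ∀ {S : Set (ℝ≥0 × Ω)}, MeasurableSet S → StronglyMeasurable
        (Function.uncurry fun t ω => S.indicator (1 : ℝ≥0 × Ω → ℝ) (t, ω)) := fun hS =>
      stronglyMeasurable_one.indicator hS
    have hSm : MeasurableSet S := by
      rcases hS with rfl | hS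
      · exact MeasurableSet.univ
      · exact hle S (MeasurableSpace.measurableSet_generateFrom hS)
    refine (integral_tdIntegral hv π (hm hSm) (hbd S)).symm.trans ?_
    -- only the trace of `S` on `(0, T] × Ω` matters
    have hcongr : ∀ {S' : Set (ℝ≥0 × Ω)}, MeasurableSet S' →
        (∀ t : ℝ≥0, 0 < t → (t : ℝ) ≤ Q.T → ∀ ω, (t, ω) ∈ S ↔ (t, ω) ∈ S') →
        ∫ ω, tdIntegral π v (fun t ω => S.indicator 1 (t, ω)) ω ∂P =
          ∫ ω, tdIntegral π v (fun t ω => S'.indicator 1 (t, ω)) ω ∂P := by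
      intro S' hS' hSS'
      refine integral_congr_ae ?_
      filter_upwards [Q.ae_unif_nonneg] with ω hω
      refine tdIntegral_congr hv π hω (hm hSm) (hm hS') (hbd S) (hbd S') fun t h0 hT => ?_
      by_cases ht : (t, ω) ∈ S'
      · rw [indicator_of_mem ht, indicator_of_mem ((hSS' t h0 hT ω).2 ht)]
      · rw [indicator_of_notMem ht, indicator_of_notMem ((hSS' t h0 hT ω).not.2 ht)]
    have hempty : (∀ t : ℝ≥0, 0 < t → (t : ℝ) ≤ Q.T → ∀ ω, (t, ω) ∉ S) →
        ∫ ω, tdIntegral π v (fun t ω => S.indicator 1 (t, ω)) ω ∂P = 0 := by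
      intro hS0
      rw [hcongr MeasurableSet.empty fun t h0 hT ω => iff_of_false (hS0 t h0 hT ω) (by simp),
        integral_tdIntegral hv π (hm MeasurableSet.empty) (hbd ∅)]
      simp [Function.uncurry_def]
    have hIoi : ∀ {s : ℝ≥0}, (s : ℝ) < Q.T → ∀ {A : Set Ω}, MeasurableSet[naturalFiltration π s] A →
        ∫ ω, tdIntegral π v (fun t ω => (Ioi s ×ˢ A).indicator 1 (t, ω)) ω ∂P = 0 :=
      fun hs A hA => (hind hs ((naturalFiltration π).le _ A hA)).trans (h _ hs A hA)
    rcases hS with rfl | ⟨A, hA, rfl⟩ | ⟨s, A, hA, rfl⟩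
    · rw [hcongr (S' := Ioi 0 ×ˢ univ) (measurableSet_Ioi.prod MeasurableSet.univ)
        fun t h0 _ ω => by simp [h0]]
      exact hIoi (s := 0) Q.T_pos MeasurableSet.univ
    · exact hempty fun t h0 _ ω hω => h0.ne' hω.1
    · rcases lt_or_ge (s : ℝ) Q.T with hs | hs
      · exact hIoi hs hA
      · exact hempty fun t _ hT ω hω => absurd (NNReal.coe_lt_coe.2 hω.1) (not_lt.2 (hT.trans hs))

omit [IsProbabilityMeasure P] in
lemma setOf_state_eq (π : Q.Policy) (t : ℝ) (x : ℕ) :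
    {ω | π.state ω t = x} = {ω | queue π 0 0 t ω = x} := by
  ext ω
  rw [mem_ofPred_eq, mem_ofPred_eq, queue_eq π ⟨le_rfl, Q.T_pos.le⟩, Policy.state]

/-- By the Markov property, the expected reward after time `s` on an event of the past is given by
the value function. -/
lemma setIntegral_reward_sub (π : Q.Policy) {s : ℝ≥0} (hs : (s : ℝ) ≤ Q.T) {A : Set Ω}
    (hA : MeasurableSet[naturalFiltration π s] A) :
    ∫ ω in A, (π.reward s (π.state ω s) ω - v s (min (π.state ω s) Q.C)) ∂P =
      ∑ x ∈ Finset.range (Q.C + 1), P.real (A ∩ {ω | queue π 0 0 s ω = x}) *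
        (valueFunction π s x - v s x) := by
  have hsT : (s : ℝ) ∈ Icc 0 Q.T := ⟨s.2, hs⟩
  have hAm : MeasurableSet A := (naturalFiltration π).le s A hA
  have hXm : ∀ x, MeasurableSet {ω | queue π 0 0 s ω = x} := fun x =>
    (naturalFiltration π).le s _ (measurableSet_queue_eq π s x)
  have hi : ∀ x, Integrable (fun ω => π.reward s x ω - v s x) P := fun x =>
    (integrable_reward π hsT x).sub (integrable_const _)
  have h1 : ∫ ω in A, (π.reward s (π.state ω s) ω - v s (min (π.state ω s) Q.C)) ∂P =
      ∫ ω in A, ∑ x ∈ Finset.range (Q.C + 1),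
        {ω | queue π 0 0 s ω = x}.indicator (fun ω => π.reward s x ω - v s x) ω ∂P := by
    refine integral_congr_ae (ae_restrict_of_ae ?_)
    filter_upwards [Q.ae_unif_nonneg] with ω hω
    have hC : π.state ω s ≤ Q.C := state_le_capacity π hω Q.T_pos.le (Nat.zero_le _) s
    rw [Finset.sum_eq_single_of_mem (π.state ω s) (Finset.mem_range_succ_iff.2 hC), min_eq_left hC,
      ← setOf_state_eq, indicator_of_mem (by rfl)]
    intro x _ hx
    rw [← setOf_state_eq]
    exact indicator_of_notMem (fun h => hx h.symm) _
  rw [h1, integral_finsetSum _ fun x _ => ((hi x).indicator (hXm x)).integrableOn]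
  refine Finset.sum_congr rfl fun x hx => ?_
  have hpast := isPastEvent_of_measurableSet π hs (hA.inter (measurableSet_queue_eq π s x))
  rw [setIntegral_indicator (hXm x), integral_sub (integrable_reward π hsT x).integrableOn
    (integrable_const _), setIntegral_reward π hsT (Finset.mem_range_succ_iff.1 hx) hpast,
    setIntegral_const, smul_eq_mul, mul_sub]

lemma valueFunction_terminal (π : Q.Policy) {x : ℕ} (hx : x ≤ Q.C) :
    valueFunction π Q.T x = -Q.K₃ * x := by
  have h : ∀ ω, π.reward Q.T x ω = -Q.K₃ * x := fun ω => by
    rw [Policy.reward, QueuePath.reward, QueuePath.state, QueuePath.countsAt_self le_rfl]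
    simp [terminal, hx]
  rw [valueFunction_eq π ⟨Q.T_pos.le, le_rfl⟩ hx]
  simp [h]

/-- A function that satisfies both conditions agrees with the value function at the states that are
occupied with positive probability. -/
lemma eq_valueFunction_of_prob_pos
    (hv : ∀ x ≤ Q.C, ContDiffOn ℝ 1 (fun t => v t x) (Icc 0 Q.T)) (π : Q.Policy)
    (hvT : ∀ x ≤ Q.C, v Q.T x = -Q.K₃ * x) (h : MartingaleOrthogonality π v) {t : ℝ}
    (ht : t ∈ Ico 0 Q.T) {x : ℕ} (hx : x ≤ Q.C) (hpos : 0 < P {ω | queue π 0 0 t ω = x}) :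
    v t x = valueFunction π t x := by
  have hF := measurableSet_queue_eq π ⟨t, ht.1⟩ x
  have h1 := (martingaleOrthogonality_iff hv π hvT).1 h ⟨t, ht.1⟩ ht.2 _ hF
  rw [setIntegral_reward_sub π (s := ⟨t, ht.1⟩) ht.2.le hF,
    Finset.sum_eq_single_of_mem x (Finset.mem_range_succ_iff.2 hx)] at h1
  · rw [inter_self, mul_eq_zero] at h1
    rcases h1 with h1 | h1
    · exact absurd h1 (ENNReal.toReal_pos hpos.ne' (measure_ne_top _ _)).ne'
    · exact (sub_eq_zero.1 h1).symm
  · intro y _ hy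
    have : ({ω | queue π 0 0 t ω = x} ∩ {ω | queue π 0 0 t ω = y} : Set Ω) = ∅ := by
      ext ω
      simp only [mem_inter_iff, mem_ofPred_eq, mem_empty_iff_false, iff_false, not_and]
      exact fun h1 h2 => hy (h2.symm.trans h1)
    change P.real ({ω | queue π 0 0 t ω = x} ∩ {ω | queue π 0 0 t ω = y}) * _ = 0
    rw [this, measureReal_empty, zero_mul]

/-- States that are not accessible from time `t` on are not occupied at time `t` and do not contribute
to the expectation in `setIntegral_reward_sub`. Conversely, `eq_valueFunction_of_prob_pos` applies at
an accessible state at all times shortly after `t`, and both sides are right-continuous at `t`. -/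
theorem eq_valueFunction_iff (hv : ∀ x ≤ Q.C, ContDiffOn ℝ 1 (fun t => v t x) (Icc 0 Q.T))
    (π : Q.Policy) :
    (∀ t ∈ Icc 0 Q.T, ∀ x ≤ Q.C, Accessible π t x → v t x = valueFunction π t x) ↔
      (∀ x ≤ Q.C, v Q.T x = -Q.K₃ * x) ∧ MartingaleOrthogonality π v := by
  constructor
  · intro h
    have hvT : ∀ x ≤ Q.C, v Q.T x = -Q.K₃ * x := fun x hx =>
      (h Q.T ⟨Q.T_pos.le, le_rfl⟩ x hx fun s h1 h2 => absurd h2 (not_le.2 h1)).trans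
        (valueFunction_terminal π hx)
    refine ⟨hvT, (martingaleOrthogonality_iff hv π hvT).2 fun s hs A hA => ?_⟩
    rw [setIntegral_reward_sub π hs.le hA]
    refine Finset.sum_eq_zero fun x hx => ?_
    by_cases hacc : Accessible π s x
    · rw [h s ⟨s.2, hs.le⟩ x (Finset.mem_range_succ_iff.1 hx) hacc, sub_self, mul_zero]
    · have h0 : P (A ∩ {ω | queue π 0 0 s ω = x}) = 0 := measure_mono_null inter_subset_right
        (prob_queue_eq_zero_of_not_accessible π s.2 hacc)
      rw [measureReal_def, h0, ENNReal.toReal_zero, zero_mul]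
  · rintro ⟨hvT, h⟩ t ht x hx hacc
    rcases ht.2.eq_or_lt with rfl | htT
    · rw [hvT x hx, valueFunction_terminal π hx]
    -- the state `x` may have probability zero at time `t` itself, but not shortly after
    have hcont : Filter.Tendsto (fun s => v s x) (nhdsWithin t (Ioi t)) (nhds (v t x)) :=
      (((hv x hx).continuousOn t ht).mono_of_mem_nhdsWithin
        (Filter.mem_of_superset (Ioo_mem_nhdsGT htT) fun s hs =>
          ⟨ht.1.trans hs.1.le, hs.2.le⟩)).tendsto
    refine tendsto_nhds_unique (hcont.congr' ?_) (tendsto_valueFunction π ⟨ht.1, htT⟩ hx)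
    filter_upwards [Ioo_mem_nhdsGT htT] with s hs
    exact eq_valueFunction_of_prob_pos hv π hvT h ⟨ht.1.trans hs.1.le, hs.2⟩ hx
      (hacc s hs.1 hs.2.le)

end QueueModel

theorem mainTheorem8 {Ω : Type*} [MeasurableSpace Ω] {P : Measure Ω} [IsProbabilityMeasure P]
    (Q : QueueModel Ω P) (π : Q.Policy) (v : ℝ → ℕ → ℝ)
    (hv : ∀ x ≤ Q.C, ContDiffOn ℝ 1 (fun t => v t x) (Icc 0 Q.T)) :
    ((∀ t ∈ Icc 0 Q.T, ∀ x ≤ Q.C, QueueModel.Accessible π t x →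
          v t x = QueueModel.valueFunction π t x) ↔
        (∀ x ≤ Q.C, v Q.T x = -Q.K₃ * x) ∧ QueueModel.MartingaleOrthogonality π v) ∧
      ((∀ t ∈ Ioc 0 Q.T, ∀ x ≤ Q.C, 0 < P {ω | QueueModel.queue π 0 0 t ω = x}) →
        ((∀ t ∈ Icc 0 Q.T, ∀ x ≤ Q.C, v t x = QueueModel.valueFunction π t x) ↔
          (∀ x ≤ Q.C, v Q.T x = -Q.K₃ * x) ∧ QueueModel.MartingaleOrthogonality π v)) := by
  refine ⟨QueueModel.eq_valueFunction_iff hv π, fun hpos => ?_⟩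
  rw [← QueueModel.eq_valueFunction_iff hv π]
  refine ⟨fun h t ht x hx _ => h t ht x hx, fun h t ht x hx => h t ht x hx fun s hts hsT => ?_⟩
  exact hpos s ⟨ht.1.trans_lt hts, hsT⟩ x hx
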